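/- For $n\ge 1$ let $\omega=e^{2\pi i/3}$ and $$Q_n(z_1,\dots,z_n,y)=y+\left(\frac{z_1+\omega}{z_1+1}\right)\cdots\left(\frac{z_n+\omega}{z_n+1}\right),$$ and let $\mathrm m(P)=\frac1{(2\pi)^N}\int_{[0,2\pi]^N}\log|P(e^{i\theta_1},\dots,e^{i\theta_N})|\,d\theta$ denote the (logarithmic) Mahler measure of a rational function in $N$ variables. Let $\zeta$ be the Riemann zeta function and $L(\chi_{-3},s)$ the Dirichlet $L$-function of the odd character of conductor $3$ (both analytically continued). Define polynomials $R_k,S_k,P_k,\mathsf Q_k,Y_k,Z_k\in\mathbb Q[x]$, $k\ge0$, recursively as follows. For $T\in\{R,S,P,\mathsf Q,Y,Z\}$, $$T_k(x)=\frac1{k+1}\sum_{\substack{1<j\le k+1\\ j\text{ odd}}}(-1)^{\frac{j+1}2}\binom{k+1}j\kappa_T^{\,j-1}\,T_{k+1-j}(x)+T^0_k(x),$$ with $\kappa_R=\kappa_S=\kappa_Y=3$, $\kappa_P=\kappa_{\mathsf Q}=\kappa_Z=6$; the sums below being over $0\le j\le k+1$, $$R^0_k=\tfrac{1}{2(k+1)}\sum_{j\text{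 even}}(-1)^{\frac j2}\tbinom{k+1}j(2^j+1)x^{k+1-j},\qquad S^0_k=\tfrac{1}{2(k+1)}\sum_{j\text{ odd}}(-1)^{\frac{j+1}2}\tbinom{k+1}j(2^j-1)x^{k+1-j},$$ $$P^0_k=\tfrac{1}{2(k+1)}\sum_{j\text{ even}}(-1)^{\frac j2}\tbinom{k+1}j(5^j+1)x^{k+1-j},\qquad \mathsf Q^0_k=\tfrac{1}{2(k+1)}\sum_{j\text{ odd}}(-1)^{\frac{j-1}2}\tbinom{k+1}j(5^j-1)x^{k+1-j},$$ $$Y^0_k=-\tfrac1{k+1}\Big[x^{k+1}+\sum_{j\text{ even}}(-1)^{\frac j2}\tbinom{k+1}j3^jx^{k+1-j}\Big],\qquad Z^0_k=-\tfrac2{k+1}\sum_{j\text{ even}}(-1)^{\frac j2}\tbinom{k+1}j3^jx^{k+1-j}.$$ Their coefficients are denoted by the corresponding lower-case letters: for $T\in\{R,P,Y,Z\}$, $t_{2m,j}$ is the coefficient of $x^{2j-1}$ in $T_{2m}$ ($j\ge1$) and $t_{2m-1,j}$ that of $x^{2j}$ in $T_{2m-1}$ ($j\ge 0$); for $T\in\{S,\mathsf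 Q\}$, $t_{2m-1,j}$ is the coefficient of $x^{2j-1}$ in $T_{2m-1}$ ($j\ge1$) and $t_{2m,j}$ that of $x^{2j}$ in $T_{2m}$ ($j\ge0$); a coefficient beyond the degree is $0$. Define real numbers $a_{n,j},b_{n,j},c_{n,j}$ ($0\le j\le n-1$) and $d_{n,j}$ ($0\le j\le n$) by $d_{0,0}=1$ and the following recursion, where $1\le h\le n+1$ for $a_{n+1,h-1}$, $1\le h\le n$ for $b_{n+1,h}$, and $n\ge0$: $$a_{n+1,h-1}=\tfrac1{\sqrt3}\sum_{l=h}^n c_{n,l-1}(2^{2l-2h+1}s_{2l-1,h}+q_{2l-1,h})+\sum_{l=h-1}^n d_{n,l}(2^{2l-2h+2}r_{2l,h}+p_{2l,h}),$$ $$b_{n+1,0}=\tfrac13\sum_{l=1}^n c_{n,l-1}\big(2^{2l}(2r_{2l-1,0}+y_{2l-1,0})+2p_{2l-1,0}+z_{2l-1,0}\big)+\tfrac2{\sqrt3}\sum_{l=0}^n d_{n,l}(2^{2l+1}s_{2l,0}+q_{2l,0}),$$ $$b_{n+1,h}=\sum_{l=h}^n c_{n,l-1}(2^{2l-2h}r_{2l-1,h}+p_{2l-1,h})+\tfrac1{\sqrt3}\sum_{l=h-1}^n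 d_{n,l}(2^{2l-2h+1}s_{2l,h}+q_{2l,h}),$$ and, for $n\ge1$ and $1\le h\le n$, $$c_{n,h-1}=\tfrac1{\sqrt3}\sum_{l=h}^n a_{n,l-1}(2^{2l-2h+1}s_{2l-1,h}+q_{2l-1,h})+\sum_{l=h-1}^{n-1} b_{n,l}(2^{2l-2h+2}r_{2l,h}+p_{2l,h}),$$ $$d_{n,0}=\tfrac13\sum_{l=1}^n a_{n,l-1}\big(2^{2l}(2r_{2l-1,0}+y_{2l-1,0})+2p_{2l-1,0}+z_{2l-1,0}\big)+\tfrac2{\sqrt3}\sum_{l=0}^{n-1} b_{n,l}(2^{2l+1}s_{2l,0}+q_{2l,0}),$$ $$d_{n,h}=\sum_{l=h}^n a_{n,l-1}(2^{2l-2h}r_{2l-1,h}+p_{2l-1,h})+\tfrac1{\sqrt3}\sum_{l=h}^{n-1} b_{n,l}(2^{2l-2h+1}s_{2l,h}+q_{2l,h}).$$ Then the integrals defining $\mathrm m(Q_n)$, $n\ge1$, converge absolutely; for $n\ge1$, $$\mathrm m(Q_{2n})=\frac2{12^n}\Bigg(\sum_{h=1}^n\frac{(-1)^ha_{n,h-1}}3(3^{2h+1}-1)(2^{2h+1}-1)\,\zeta'(-2h)+\sum_{h=0}^{n-1}\frac{(-1)^hb_{n,h}}{\sqrt3}(2^{2h+2}+1)\,L'(\chi_{-3},-2h-1)\Bigg),$$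 and for $n\ge0$, $$\mathrm m(Q_{2n+1})=\frac1{12^n}\Bigg(\sum_{h=1}^n\frac{(-1)^hc_{n,h-1}}{3\sqrt3}(3^{2h+1}-1)(2^{2h+1}-1)\,\zeta'(-2h)+\sum_{h=0}^{n}\frac{(-1)^hd_{n,h}}{3}(2^{2h+2}+1)\,L'(\chi_{-3},-2h-1)\Bigg).$$ Moreover $a_{n,j},d_{n,k}\in\mathbb Q$ and $b_{n,j},c_{n,j}\in\sqrt3\,\mathbb Q$ for $0\le j\le n-1$ and $0\le k\le n$, so that $\mathrm m(Q_{2n})$ and $\mathrm m(Q_{2n+1})$ are $\mathbb Q$-linear combinations of the numbers $\zeta'(-2h)$ and $L'(\chi_{-3},-2h-1)$. In particular $$\mathrm m(Q_1)=\tfrac53L'(\chi_{-3},-1),\qquad \mathrm m(Q_2)=-\tfrac{182}9\zeta'(-2)+\tfrac59L'(\chi_{-3},-1).$$ -/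

import Mathlib

namespace MahlerQ

noncomputable section

open Polynomial

/-! ### Mahler measure -/

/-- The point `(e^{iθ₁}, …, e^{iθₙ})` of the unit torus. -/
def torusPoint {n : ℕ} (θ : Fin n → ℝ) : Fin n → ℂ :=
  fun j => Complex.exp ((θ j : ℂ) * Complex.I)

/-- The (logarithmic) Mahler measure: the mean of `log |P|` over the unit `n`-torus with respect
to the Haar measure, in the coordinates `x_j = e^{iθ_j}`, `θ_j ∈ [0, 2π]`
(so that `dx_j / (2πi x_j) = dθ_j / (2π)`). -/
def mahlerMeasure {n : ℕ} (P : (Fin n → ℂ) → ℂ) : ℝ :=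
  (1 / (2 * Real.pi) ^ n) *
    ∫ θ in Set.Icc (0 : Fin n → ℝ) (fun _ => 2 * Real.pi), Real.log ‖P (torusPoint θ)‖

/-- Absolute convergence of the integral that defines the Mahler measure. -/
def MahlerIntegrable {n : ℕ} (P : (Fin n → ℂ) → ℂ) : Prop :=
  MeasureTheory.IntegrableOn (fun θ : Fin n → ℝ => Real.log ‖P (torusPoint θ)‖)
    (Set.Icc (0 : Fin n → ℝ) (fun _ => 2 * Real.pi))

/-- The third root of unity `ω = e^{2πi/3}`. -/
def omega : ℂ := Complex.exp (2 * Real.pi * Complex.I / 3)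

/-- The rational function
`Q_n(z_1, …, z_n, y) = y + ((z_1 + ω)/(z_1 + 1)) ⋯ ((z_n + ω)/(z_n + 1))`;
the last of the `n + 1` variables is `y`. -/
def ratQ (n : ℕ) (x : Fin (n + 1) → ℂ) : ℂ :=
  x (Fin.last n) + ∏ j : Fin n, (x j.castSucc + omega) / (x j.castSucc + 1)

/-! ### The character of conductor 3 -/

/-- The odd Dirichlet character `χ₋₃` of conductor 3: the Legendre symbol modulo 3. -/
def chi3 : DirichletCharacter ℂ 3 :=
  (quadraticChar (ZMod 3)).ringHomComp (Int.castRingHom ℂ)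

theorem chi3_apply (x : ZMod 3) : chi3 x = if x = 0 then 0 else if x = 1 then 1 else -1 := by
  have h : ∀ y : ZMod 3,
      quadraticChar (ZMod 3) y = if y = 0 then 0 else if y = 1 then 1 else -1 := by decide
  simp only [chi3, MulChar.ringHomComp_apply, h]
  split_ifs <;> simp

/-! ### The recursive families of polynomials -/

/-- The family determined by
`T_k = 1/(k+1) ∑_{1 < j ≤ k+1, j odd} (-1)^{(j+1)/2} C(k+1,j) c^{j-1} T_{k+1-j} + g_k`. -/
def recPoly (c : ℚ) (g : ℕ → ℚ[X]) (k : ℕ) : ℚ[X] :=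
  C (1 / ((k : ℚ) + 1)) *
    ∑ j ∈ ((Finset.Icc 2 (k + 1)).filter Odd).attach,
      C ((-1) ^ ((j.1 + 1) / 2) * ((k + 1).choose j.1 : ℚ) * c ^ (j.1 - 1)) *
        recPoly c g (k + 1 - j.1)
  + g k
termination_by k
decreasing_by
  have h := Finset.mem_Icc.mp (Finset.mem_filter.mp j.2).1
  omega

theorem recPoly_eq (c : ℚ) (g : ℕ → ℚ[X]) (k : ℕ) :
    recPoly c g k =
      C (1 / ((k : ℚ) + 1)) *
        ∑ j ∈ (Finset.Icc 2 (k + 1)).filter Odd,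
          C ((-1) ^ ((j + 1) / 2) * ((k + 1).choose j : ℚ) * c ^ (j - 1)) *
            recPoly c g (k + 1 - j)
      + g k := by
  rw [recPoly]
  congr 2
  exact Finset.sum_attach ((Finset.Icc 2 (k + 1)).filter Odd)
    (fun j => C ((-1) ^ ((j + 1) / 2) * ((k + 1).choose j : ℚ) * c ^ (j - 1)) *
      recPoly c g (k + 1 - j))

/-- `∑_{0 ≤ j ≤ k+1, j even} (-1)^{j/2} C(k+1,j) w_j x^{k+1-j}` -/
def evenPart (w : ℕ → ℚ) (k : ℕ) : ℚ[X] :=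
  ∑ j ∈ (Finset.Icc 0 (k + 1)).filter Even,
    C ((-1) ^ (j / 2) * ((k + 1).choose j : ℚ) * w j) * X ^ (k + 1 - j)

/-- `∑_{1 ≤ j ≤ k+1, j odd} (-1)^{(j-1)/2} C(k+1,j) w_j x^{k+1-j}` -/
def oddPart (w : ℕ → ℚ) (k : ℕ) : ℚ[X] :=
  ∑ j ∈ (Finset.Icc 1 (k + 1)).filter Odd,
    C ((-1) ^ ((j - 1) / 2) * ((k + 1).choose j : ℚ) * w j) * X ^ (k + 1 - j)

def polyR : ℕ → ℚ[X] :=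
  recPoly 3 fun k => C (1 / (2 * ((k : ℚ) + 1))) * evenPart (fun j => 2 ^ j + 1) k

/-- The sign `(-1)^{(j+1)/2}` of the non-recursive sum is written as `-(-1)^{(j-1)/2}`. -/
def polyS : ℕ → ℚ[X] :=
  recPoly 3 fun k => -(C (1 / (2 * ((k : ℚ) + 1))) * oddPart (fun j => 2 ^ j - 1) k)

def polyP : ℕ → ℚ[X] :=
  recPoly 6 fun k => C (1 / (2 * ((k : ℚ) + 1))) * evenPart (fun j => 5 ^ j + 1) k

def polyQ : ℕ → ℚ[X] :=
  recPoly 6 fun k => C (1 / (2 * ((k : ℚ) + 1))) * oddPart (fun j => 5 ^ j - 1) k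

def polyY : ℕ → ℚ[X] :=
  recPoly 3 fun k => -(C (1 / ((k : ℚ) + 1)) * (X ^ (k + 1) + evenPart (fun j => 3 ^ j) k))

def polyZ : ℕ → ℚ[X] :=
  recPoly 6 fun k => -(C (2 / ((k : ℚ) + 1)) * evenPart (fun j => 3 ^ j) k)

/-- For `T = R, P, Y, Z`: the coefficient `t_{k,j}`, that is
`T_{2m} = ∑_{j=1}^{m+1} t_{2m,j} x^{2j-1}` and `T_{2m-1} = ∑_{j=0}^{m} t_{2m-1,j} x^{2j}`. -/
def coeffRPYZ (T : ℕ → ℚ[X]) (k j : ℕ) : ℚ :=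
  if Even k then (if j = 0 then 0 else (T k).coeff (2 * j - 1)) else (T k).coeff (2 * j)

/-- For `T = S, Q`: the coefficient `t_{k,j}`, that is
`T_{2m-1} = ∑_{j=1}^{m} t_{2m-1,j} x^{2j-1}` and `T_{2m} = ∑_{j=0}^{m} t_{2m,j} x^{2j}`. -/
def coeffSQ (T : ℕ → ℚ[X]) (k j : ℕ) : ℚ :=
  if Even k then (T k).coeff (2 * j) else (if j = 0 then 0 else (T k).coeff (2 * j - 1))

def r (k j : ℕ) : ℚ := coeffRPYZ polyR k j
def p (k j : ℕ) : ℚ := coeffRPYZ polyP k j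
def y (k j : ℕ) : ℚ := coeffRPYZ polyY k j
def z (k j : ℕ) : ℚ := coeffRPYZ polyZ k j
def s (k j : ℕ) : ℚ := coeffSQ polyS k j
def q (k j : ℕ) : ℚ := coeffSQ polyQ k j

/-! ### The rational weights in the recursion (those at `2l - 1` are used only for `l ≥ 1`) -/

/-- `2^{2l-2h+1} s_{2l-1,h} + q_{2l-1,h}` -/
def sqOdd (l h : ℕ) : ℚ :=
  2 ^ (2 * (l : ℤ) - 2 * (h : ℤ) + 1) * s (2 * l - 1) h + q (2 * l - 1) h

/-- `2^{2l-2h+1} s_{2l,h} + q_{2l,h}` -/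
def sqEven (l h : ℕ) : ℚ :=
  2 ^ (2 * (l : ℤ) - 2 * (h : ℤ) + 1) * s (2 * l) h + q (2 * l) h

/-- `2^{2l-2h} r_{2l-1,h} + p_{2l-1,h}` -/
def rpOdd (l h : ℕ) : ℚ :=
  2 ^ (2 * (l : ℤ) - 2 * (h : ℤ)) * r (2 * l - 1) h + p (2 * l - 1) h

/-- `2^{2l-2h+2} r_{2l,h} + p_{2l,h}` -/
def rpEven (l h : ℕ) : ℚ :=
  2 ^ (2 * (l : ℤ) - 2 * (h : ℤ) + 2) * r (2 * l) h + p (2 * l) h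

/-- `2^{2l} (2 r_{2l-1,0} + y_{2l-1,0}) + 2 p_{2l-1,0} + z_{2l-1,0}` -/
def constOdd (l : ℕ) : ℚ :=
  2 ^ (2 * l) * (2 * r (2 * l - 1) 0 + y (2 * l - 1) 0) + 2 * p (2 * l - 1) 0 + z (2 * l - 1) 0

/-- `2^{2l+1} s_{2l,0} + q_{2l,0}` -/
def constEven (l : ℕ) : ℚ :=
  2 ^ (2 * l + 1) * s (2 * l) 0 + q (2 * l) 0

/-! ### The coefficients `a_{n,h-1}`, `b_{n,h}`, `c_{n,h-1}`, `d_{n,h}`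

The recursion starts from `d_{0,0} = 1`. Below `a_{n,j}` and `c_{n,j}` are given with `j = h - 1`.
The values `a_{0,j}`, `b_{0,j}`, `c_{0,j}` and `d_{0,h}`, `h ≥ 1`, are never used. -/

mutual

/-- `a_{n,j}`, for `n ≥ 1` and `0 ≤ j ≤ n - 1` -/
def a : ℕ → ℕ → ℝ
  | 0, _ => 0
  | n + 1, j =>
      1 / √3 * ∑ l ∈ Finset.Icc (j + 1) n, c n (l - 1) * (sqOdd l (j + 1) : ℝ)
        + ∑ l ∈ Finset.Icc j n, d n l * (rpEven l (j + 1) : ℝ)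
termination_by n => 2 * n

/-- `b_{n,h}`, for `n ≥ 1` and `0 ≤ h ≤ n - 1` -/
def b : ℕ → ℕ → ℝ
  | 0, _ => 0
  | n + 1, 0 =>
      1 / 3 * ∑ l ∈ Finset.Icc 1 n, c n (l - 1) * (constOdd l : ℝ)
        + 2 / √3 * ∑ l ∈ Finset.Icc 0 n, d n l * (constEven l : ℝ)
  | n + 1, h + 1 =>
      ∑ l ∈ Finset.Icc (h + 1) n, c n (l - 1) * (rpOdd l (h + 1) : ℝ)
        + 1 / √3 * ∑ l ∈ Finset.Icc h n, d n l * (sqEven l (h + 1) : ℝ)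
termination_by n => 2 * n

/-- `c_{n,j}`, for `n ≥ 1` and `0 ≤ j ≤ n - 1` -/
def c : ℕ → ℕ → ℝ
  | 0, _ => 0
  | n + 1, j =>
      1 / √3 * ∑ l ∈ Finset.Icc (j + 1) (n + 1), a (n + 1) (l - 1) * (sqOdd l (j + 1) : ℝ)
        + ∑ l ∈ Finset.Icc j n, b (n + 1) l * (rpEven l (j + 1) : ℝ)
termination_by n => 2 * n + 1

/-- `d_{n,h}`, for `n ≥ 0` and `0 ≤ h ≤ n` -/
def d : ℕ → ℕ → ℝ
  | 0, 0 => 1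
  | 0, _ + 1 => 0
  | n + 1, 0 =>
      1 / 3 * ∑ l ∈ Finset.Icc 1 (n + 1), a (n + 1) (l - 1) * (constOdd l : ℝ)
        + 2 / √3 * ∑ l ∈ Finset.Icc 0 n, b (n + 1) l * (constEven l : ℝ)
  | n + 1, h + 1 =>
      ∑ l ∈ Finset.Icc (h + 1) (n + 1), a (n + 1) (l - 1) * (rpOdd l (h + 1) : ℝ)
        + 1 / √3 * ∑ l ∈ Finset.Icc (h + 1) n, b (n + 1) l * (sqEven l (h + 1) : ℝ)
termination_by n => 2 * n + 1

end

end

end MahlerQ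

-- Jensen's formula in `y` turns `m(Q_N)` into the mean of `log⁺` of the modulus of the product of
-- the `N` factors. Now `log⁺ = (log + |log|)/2`, and `X = log |(e^{iθ}+ω)/(e^{iθ}+1)|` has an even
-- density, so the mean of `log` vanishes. Thus `m(Q_N)` is half the mean of `|X_1 + ... + X_N|` for
-- independent copies of `X` (`mahlerMeasure_ratQ`).
--
-- For `θ` uniform, `X` has density `(√3/π) sinh 2u / sinh 3u` and characteristic function `φ(t) =
-- 1/(2 cosh(πt/3) - 1)`. As `|x|` is a positive multiple of `∫ (1 - cos tx)/t² dt`, the mean of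
-- `|X_1 + ... + X_N|` depends only on `φ^N` (`integral_abs_mul_eq_of_integral_cos_eq`). It
-- therefore suffices to exhibit a weight on the half-line whose cosine transform is `φ^N`.
--
-- The weight is a combination of `g_k(u) = u^k (e^{2u} - (-1)^k e^{-2u})/(2 sinh 3u)`, `k < N`,
-- with coefficients built from `a, b, c, d`. The cosine transforms of the `g_k` have a generating
-- function `j(τ)`, a sum of two tangents (`kernInt_zero_eq`), which satisfies `(1/φ - z) j = (π/3)
-- z'` with `z = cos τ + √3 sin τ - 1` (`taylorS_momentFun`). The coefficients are encoded in a
-- linear functional `L_N` on power series, `L_1` being the constant term. The recursion gives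
-- `L_{N+1}(z f) = 2√3 L_N(f)` and `L_{N+1}(z') = 0` (`pair_zS_mul`, `pair_zS'`). Applied to `z j =
-- j/φ - (π/3) z'` this yields `L_{N+1}(j) = 2√3 φ L_N(j)`, so `L_N(j)` is a constant times `φ^N`
-- (`pair_eq_of_mul_eq`).
--
-- These rules come from the polynomial families: their recursion is a convolution with `sin κt`
-- (`sinS_mul_egf_recPoly`), so the generating functions are trigonometric quotients over `sin 6t`,
-- and the combination with index `m ≥ 1` collapses to `2√3 t^m / z(t)`.
--
-- Finally `∫ u g_k(u) du` expands into sums of `n^{-k-2}` over `n ≡ ±1 mod 6`, that is, into values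
-- of `ζ` for odd `k` and of `L(χ₋₃, ·)` for even `k`. The functional equations turn these into
-- derivatives at trivial zeros.

namespace MahlerProof
-- Formal trigonometric series and generating functions of recursive families
noncomputable section
open PowerSeries

/-- The formal power series of `cos (k t)`. -/
def cosS (k : ℂ) : ℂ⟦X⟧ :=
  mk fun n => if Even n then (-1) ^ (n / 2) * k ^ n / (n.factorial : ℂ) else 0

/-- The formal power series of `sin (k t)`. -/
def sinS (k : ℂ) : ℂ⟦X⟧ :=
  mk fun n => if Even n then 0 else (-1) ^ (n / 2) * k ^ n / (n.factorial : ℂ)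

/-- The formal power series of `exp (k t)`. -/
def expS (k : ℂ) : ℂ⟦X⟧ := rescale k (exp ℂ)

theorem coeff_expS (k : ℂ) (n : ℕ) : coeff n (expS k) = k ^ n / (n.factorial : ℂ) := by
  simp [expS, coeff_rescale, div_eq_mul_inv]

theorem expS_mul (k l : ℂ) : expS k * expS l = expS (k + l) := exp_mul_exp_eq_exp_add k l

theorem expS_zero : expS 0 = 1 := by
  ext n
  rw [coeff_expS, coeff_one]
  rcases n with _ | n <;> simp

theorem expS_mul_I (k : ℂ) : expS (k * Complex.I) = cosS k + C Complex.I * sinS k := by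
  ext n
  rw [coeff_expS, map_add, coeff_C_mul, cosS, sinS, coeff_mk, coeff_mk]
  rcases Nat.even_or_odd' n with ⟨m, rfl | rfl⟩
  · have : Even (2 * m) := even_two_mul m
    simp only [this, if_true, mul_pow, pow_mul Complex.I, Complex.I_sq]
    rw [Nat.mul_div_cancel_left _ (by norm_num)]; ring
  · have : ¬ Even (2 * m + 1) := by simp
    have h2 : (2 * m + 1) / 2 = m := by omega
    simp only [this, if_false, h2, mul_pow, pow_succ Complex.I (2 * m), pow_mul Complex.I,
      Complex.I_sq]
    ring

theorem cosS_neg (k : ℂ) : cosS (-k) = cosS k := by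
  ext n
  simp only [cosS, coeff_mk]
  split_ifs with h
  · rw [h.neg_pow]
  · rfl

theorem sinS_neg (k : ℂ) : sinS (-k) = -sinS k := by
  ext n
  simp only [sinS, coeff_mk, map_neg]
  split_ifs with h
  · simp
  · rw [(Nat.not_even_iff_odd.mp h).neg_pow]; ring

theorem rescale_cosS (c k : ℂ) : rescale c (cosS k) = cosS (c * k) := by
  ext n
  simp only [cosS, coeff_rescale, coeff_mk]
  split_ifs <;> ring

theorem rescale_sinS (c k : ℂ) : rescale c (sinS k) = sinS (c * k) := by
  ext n
  simp only [sinS, coeff_rescale, coeff_mk]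
  split_ifs <;> ring

/-- In the sum of the exponential laws at `(k, l)` and `(-k, -l)`, Euler's formula cancels
everything odd and leaves twice the claim. -/
theorem cosS_add (k l : ℂ) : cosS (k + l) = cosS k * cosS l - sinS k * sinS l := by
  have h1 := expS_mul (k * Complex.I) (l * Complex.I)
  have h2 := expS_mul (-k * Complex.I) (-l * Complex.I)
  rw [← add_mul] at h1 h2
  rw [expS_mul_I, expS_mul_I, expS_mul_I] at h1 h2
  rw [← neg_add, cosS_neg, cosS_neg, cosS_neg, sinS_neg, sinS_neg, sinS_neg] at h2
  have hI : (C Complex.I : ℂ⟦X⟧) * C Complex.I = -1 := by rw [← map_mul]; simp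
  have h3 : (2 : ℂ⟦X⟧) ≠ 0 := by
    rw [← map_ofNat (C : ℂ →+* ℂ⟦X⟧) 2]
    exact (map_ne_zero_iff _ C_injective).mpr two_ne_zero
  apply mul_left_cancel₀ h3
  linear_combination -h1 - h2 + 2 * sinS k * sinS l * hI

theorem sinS_add (k l : ℂ) : sinS (k + l) = sinS k * cosS l + cosS k * sinS l := by
  have h1 := expS_mul (k * Complex.I) (l * Complex.I)
  rw [← add_mul, expS_mul_I, expS_mul_I, expS_mul_I] at h1
  have hI : (C Complex.I : ℂ⟦X⟧) * C Complex.I = -1 := by rw [← map_mul]; simp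
  rw [cosS_add] at h1
  have h3 : (C Complex.I : ℂ⟦X⟧) ≠ 0 := by
    intro h; have := congrArg (coeff 0) h; simp at this
  apply mul_left_cancel₀ h3
  linear_combination -h1 + sinS k * sinS l * hI

theorem cosS_zero : cosS 0 = 1 := by
  have h := expS_mul_I 0
  have h2 : sinS 0 = 0 := by
    ext n; simp only [sinS, coeff_mk]; rcases n with _ | n <;> simp
  rw [h2, zero_mul, expS_zero] at h
  simpa using h.symm

theorem cosS_sq_add_sinS_sq (k : ℂ) : cosS k ^ 2 + sinS k ^ 2 = 1 := by
  have h := cosS_add k (-k)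
  rw [add_neg_cancel, cosS_zero, cosS_neg, sinS_neg] at h
  linear_combination -h

/-- Later trigonometric identities involve multiples up to `6t`; written in `cosS 1` and `sinS 1`
they become polynomial identities modulo `c² + s² = 1`. -/
theorem cosS_multiples : cosS 2 = 2 * cosS 1 ^ 2 - 1 ∧ cosS 3 = 4 * cosS 1 ^ 3 - 3 * cosS 1 ∧
    cosS 4 = 8 * cosS 1 ^ 4 - 8 * cosS 1 ^ 2 + 1 ∧
    cosS 5 = 16 * cosS 1 ^ 5 - 20 * cosS 1 ^ 3 + 5 * cosS 1 ∧
    cosS 6 = 32 * cosS 1 ^ 6 - 48 * cosS 1 ^ 4 + 18 * cosS 1 ^ 2 - 1 ∧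
    sinS 2 = 2 * sinS 1 * cosS 1 ∧ sinS 3 = sinS 1 * (4 * cosS 1 ^ 2 - 1) ∧
    sinS 4 = sinS 1 * (8 * cosS 1 ^ 3 - 4 * cosS 1) ∧
    sinS 5 = sinS 1 * (16 * cosS 1 ^ 4 - 12 * cosS 1 ^ 2 + 1) ∧
    sinS 6 = sinS 1 * (32 * cosS 1 ^ 5 - 32 * cosS 1 ^ 3 + 6 * cosS 1) := by
  have h := cosS_sq_add_sinS_sq 1
  have c2 : cosS 2 = 2 * cosS 1 ^ 2 - 1 := by
    have := cosS_add 1 1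
    norm_num at this
    rw [this]; linear_combination -h
  have s2 : sinS 2 = 2 * sinS 1 * cosS 1 := by
    have := sinS_add 1 1
    norm_num at this
    rw [this]; ring
  have c3 : cosS 3 = 4 * cosS 1 ^ 3 - 3 * cosS 1 := by
    have := cosS_add 2 1
    norm_num at this
    rw [this, c2, s2]; linear_combination -2 * cosS 1 * h
  have s3 : sinS 3 = sinS 1 * (4 * cosS 1 ^ 2 - 1) := by
    have := sinS_add 2 1
    norm_num at this
    rw [this, c2, s2]; ring
  have c4 : cosS 4 = 8 * cosS 1 ^ 4 - 8 * cosS 1 ^ 2 + 1 := by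
    have := cosS_add 3 1
    norm_num at this
    rw [this, c3, s3]; linear_combination (-(4 * cosS 1 ^ 2 - 1)) * h
  have s4 : sinS 4 = sinS 1 * (8 * cosS 1 ^ 3 - 4 * cosS 1) := by
    have := sinS_add 3 1
    norm_num at this
    rw [this, c3, s3]; ring
  have c5 : cosS 5 = 16 * cosS 1 ^ 5 - 20 * cosS 1 ^ 3 + 5 * cosS 1 := by
    have := cosS_add 4 1
    norm_num at this
    rw [this, c4, s4]; linear_combination (-(8 * cosS 1 ^ 3 - 4 * cosS 1)) * h
  have s5 : sinS 5 = sinS 1 * (16 * cosS 1 ^ 4 - 12 * cosS 1 ^ 2 + 1) := by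
    have := sinS_add 4 1
    norm_num at this
    rw [this, c4, s4]; ring
  have c6 : cosS 6 = 32 * cosS 1 ^ 6 - 48 * cosS 1 ^ 4 + 18 * cosS 1 ^ 2 - 1 := by
    have := cosS_add 5 1
    norm_num at this
    rw [this, c5, s5]; linear_combination (-(16 * cosS 1 ^ 4 - 12 * cosS 1 ^ 2 + 1)) * h
  have s6 : sinS 6 = sinS 1 * (32 * cosS 1 ^ 5 - 32 * cosS 1 ^ 3 + 6 * cosS 1) := by
    have := sinS_add 5 1
    norm_num at this
    rw [this, c5, s5]; ring
  exact ⟨c2, c3, c4, c5, c6, s2, s3, s4, s5, s6⟩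

/-- The exponential generating function of the coefficients of `x ^ m` in a family of
polynomials. -/
def egf (T : ℕ → Polynomial ℚ) (m : ℕ) : ℂ⟦X⟧ :=
  mk fun k => (((T k).coeff m : ℚ) : ℂ) / (k.factorial : ℂ)

/-- Multiplied by `k + 1`, the recursion is a binomial convolution. With `T_k` moved to the other
side as the term `j = 1`, the factors `(-1)^{(j-1)/2} κ^j / j!` are the coefficients of `sin κt`. -/
theorem sinS_mul_egf_recPoly (κ : ℚ) (g : ℕ → Polynomial ℚ) (m : ℕ) :
    sinS κ * egf (MahlerQ.recPoly κ g) m = C (κ : ℂ) * (X * egf g m) := by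
  ext n
  rcases n with _ | k
  · simp [coeff_mul, sinS]
  have hrec := congrArg (fun q : Polynomial ℚ => ((q.coeff m : ℚ) : ℂ)) (MahlerQ.recPoly_eq κ g k)
  simp only [Polynomial.coeff_add, Polynomial.coeff_C_mul, Polynomial.finsetSum_coeff] at hrec
  set t : ℕ → ℂ := fun j => (((MahlerQ.recPoly κ g j).coeff m : ℚ) : ℂ) with ht
  have hg : (((g k).coeff m : ℚ) : ℂ) = t k - 1 / ((k : ℂ) + 1) *
      ∑ j ∈ Finset.Icc 2 (k + 1), if Odd j then
        (-1) ^ ((j + 1) / 2) * ((k + 1).choose j : ℂ) * (κ : ℂ) ^ (j - 1) * t (k + 1 - j) else 0 := by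
    rw [← Finset.sum_filter]
    simp only [ht]
    rw [hrec]
    push_cast
    ring
  have hk : (k : ℂ) + 1 ≠ 0 := by exact_mod_cast k.succ_ne_zero
  have hkf : (k.factorial : ℂ) ≠ 0 := by exact_mod_cast k.factorial_ne_zero
  -- Two terms are split off: index `0`, where the sine has no coefficient, and index `1`, which
  -- contributes `T_k` itself; the rest is the sum over `j ≥ 2` of the recursion.
  rw [coeff_C_mul, coeff_succ_X_mul, coeff_mul, Finset.Nat.sum_antidiagonal_eq_sum_range_succ_mk,
    Finset.sum_range_succ', Finset.sum_range_succ']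
  have hterm : ∀ i ∈ Finset.range k, coeff (i + 1 + 1) (sinS κ) *
      coeff (k + 1 - (i + 1 + 1)) (egf (MahlerQ.recPoly κ g) m) =
      - (κ : ℂ) / ((k : ℂ) + 1) / (k.factorial : ℂ) * (if Odd (2 + i) then
        (-1) ^ ((2 + i + 1) / 2) * ((k + 1).choose (2 + i) : ℂ) * (κ : ℂ) ^ (2 + i - 1) *
          t (k + 1 - (2 + i)) else 0) := by
    intro i hi
    have hi' := Finset.mem_range.mp hi
    have h2 : 2 + i ≤ k + 1 := by omega
    have hc : (((k + 1).choose (2 + i) : ℕ) : ℂ) =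
        ((k : ℂ) + 1) * (k.factorial : ℂ) / (((2 + i).factorial : ℂ) *
          ((k + 1 - (2 + i)).factorial : ℂ)) := by
      rw [Nat.cast_choose ℂ h2, Nat.factorial_succ]; push_cast; ring
    have e : i + 1 + 1 = 2 + i := by ring
    rw [e, hc]
    simp only [sinS, egf, coeff_mk]
    rcases Nat.even_or_odd' i with ⟨l, rfl | rfl⟩
    · have h1 : Even (2 + 2 * l) := ⟨1 + l, by ring⟩
      have h3 : ¬ Odd (2 + 2 * l) := by simpa using h1
      simp [h1, h3]
    · have h1 : ¬ Even (2 + (2 * l + 1)) := by rw [Nat.not_even_iff_odd]; exact ⟨1 + l, by ring⟩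
      have h3 : Odd (2 + (2 * l + 1)) := by simpa using h1
      have h4 : (2 + (2 * l + 1)) / 2 = l + 1 := by omega
      have h5 : (2 + (2 * l + 1) + 1) / 2 = l + 2 := by omega
      have h6 : 2 + (2 * l + 1) - 1 = 2 * l + 2 := by omega
      have hf1 : ((2 + (2 * l + 1)).factorial : ℂ) ≠ 0 := by exact_mod_cast Nat.factorial_ne_zero _
      have hf2 : ((k + 1 - (2 + (2 * l + 1))).factorial : ℂ) ≠ 0 := by
        exact_mod_cast Nat.factorial_ne_zero _
      simp only [h1, h3, h4, h5, h6, if_true, if_false]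
      change _ * (t (k + 1 - (2 + (2 * l + 1))) / _) = _
      field_simp
      ring
  rw [Finset.sum_congr rfl hterm, ← Finset.mul_sum]
  have hIcc : Finset.Icc 2 (k + 1) = Finset.Ico 2 (k + 2) := by ext; simp; omega
  have e3 : coeff k (egf g m) = (((g k).coeff m : ℚ) : ℂ) / (k.factorial : ℂ) := by
    simp [egf]
  rw [e3, hg, hIcc, Finset.sum_Ico_eq_sum_range]
  have e4 : coeff (k + 1 - (0 + 1)) (egf (MahlerQ.recPoly κ g) m) = t k / (k.factorial : ℂ) := by
    simp [egf, ht]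
  rw [e4]
  simp only [sinS, coeff_mk, zero_add, Nat.add_sub_cancel]
  simp
  field_simp
  ring

/-- The even generating function `∑ (-1)^{j/2} w_j t^j / j!` over even `j`. -/
def evenS (w : ℕ → ℚ) : ℂ⟦X⟧ :=
  mk fun n => if Even n then (-1) ^ (n / 2) * (w n : ℂ) / (n.factorial : ℂ) else 0

/-- The odd generating function `∑ (-1)^{(j-1)/2} w_j t^j / j!` over odd `j`. -/
def oddS (w : ℕ → ℚ) : ℂ⟦X⟧ :=
  mk fun n => if Even n then 0 else (-1) ^ (n / 2) * (w n : ℂ) / (n.factorial : ℂ)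

/-- The sums `evenPart w k` are the coefficients of `t^{k+1}/(k+1)!` in `e^{xt} · evenS w`, where
`x^m` has coefficient `t^m/m! · evenS w`. The term of degree `0` in `t` is not reached by any `k`,
hence the correction at `m = 0`. -/
theorem X_mul_egf_evenPart (α : ℚ) (w : ℕ → ℚ) (m : ℕ) :
    X * egf (fun k => Polynomial.C (α / ((k : ℚ) + 1)) * MahlerQ.evenPart w k) m =
      C (α : ℂ) * (C (1 / (m.factorial : ℂ)) * X ^ m * evenS w
        - if m = 0 then C (w 0 : ℂ) else 0) := by
  ext n
  rcases n with _ | k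
  · rcases m with _ | m <;> simp [evenS]
  have hk : (k : ℂ) + 1 ≠ 0 := by exact_mod_cast k.succ_ne_zero
  have hkf : (k.factorial : ℂ) ≠ 0 := by exact_mod_cast k.factorial_ne_zero
  have hmf : (m.factorial : ℂ) ≠ 0 := by exact_mod_cast m.factorial_ne_zero
  have h0 : coeff (k + 1) (if m = 0 then C (w 0 : ℂ) else 0 : ℂ⟦X⟧) = 0 := by
    split_ifs <;> simp
  rw [coeff_succ_X_mul, coeff_C_mul, map_sub, h0, mul_assoc, coeff_C_mul, coeff_X_pow_mul']
  simp only [egf, coeff_mk, evenS, Polynomial.coeff_C_mul, MahlerQ.evenPart,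
    Polynomial.finsetSum_coeff, Polynomial.coeff_X_pow]
  by_cases hm : m ≤ k + 1
  · rw [Finset.sum_filter, Finset.sum_eq_single (k + 1 - m)]
    · have : m = k + 1 - (k + 1 - m) := by omega
      simp only [hm, if_true, ← this]
      split_ifs with he
      · push_cast
        rw [Nat.choose_symm hm, Nat.cast_choose ℂ hm, Nat.factorial_succ]
        have hf2 : ((k + 1 - m).factorial : ℂ) ≠ 0 := by exact_mod_cast Nat.factorial_ne_zero _
        push_cast
        field_simp
        ring
      · simp
    · intro j hj hne
      have := Finset.mem_Icc.mp hj
      have : m ≠ k + 1 - j := by omega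
      simp [this]
    · intro h; exact absurd (Finset.mem_Icc.mpr ⟨Nat.zero_le _, Nat.sub_le _ _⟩) h
  · rw [Finset.sum_eq_zero]
    · simp [hm]
    · intro j _
      have : m ≠ k + 1 - j := by omega
      simp [this]

theorem X_mul_egf_oddPart (α : ℚ) (w : ℕ → ℚ) (m : ℕ) :
    X * egf (fun k => Polynomial.C (α / ((k : ℚ) + 1)) * MahlerQ.oddPart w k) m =
      C (α : ℂ) * (C (1 / (m.factorial : ℂ)) * X ^ m * oddS w) := by
  ext n
  rcases n with _ | k
  · rcases m with _ | m <;> simp [oddS]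
  have hk : (k : ℂ) + 1 ≠ 0 := by exact_mod_cast k.succ_ne_zero
  have hkf : (k.factorial : ℂ) ≠ 0 := by exact_mod_cast k.factorial_ne_zero
  have hmf : (m.factorial : ℂ) ≠ 0 := by exact_mod_cast m.factorial_ne_zero
  rw [coeff_succ_X_mul, coeff_C_mul, mul_assoc, coeff_C_mul, coeff_X_pow_mul']
  simp only [egf, coeff_mk, oddS, Polynomial.coeff_C_mul, MahlerQ.oddPart,
    Polynomial.finsetSum_coeff, Polynomial.coeff_X_pow]
  by_cases hm : m ≤ k + 1
  · rw [Finset.sum_filter, Finset.sum_eq_single (k + 1 - m)]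
    · have : m = k + 1 - (k + 1 - m) := by omega
      simp only [hm, if_true, ← this]
      rcases Nat.even_or_odd' (k + 1 - m) with ⟨i, hi | hi⟩
      · simp [hi]
      · have h1 : (2 * i + 1 - 1) / 2 = i := by omega
        have h2 : (2 * i + 1) / 2 = i := by omega
        have h3 : ¬ Even (2 * i + 1) := by simp
        have h4 : Odd (2 * i + 1) := by simp
        rw [Nat.choose_symm hm]
        simp only [hi, h1, h2, h3, h4, if_true, if_false]
        push_cast
        rw [← hi, Nat.cast_choose ℂ hm, Nat.factorial_succ]
        have hf2 : ((k + 1 - m).factorial : ℂ) ≠ 0 := by exact_mod_cast Nat.factorial_ne_zero _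
        push_cast
        field_simp
    · intro j hj hne
      have := Finset.mem_Icc.mp hj
      have : m ≠ k + 1 - j := by omega
      simp [this]
    · intro h
      have : k + 1 - m = 0 := by
        by_contra h'
        exact h (Finset.mem_Icc.mpr ⟨Nat.one_le_iff_ne_zero.mpr h', Nat.sub_le _ _⟩)
      simp [this]
  · rw [Finset.sum_eq_zero]
    · simp [hm]
    · intro j _
      have : m ≠ k + 1 - j := by omega
      simp [this]

end
end MahlerProof

-- Generating functions of the families R, S, P, Q, Y, Z

namespace MahlerProof
noncomputable section
open PowerSeries

theorem egf_add (T S : ℕ → Polynomial ℚ) (m : ℕ) :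
    egf (fun k => T k + S k) m = egf T m + egf S m := by
  ext n; simp [egf, add_div]

theorem evenS_add (v w : ℕ → ℚ) : evenS (fun j => v j + w j) = evenS v + evenS w := by
  ext n; simp only [evenS, coeff_mk, map_add]; split_ifs <;> push_cast <;> ring

theorem oddS_sub (v w : ℕ → ℚ) : oddS (fun j => v j - w j) = oddS v - oddS w := by
  ext n; simp only [oddS, coeff_mk, map_sub]; split_ifs <;> push_cast <;> ring

theorem evenS_pow (κ : ℚ) : evenS (fun j => κ ^ j) = cosS κ := by
  ext n; simp [evenS, cosS]

theorem oddS_pow (κ : ℚ) : oddS (fun j => κ ^ j) = sinS κ := by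
  ext n; simp [oddS, sinS]

theorem evenS_pow_add_one (κ : ℚ) : evenS (fun j => κ ^ j + 1) = cosS κ + cosS 1 := by
  have h := evenS_pow 1
  rw [evenS_add (fun j => κ ^ j) (fun _ => 1), evenS_pow]
  simp only [one_pow, Rat.cast_one] at h
  rw [h]

theorem oddS_pow_sub_one (κ : ℚ) : oddS (fun j => κ ^ j - 1) = sinS κ - sinS 1 := by
  have h := oddS_pow 1
  rw [oddS_sub (fun j => κ ^ j) (fun _ => 1), oddS_pow]
  simp only [one_pow, Rat.cast_one] at h
  rw [h]

/-- The constant term that an even exponential generating function lacks. -/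
def delta (m : ℕ) : ℂ⟦X⟧ := if m = 0 then 1 else 0

/-- The series `t ^ m / m!`. -/
def mono (m : ℕ) : ℂ⟦X⟧ := C (1 / (m.factorial : ℂ)) * X ^ m

theorem sinS_mul_egf_of_evenPart (κ α : ℚ) (w : ℕ → ℚ) (m : ℕ) (hw : w 0 = 2) :
    sinS κ * egf (MahlerQ.recPoly κ fun k =>
      Polynomial.C (α / ((k : ℚ) + 1)) * MahlerQ.evenPart w k) m =
      C ((κ * α : ℚ) : ℂ) * (mono m * evenS w - 2 * delta m) := by
  rw [sinS_mul_egf_recPoly, X_mul_egf_evenPart, ← mul_assoc, ← map_mul, mono, delta, hw]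
  have e : (C 2 : ℂ⟦X⟧) = 2 := map_ofNat _ 2
  push_cast
  split_ifs <;> simp [e]

theorem sinS_mul_egf_of_oddPart (κ α : ℚ) (w : ℕ → ℚ) (m : ℕ) :
    sinS κ * egf (MahlerQ.recPoly κ fun k =>
      Polynomial.C (α / ((k : ℚ) + 1)) * MahlerQ.oddPart w k) m =
      C ((κ * α : ℚ) : ℂ) * (mono m * oddS w) := by
  rw [sinS_mul_egf_recPoly, X_mul_egf_oddPart, ← mul_assoc, ← map_mul, mono]
  push_cast
  rfl

theorem one_div_two_mul (k : ℚ) : 1 / (2 * (k + 1)) = 1 / 2 / (k + 1) := by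
  rw [div_div]

theorem sinS_mul_egf_polyR (m : ℕ) :
    sinS 3 * egf MahlerQ.polyR m =
      C (3 / 2) * (mono m * (cosS 2 + cosS 1) - 2 * delta m) := by
  have h := sinS_mul_egf_of_evenPart 3 (1 / 2) (fun j => 2 ^ j + 1) m (by norm_num)
  rw [evenS_pow_add_one] at h
  simp only [MahlerQ.polyR, one_div_two_mul]
  convert h using 2 <;> norm_num

theorem sinS_mul_egf_polyP (m : ℕ) :
    sinS 6 * egf MahlerQ.polyP m = C 3 * (mono m * (cosS 5 + cosS 1) - 2 * delta m) := by
  have h := sinS_mul_egf_of_evenPart 6 (1 / 2) (fun j => 5 ^ j + 1) m (by norm_num)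
  rw [evenS_pow_add_one] at h
  simp only [MahlerQ.polyP, one_div_two_mul]
  convert h using 2 <;> norm_num

theorem sinS_mul_egf_polyS (m : ℕ) :
    sinS 3 * egf MahlerQ.polyS m = C (3 / 2) * (mono m * (sinS 1 - sinS 2)) := by
  have h := sinS_mul_egf_of_oddPart 3 (-1 / 2) (fun j => 2 ^ j - 1) m
  rw [oddS_pow_sub_one] at h
  have e : ∀ k : ℕ, -(Polynomial.C (1 / (2 * ((k : ℚ) + 1))) *
      MahlerQ.oddPart (fun j => 2 ^ j - 1) k) =
      Polynomial.C (-1 / 2 / ((k : ℚ) + 1)) * MahlerQ.oddPart (fun j => 2 ^ j - 1) k := by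
    intro k
    rw [one_div_two_mul, ← neg_mul, ← map_neg]
    congr 2; ring
  simp only [MahlerQ.polyS, e]
  have e2 : C (3 / 2 : ℂ) * (mono m * (sinS 1 - sinS 2)) =
      C (-(3 / 2) : ℂ) * (mono m * (sinS 2 - sinS 1)) := by
    rw [map_neg]; ring
  rw [e2]
  convert h using 2 <;> norm_num

theorem sinS_mul_egf_polyQ (m : ℕ) :
    sinS 6 * egf MahlerQ.polyQ m = C 3 * (mono m * (sinS 5 - sinS 1)) := by
  have h := sinS_mul_egf_of_oddPart 6 (1 / 2) (fun j => 5 ^ j - 1) m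
  rw [oddS_pow_sub_one] at h
  simp only [MahlerQ.polyQ, one_div_two_mul]
  convert h using 2 <;> norm_num

theorem sinS_mul_egf_polyZ :
    sinS 6 * egf MahlerQ.polyZ 0 = C (-12) * (cosS 3 - 1) := by
  have e : ∀ k : ℕ, -(Polynomial.C (2 / ((k : ℚ) + 1)) * MahlerQ.evenPart (fun j => 3 ^ j) k) =
      Polynomial.C (-2 / ((k : ℚ) + 1)) * MahlerQ.evenPart (fun j => 3 ^ j) k := by
    intro k
    rw [← neg_mul, ← map_neg]
    congr 2; ring
  have h := sinS_mul_egf_recPoly 6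
    (fun k => Polynomial.C (-2 / ((k : ℚ) + 1)) * MahlerQ.evenPart (fun j => 3 ^ j) k) 0
  rw [X_mul_egf_evenPart, evenS_pow, ← mul_assoc, ← map_mul] at h
  simp only [MahlerQ.polyZ, e]
  convert h using 2 <;> norm_num

/-- Only the constant coefficient of `polyY` is used, so its extra summand `x^{k+1}` drops out. -/
theorem X_mul_egf_X_pow :
    X * egf (fun k => Polynomial.C (-1 / ((k : ℚ) + 1)) * Polynomial.X ^ (k + 1)) 0 = 0 := by
  ext n
  rcases n with _ | k
  · simp
  · rw [coeff_succ_X_mul, egf, coeff_mk, Polynomial.coeff_C_mul, Polynomial.coeff_X_pow]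
    simp

theorem sinS_mul_egf_polyY :
    sinS 3 * egf MahlerQ.polyY 0 = C (-3) * (cosS 3 - 1) := by
  have e : ∀ k : ℕ, -(Polynomial.C (1 / ((k : ℚ) + 1)) *
      (Polynomial.X ^ (k + 1) + MahlerQ.evenPart (fun j => 3 ^ j) k)) =
      Polynomial.C (-1 / ((k : ℚ) + 1)) * Polynomial.X ^ (k + 1) +
      Polynomial.C (-1 / ((k : ℚ) + 1)) * MahlerQ.evenPart (fun j => 3 ^ j) k := by
    intro k
    rw [← mul_add, ← neg_mul, ← map_neg]
    congr 2; ring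
  have h := sinS_mul_egf_recPoly 3
    (fun k => Polynomial.C (-1 / ((k : ℚ) + 1)) * Polynomial.X ^ (k + 1) +
      Polynomial.C (-1 / ((k : ℚ) + 1)) * MahlerQ.evenPart (fun j => 3 ^ j) k) 0
  rw [egf_add, mul_add, X_mul_egf_X_pow, X_mul_egf_evenPart, evenS_pow, zero_add, ← mul_assoc,
    ← map_mul] at h
  simp only [MahlerQ.polyY, e]
  convert h using 2 <;> norm_num

/-- Generating function of the coefficients of `x ^ m` in `2 ^ (k + 1) R_k(x / 2) + P_k(x)`. -/
def rpS (m : ℕ) : ℂ⟦X⟧ :=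
  C (2 / 2 ^ m) * rescale 2 (egf MahlerQ.polyR m) + egf MahlerQ.polyP m

/-- Generating function of the coefficients of `x ^ m` in `2 ^ (k + 1) S_k(x / 2) + Q_k(x)`. -/
def sqS (m : ℕ) : ℂ⟦X⟧ :=
  C (2 / 2 ^ m) * rescale 2 (egf MahlerQ.polyS m) + egf MahlerQ.polyQ m

/-- Generating function of the constants `constOdd`. -/
def constS : ℂ⟦X⟧ :=
  2 * rpS 0 + C 2 * rescale 2 (egf MahlerQ.polyY 0) + egf MahlerQ.polyZ 0

theorem rescale_two_mono (m : ℕ) : C (2 / 2 ^ m) * rescale 2 (mono m) = 2 * mono m := by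
  ext n
  rw [coeff_C_mul, coeff_rescale, mono, ← map_ofNat (C : ℂ →+* ℂ⟦X⟧) 2, coeff_C_mul, coeff_C_mul,
    coeff_C_mul, coeff_X_pow]
  split_ifs with h
  · subst h
    field_simp
  · simp

theorem rescale_delta (m : ℕ) : C (2 / 2 ^ m) * rescale 2 (delta m) = 2 * delta m := by
  rw [delta]
  split_ifs with h
  · subst h
    have e : (C 2 : ℂ⟦X⟧) = 2 := map_ofNat _ 2
    simp [e]
  · simp

theorem rescale_C' (a b : ℂ) : rescale a (C b) = C b := by
  ext n
  rw [coeff_rescale, coeff_C]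
  split_ifs with h <;> simp [h]

/-- Replacing `t` by `2t` turns the denominator `sin 3t` of the family `R` into the denominator `sin
6t` of `P`, so both combine over one denominator. -/
theorem sinS_mul_rpS (m : ℕ) : sinS 6 * rpS m =
    3 * (mono m * (cosS 1 + cosS 2 + cosS 4 + cosS 5) - 4 * delta m) := by
  have h := congrArg (rescale (2 : ℂ)) (sinS_mul_egf_polyR m)
  simp only [rescale_C', map_mul (rescale (2 : ℂ)), map_sub (rescale (2 : ℂ)),
    map_add (rescale (2 : ℂ)), rescale_sinS, rescale_cosS, map_ofNat] at h
  norm_num at h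
  have h2 := sinS_mul_egf_polyP m
  have h3 := rescale_two_mono m
  have h4 := rescale_delta m
  have e : (C (3 / 2) : ℂ⟦X⟧) * 2 = 3 := by
    rw [← map_ofNat (C : ℂ →+* ℂ⟦X⟧) 2, ← map_mul]; norm_num; exact map_ofNat _ 3
  have e3 : (C 3 : ℂ⟦X⟧) = 3 := map_ofNat _ 3
  rw [e3] at h2
  rw [rpS, mul_add]
  linear_combination C (2 / 2 ^ m) * h + h2 + C (3 / 2) * (cosS 4 + cosS 2) * h3 - 2 * C (3 / 2) * h4 +
    (mono m * (cosS 4 + cosS 2) - 2 * delta m) * e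

theorem sinS_mul_sqS (m : ℕ) : sinS 6 * sqS m =
    3 * (mono m * (sinS 5 - sinS 1 - sinS 4 + sinS 2)) := by
  have h := congrArg (rescale (2 : ℂ)) (sinS_mul_egf_polyS m)
  simp only [rescale_C', map_mul (rescale (2 : ℂ)), map_sub (rescale (2 : ℂ)),
    rescale_sinS] at h
  norm_num at h
  have h2 := sinS_mul_egf_polyQ m
  have h3 := rescale_two_mono m
  have e : (C (3 / 2) : ℂ⟦X⟧) * 2 = 3 := by
    rw [← map_ofNat (C : ℂ →+* ℂ⟦X⟧) 2, ← map_mul]; norm_num; exact map_ofNat _ 3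
  have e3 : (C 3 : ℂ⟦X⟧) = 3 := map_ofNat _ 3
  rw [e3] at h2
  rw [sqS, mul_add]
  linear_combination C (2 / 2 ^ m) * h + h2 + C (3 / 2) * (sinS 2 - sinS 4) * h3 +
    (mono m * (sinS 2 - sinS 4)) * e

theorem sinS_mul_constS : sinS 6 * constS =
    6 * (cosS 1 + cosS 2 - 2 * cosS 3 + cosS 4 + cosS 5 - cosS 6 - 1) := by
  have h := congrArg (rescale (2 : ℂ)) sinS_mul_egf_polyY
  simp only [rescale_C', map_mul (rescale (2 : ℂ)), map_sub (rescale (2 : ℂ)), map_one,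
    rescale_sinS, rescale_cosS] at h
  norm_num at h
  have h2 := sinS_mul_egf_polyZ
  have h3 := sinS_mul_rpS 0
  have e3 : (C 12 : ℂ⟦X⟧) = 12 := map_ofNat _ 12
  have e4 : (C 3 : ℂ⟦X⟧) = 3 := map_ofNat _ 3
  have e5 : (C 2 : ℂ⟦X⟧) = 2 := map_ofNat _ 2
  rw [map_neg, e3] at h2
  have e1 : mono 0 = 1 := by simp [mono]
  have e2 : delta 0 = 1 := by simp [delta]
  rw [e1, e2] at h3
  have h' : sinS 6 * rescale 2 (egf MahlerQ.polyY 0) = -(3 * (cosS 6 - 1)) := by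
    rw [h, e4]
  rw [constS, e5]
  linear_combination 2 * h' + h2 + 2 * h3

end
end MahlerProof

-- The trigonometric quotients `2√3 t^m / z(t)`

namespace MahlerProof
noncomputable section
open PowerSeries

/-- `cos t + √3 sin t - 1`. -/
def zS : ℂ⟦X⟧ := cosS 1 + C ((√3 : ℝ) : ℂ) * sinS 1 - 1

/-- The derivative `√3 cos t - sin t` of `zS`. -/
def zS' : ℂ⟦X⟧ := C ((√3 : ℝ) : ℂ) * cosS 1 - sinS 1

theorem sqrt_three_sq : ((√3 : ℝ) : ℂ) ^ 2 = 3 := by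
  rw [← Complex.ofReal_pow, Real.sq_sqrt (by norm_num)]; norm_num

theorem sqrt_three_ne_zero : ((√3 : ℝ) : ℂ) ≠ 0 := by
  intro h
  have := sqrt_three_sq
  rw [h] at this
  norm_num at this

theorem C_sqrt_three_sq : (C ((√3 : ℝ) : ℂ) : ℂ⟦X⟧) ^ 2 = 3 := by
  rw [← map_pow, sqrt_three_sq]; exact map_ofNat _ 3

theorem sinS_ne_zero {k : ℂ} (hk : k ≠ 0) : sinS k ≠ 0 := by
  intro h
  have := congrArg (coeff 1) h
  simp [sinS, hk] at this

/-- Here `c, s, w` stand for `cos t`, `sin t`, `√3`. Since `z = 2 cos(t - π/3) - 2 cos(π/3)`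
vanishes only at `t ≡ 0, 2π/3`, which are zeros of `sin 6t`, the quotient `sin 6t / z` is a
trigonometric polynomial; the second factor on the left is that quotient times `2√3`. -/
theorem step_identity {R : Type*} [CommRing R] (c s w : R) (hw : w ^ 2 = 3)
    (hc : s ^ 2 = 1 - c ^ 2) :
    (c + w * s - 1) *
      (3 * (c + (2 * c ^ 2 - 1) + (8 * c ^ 4 - 8 * c ^ 2 + 1) + (16 * c ^ 5 - 20 * c ^ 3 + 5 * c)) +
        w * (s * (16 * c ^ 4 - 12 * c ^ 2 + 1) - s - s * (8 * c ^ 3 - 4 * c) + 2 * s * c)) =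
    s * (32 * c ^ 5 - 32 * c ^ 3 + 6 * c) * (2 * w) := by
  grind

theorem step_const_identity {R : Type*} [CommRing R] (c s w : R) (hw : w ^ 2 = 3)
    (hc : s ^ 2 = 1 - c ^ 2) :
    2 * (c + w * s - 1) *
      ((c + (2 * c ^ 2 - 1) - 2 * (4 * c ^ 3 - 3 * c) + (8 * c ^ 4 - 8 * c ^ 2 + 1) +
        (16 * c ^ 5 - 20 * c ^ 3 + 5 * c) - (32 * c ^ 6 - 48 * c ^ 4 + 18 * c ^ 2 - 1) - 1) +
        w * (s * (16 * c ^ 4 - 12 * c ^ 2 + 1) - s - s * (8 * c ^ 3 - 4 * c) + 2 * s * c)) =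
    s * (32 * c ^ 5 - 32 * c ^ 3 + 6 * c) * (2 * w - 2 * (w * c - s)) := by
  grind

/-- `∑_k m! [x ^ m] (2 ^ (k + 1) R_k(x / 2) + P_k + (2 ^ (k + 1) S_k(x / 2) + Q_k) / √3) t ^ k / k!`. -/
def stepS (m : ℕ) : ℂ⟦X⟧ :=
  C (m.factorial : ℂ) * (rpS m + C (1 / ((√3 : ℝ) : ℂ)) * sqS m)

/-- The series that produces the constant terms `b_{n+1,0}` and `d_{n,0}`. -/
def stepConst : ℂ⟦X⟧ := C (1 / 3) * constS + C (2 / ((√3 : ℝ) : ℂ)) * sqS 0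

/-- For `m ≠ 0` the correction `delta m` is absent, and `m` enters only through the factor `t^m`. -/
theorem zS_mul_stepS {m : ℕ} (hm : m ≠ 0) :
    zS * stepS m = C (2 * ((√3 : ℝ) : ℂ)) * X ^ m := by
  apply mul_left_cancel₀ (sinS_ne_zero (k := 6) (by norm_num))
  have h1 := sinS_mul_rpS m
  have h2 := sinS_mul_sqS m
  have hd : delta m = 0 := by simp [delta, hm]
  have hmono : C (m.factorial : ℂ) * mono m = X ^ m := by
    rw [mono, ← mul_assoc, ← map_mul]
    have : (m.factorial : ℂ) ≠ 0 := by exact_mod_cast m.factorial_ne_zero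
    rw [mul_one_div_cancel this, map_one, one_mul]
  have e : (C (1 / ((√3 : ℝ) : ℂ)) : ℂ⟦X⟧) * 3 = C ((√3 : ℝ) : ℂ) := by
    have e3 : (C 3 : ℂ⟦X⟧) = 3 := map_ofNat _ 3
    rw [← e3, ← map_mul, ← sqrt_three_sq]
    congr 1
    field_simp [sqrt_three_ne_zero]
  have e2 : (C (2 * ((√3 : ℝ) : ℂ)) : ℂ⟦X⟧) = 2 * C ((√3 : ℝ) : ℂ) := by
    rw [map_mul]; congr 1
  have e3 := C_sqrt_three_sq
  have hc := cosS_sq_add_sinS_sq 1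
  obtain ⟨c2, c3, c4, c5, c6, s2, s3, s4, s5, s6⟩ := cosS_multiples
  rw [hd] at h1
  have key : sinS 6 * (zS * stepS m) = X ^ m * zS *
      (3 * (cosS 1 + cosS 2 + cosS 4 + cosS 5) +
        C ((√3 : ℝ) : ℂ) * (sinS 5 - sinS 1 - sinS 4 + sinS 2)) := by
    rw [stepS]
    linear_combination C (m.factorial : ℂ) * zS * h1 +
      C (m.factorial : ℂ) * C (1 / ((√3 : ℝ) : ℂ)) * zS * h2 +
      zS * (3 * (cosS 1 + cosS 2 + cosS 4 + cosS 5) +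
        C ((√3 : ℝ) : ℂ) * (sinS 5 - sinS 1 - sinS 4 + sinS 2)) * hmono +
      C (m.factorial : ℂ) * mono m * zS * (sinS 5 - sinS 1 - sinS 4 + sinS 2) * e
  rw [key, e2, zS, c2, c4, c5, s2, s4, s5, s6]
  linear_combination X ^ m * step_identity (cosS 1) (sinS 1) _ e3 (by linear_combination hc)

/-- The weights of the constant terms do not follow the pattern of `stepS`. The term `-2 z'` is
exactly what makes the functional of the next level vanish on `z'`; see `pair_zS'`. -/
theorem zS_mul_stepConst : zS * stepConst = C (2 * ((√3 : ℝ) : ℂ)) - 2 * zS' := by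
  apply mul_left_cancel₀ (sinS_ne_zero (k := 6) (by norm_num))
  have h1 := sinS_mul_constS
  have h2 := sinS_mul_sqS 0
  have e1 : mono 0 = 1 := by simp [mono]
  rw [e1] at h2
  have e : (C (2 / ((√3 : ℝ) : ℂ)) : ℂ⟦X⟧) * 3 = 2 * C ((√3 : ℝ) : ℂ) := by
    have e3 : (C 3 : ℂ⟦X⟧) = 3 := map_ofNat _ 3
    have e2 : (C 2 : ℂ⟦X⟧) = 2 := map_ofNat _ 2
    rw [← e3, ← e2, ← map_mul, ← map_mul, ← sqrt_three_sq]
    congr 1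
    field_simp [sqrt_three_ne_zero]
  have e0 : (C (1 / 3) : ℂ⟦X⟧) * 6 = 2 := by
    have e3 : (C 6 : ℂ⟦X⟧) = 6 := map_ofNat _ 6
    rw [← e3, ← map_mul]; norm_num; exact map_ofNat _ 2
  have e2 : (C (2 * ((√3 : ℝ) : ℂ)) : ℂ⟦X⟧) = 2 * C ((√3 : ℝ) : ℂ) := by
    rw [map_mul]; congr 1
  have e3 := C_sqrt_three_sq
  have hc := cosS_sq_add_sinS_sq 1
  obtain ⟨c2, c3, c4, c5, c6, s2, s3, s4, s5, s6⟩ := cosS_multiples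
  have key : sinS 6 * (zS * stepConst) = 2 * zS *
      ((cosS 1 + cosS 2 - 2 * cosS 3 + cosS 4 + cosS 5 - cosS 6 - 1) +
        C ((√3 : ℝ) : ℂ) * (sinS 5 - sinS 1 - sinS 4 + sinS 2)) := by
    rw [stepConst]
    linear_combination C (1 / 3) * zS * h1 + C (2 / ((√3 : ℝ) : ℂ)) * zS * h2 +
      zS * (cosS 1 + cosS 2 - 2 * cosS 3 + cosS 4 + cosS 5 - cosS 6 - 1) * e0 +
      zS * (sinS 5 - sinS 1 - sinS 4 + sinS 2) * e
  rw [key, e2, zS, zS', c2, c3, c4, c5, c6, s2, s4, s5, s6]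
  exact step_const_identity (cosS 1) (sinS 1) _ e3 (by linear_combination hc)

/-- As `sin 6t` is odd and can be cancelled, `f` has the parity opposite to that of `g`. The
resulting parities separate the rational weights from those carrying `1/√3`. -/
theorem rescale_neg_one_eq {f g : ℂ⟦X⟧} {ε : ℂ} (h : sinS 6 * f = g)
    (hg : rescale (-1) g = C ε * g) : rescale (-1) f = C (-ε) * f := by
  apply mul_left_cancel₀ (sinS_ne_zero (k := 6) (by norm_num))
  have h' := congrArg (rescale (-1 : ℂ)) h
  rw [map_mul, rescale_sinS, neg_one_mul, sinS_neg, hg, ← h] at h'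
  rw [map_neg]
  linear_combination -h'

theorem coeff_eq_zero_of_rescale {f : ℂ⟦X⟧} {ε : ℂ} (h : rescale (-1) f = C ε * f) {n : ℕ}
    (hn : (-1) ^ n ≠ ε) : coeff n f = 0 := by
  have := congrArg (coeff n) h
  rw [coeff_rescale, coeff_C_mul] at this
  have h2 : ((-1) ^ n - ε) * coeff n f = 0 := by linear_combination this
  exact (mul_eq_zero.mp h2).resolve_left (sub_ne_zero.mpr hn)

theorem rescale_neg_one_mono (m : ℕ) : rescale (-1) (mono m) = C ((-1) ^ m) * mono m := by
  ext n
  rw [coeff_rescale, coeff_C_mul, mono, coeff_C_mul, coeff_X_pow]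
  split_ifs with h
  · rw [h]
  · simp

theorem rescale_neg_one_rpS {m : ℕ} (hm : m ≠ 0) :
    rescale (-1) (rpS m) = C (-(-1) ^ m) * rpS m := by
  refine rescale_neg_one_eq (sinS_mul_rpS m) ?_
  have hd : delta m = 0 := by simp [delta, hm]
  rw [hd]
  simp only [map_mul (rescale (-1 : ℂ)), map_sub (rescale (-1 : ℂ)), map_add (rescale (-1 : ℂ)),
    rescale_cosS, neg_one_mul, cosS_neg, rescale_neg_one_mono, map_ofNat, mul_zero, map_zero]
  ring

theorem rescale_neg_one_sqS (m : ℕ) : rescale (-1) (sqS m) = C ((-1) ^ m) * sqS m := by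
  have := rescale_neg_one_eq (sinS_mul_sqS m) (ε := -(-1) ^ m) ?_
  · rwa [neg_neg] at this
  simp only [map_mul (rescale (-1 : ℂ)), map_sub (rescale (-1 : ℂ)), map_add (rescale (-1 : ℂ)),
    rescale_sinS, neg_one_mul, sinS_neg, rescale_neg_one_mono, map_ofNat, map_neg]
  ring

theorem rescale_neg_one_constS : rescale (-1) constS = C (-1) * constS := by
  refine rescale_neg_one_eq sinS_mul_constS ?_
  simp only [map_mul (rescale (-1 : ℂ)), map_sub (rescale (-1 : ℂ)), map_add (rescale (-1 : ℂ)),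
    rescale_cosS, neg_one_mul, cosS_neg, map_ofNat, map_one]
  ring

theorem neg_one_pow_two_mul (l : ℕ) : (-1 : ℂ) ^ (2 * l) = 1 := by simp

theorem coeff_rpS_eq_zero {k m : ℕ} (hm : m ≠ 0) (h : (-1 : ℂ) ^ k = (-1) ^ m) :
    coeff k (rpS m) = 0 := by
  refine coeff_eq_zero_of_rescale (rescale_neg_one_rpS hm) ?_
  rw [h]
  rcases neg_one_pow_eq_or ℂ m with h | h <;> rw [h] <;> norm_num

theorem coeff_sqS_eq_zero {k m : ℕ} (h : (-1 : ℂ) ^ k = -(-1) ^ m) : coeff k (sqS m) = 0 := by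
  refine coeff_eq_zero_of_rescale (rescale_neg_one_sqS m) ?_
  rw [h]
  rcases neg_one_pow_eq_or ℂ m with h | h <;> rw [h] <;> norm_num

theorem coeff_constS_eq_zero (l : ℕ) : coeff (2 * l) constS = 0 := by
  refine coeff_eq_zero_of_rescale rescale_neg_one_constS ?_
  rw [neg_one_pow_two_mul]; norm_num

/-- `z(0) = 0` and `z'(0) = √3`, so `z` is `t` times a unit and `2√3 t / z` is a power series. -/
theorem exists_zS_eq : ∃ Z : ℂ⟦X⟧, zS = X * Z ∧ constantCoeff Z = ((√3 : ℝ) : ℂ) := by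
  have h0 : constantCoeff zS = 0 := by
    rw [← coeff_zero_eq_constantCoeff_apply]
    simp only [zS, cosS, sinS, map_sub, map_add, coeff_C_mul, coeff_mk, coeff_zero_one]
    simp
  obtain ⟨Z, hZ⟩ := X_dvd_iff.mpr h0
  refine ⟨Z, hZ, ?_⟩
  have := congrArg (coeff 1) hZ
  rw [← zero_add 1, coeff_succ_X_mul, coeff_zero_eq_constantCoeff_apply] at this
  rw [← this]
  simp [zS, cosS, sinS, coeff_one]

/-- `2 √3 t / z(t)`. -/
def stepF : ℂ⟦X⟧ := C (2 * ((√3 : ℝ) : ℂ)) * (exists_zS_eq.choose)⁻¹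

theorem zS_mul_stepF : zS * stepF = C (2 * ((√3 : ℝ) : ℂ)) * X := by
  obtain ⟨h1, h2⟩ := exists_zS_eq.choose_spec
  have h3 : exists_zS_eq.choose * (exists_zS_eq.choose)⁻¹ = 1 :=
    PowerSeries.mul_inv_cancel _ (by rw [h2]; exact sqrt_three_ne_zero)
  rw [stepF]
  nth_rewrite 1 [h1]
  linear_combination C (2 * ((√3 : ℝ) : ℂ)) * X * h3

theorem zS_ne_zero : zS ≠ 0 := by
  intro h
  have h1 := zS_mul_stepF
  rw [h, zero_mul] at h1
  have := congrArg (coeff 1) h1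
  simp at this

/-- All step series of positive index are shifts of the single series `stepF`; this is why one step
of the recursion amounts to multiplication by `stepF`. -/
theorem stepS_succ (m : ℕ) : stepS (m + 1) = X ^ m * stepF := by
  apply mul_left_cancel₀ zS_ne_zero
  rw [zS_mul_stepS m.succ_ne_zero]
  have := zS_mul_stepF
  rw [pow_succ]
  linear_combination -X ^ m * this

/-- This reflects the degree bound `deg T_k ≤ k + 1`. It allows the lower limits of the sums in the
recursion to be replaced by `0`. -/
theorem coeff_stepS_eq_zero {m k : ℕ} (h : k + 1 < m) : coeff k (stepS m) = 0 := by
  obtain ⟨m, rfl⟩ : ∃ i, m = i + 1 := ⟨m - 1, by omega⟩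
  rw [stepS_succ, coeff_X_pow_mul', if_neg (by omega)]

end
end MahlerProof

-- The recursion for `a, b, c, d` as a linear functional on power series

namespace MahlerProof
noncomputable section
open PowerSeries

theorem factorial_mul_coeff_rpS (k m : ℕ) : (k.factorial : ℂ) * coeff k (rpS m) =
    2 / 2 ^ m * 2 ^ k * ((MahlerQ.polyR k).coeff m : ℚ) + ((MahlerQ.polyP k).coeff m : ℚ) := by
  have hk : (k.factorial : ℂ) ≠ 0 := by exact_mod_cast k.factorial_ne_zero
  simp only [rpS, egf, map_add, coeff_C_mul, coeff_rescale, coeff_mk]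
  field_simp

theorem factorial_mul_coeff_sqS (k m : ℕ) : (k.factorial : ℂ) * coeff k (sqS m) =
    2 / 2 ^ m * 2 ^ k * ((MahlerQ.polyS k).coeff m : ℚ) + ((MahlerQ.polyQ k).coeff m : ℚ) := by
  have hk : (k.factorial : ℂ) ≠ 0 := by exact_mod_cast k.factorial_ne_zero
  simp only [sqS, egf, map_add, coeff_C_mul, coeff_rescale, coeff_mk]
  field_simp

/-- In every weight the exponent of `2` is `k - m + 1`, where `k` is the index of the polynomial and
`m` the power of `x`; this matches the factor `2 / 2^m · 2^k`. -/
theorem rpEven_eq (l j : ℕ) : ((MahlerQ.rpEven l (j + 1) : ℚ) : ℂ) =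
    ((2 * l).factorial : ℂ) * coeff (2 * l) (rpS (2 * j + 1)) := by
  rw [factorial_mul_coeff_rpS]
  have h1 : 2 * (j + 1) - 1 = 2 * j + 1 := by omega
  have h2 : (2 * (l : ℤ) - 2 * ((j + 1 : ℕ) : ℤ) + 2) = ((2 * l : ℕ) : ℤ) - ((2 * j + 1 : ℕ) : ℤ) + 1 := by
    push_cast; ring
  have hE : Even (2 * l) := even_two_mul l
  simp only [MahlerQ.rpEven, MahlerQ.r, MahlerQ.p, MahlerQ.coeffRPYZ, hE, if_true,
    Nat.succ_ne_zero, if_false]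
  rw [h1, h2]
  push_cast
  rw [zpow_add₀ (by norm_num), zpow_sub₀ (by norm_num)]
  norm_cast
  push_cast
  ring

theorem sqOdd_eq (l j : ℕ) : ((MahlerQ.sqOdd (l + 1) (j + 1) : ℚ) : ℂ) =
    ((2 * l + 1).factorial : ℂ) * coeff (2 * l + 1) (sqS (2 * j + 1)) := by
  rw [factorial_mul_coeff_sqS]
  have h1 : 2 * (j + 1) - 1 = 2 * j + 1 := by omega
  have h3 : 2 * (l + 1) - 1 = 2 * l + 1 := by omega
  have h2 : (2 * ((l + 1 : ℕ) : ℤ) - 2 * ((j + 1 : ℕ) : ℤ) + 1) =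
      ((2 * l + 1 : ℕ) : ℤ) - ((2 * j + 1 : ℕ) : ℤ) + 1 := by
    push_cast; ring
  rw [MahlerQ.sqOdd, MahlerQ.s, MahlerQ.q, MahlerQ.coeffSQ, MahlerQ.coeffSQ, h3, if_neg (by simp),
    if_neg (by simp), if_neg (by simp), if_neg (by simp), h1, h2]
  push_cast
  rw [zpow_add₀ (by norm_num), zpow_sub₀ (by norm_num)]
  norm_cast
  push_cast
  ring

theorem rpOdd_eq (l h : ℕ) : ((MahlerQ.rpOdd (l + 1) h : ℚ) : ℂ) =
    ((2 * l + 1).factorial : ℂ) * coeff (2 * l + 1) (rpS (2 * h)) := by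
  rw [factorial_mul_coeff_rpS]
  have h3 : 2 * (l + 1) - 1 = 2 * l + 1 := by omega
  have h2 : (2 * ((l + 1 : ℕ) : ℤ) - 2 * (h : ℤ)) =
      ((2 * l + 1 : ℕ) : ℤ) - ((2 * h : ℕ) : ℤ) + 1 := by
    push_cast; ring
  rw [MahlerQ.rpOdd, MahlerQ.r, MahlerQ.p, MahlerQ.coeffRPYZ, MahlerQ.coeffRPYZ, h3,
    if_neg (by simp), if_neg (by simp), h2]
  push_cast
  rw [zpow_add₀ (by norm_num), zpow_sub₀ (by norm_num)]
  norm_cast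
  push_cast
  ring

theorem sqEven_eq (l h : ℕ) : ((MahlerQ.sqEven l h : ℚ) : ℂ) =
    ((2 * l).factorial : ℂ) * coeff (2 * l) (sqS (2 * h)) := by
  rw [factorial_mul_coeff_sqS]
  have h2 : (2 * (l : ℤ) - 2 * (h : ℤ) + 1) =
      ((2 * l : ℕ) : ℤ) - ((2 * h : ℕ) : ℤ) + 1 := by
    push_cast; ring
  rw [MahlerQ.sqEven, MahlerQ.s, MahlerQ.q, MahlerQ.coeffSQ, MahlerQ.coeffSQ,
    if_pos (by simp), if_pos (by simp), h2]
  push_cast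
  rw [zpow_add₀ (by norm_num), zpow_sub₀ (by norm_num)]
  norm_cast
  push_cast
  ring

theorem constEven_eq (l : ℕ) : ((MahlerQ.constEven l : ℚ) : ℂ) =
    ((2 * l).factorial : ℂ) * coeff (2 * l) (sqS 0) := by
  rw [factorial_mul_coeff_sqS, MahlerQ.constEven, MahlerQ.s, MahlerQ.q, MahlerQ.coeffSQ,
    MahlerQ.coeffSQ, if_pos (by simp), if_pos (by simp)]
  push_cast
  ring

theorem constOdd_eq (l : ℕ) : ((MahlerQ.constOdd (l + 1) : ℚ) : ℂ) =
    ((2 * l + 1).factorial : ℂ) * coeff (2 * l + 1) constS := by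
  have hk : ((2 * l + 1).factorial : ℂ) ≠ 0 := by exact_mod_cast Nat.factorial_ne_zero _
  have h := factorial_mul_coeff_rpS (2 * l + 1) 0
  have h3 : 2 * (l + 1) - 1 = 2 * l + 1 := by omega
  have e2 : (2 : ℂ⟦X⟧) = C 2 := (map_ofNat _ 2).symm
  have e : ((2 * l + 1).factorial : ℂ) * coeff (2 * l + 1) constS =
      2 * (((2 * l + 1).factorial : ℂ) * coeff (2 * l + 1) (rpS 0)) +
      2 * 2 ^ (2 * l + 1) * ((MahlerQ.polyY (2 * l + 1)).coeff 0 : ℚ) +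
      ((MahlerQ.polyZ (2 * l + 1)).coeff 0 : ℚ) := by
    rw [constS, e2, map_add, map_add, coeff_C_mul, coeff_C_mul, coeff_rescale]
    simp only [egf, coeff_mk]
    field_simp
  rw [e, h, MahlerQ.constOdd, MahlerQ.r, MahlerQ.p, MahlerQ.y, MahlerQ.z]
  simp only [MahlerQ.coeffRPYZ, h3]
  rw [if_neg (by simp), if_neg (by simp), if_neg (by simp), if_neg (by simp)]
  push_cast
  ring

/-- The coefficients of the polynomials in `log x` that describe the density of a product of `N`
factors: `d` and `c` for odd `N`, `b` and `a` for even `N`. -/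
def dens (N k : ℕ) : ℝ :=
  if Even N then (if Even k then MahlerQ.b (N / 2) (k / 2) else MahlerQ.a (N / 2) (k / 2))
  else (if Even k then MahlerQ.d (N / 2) (k / 2) else MahlerQ.c (N / 2) (k / 2))

theorem dens_even_even (n l : ℕ) : dens (2 * n) (2 * l) = MahlerQ.b n l := by
  simp [dens]

theorem dens_even_odd (n l : ℕ) : dens (2 * n) (2 * l + 1) = MahlerQ.a n l := by
  have : (2 * l + 1) / 2 = l := by omega
  simp [dens, this]

theorem dens_odd_even (n l : ℕ) : dens (2 * n + 1) (2 * l) = MahlerQ.d n l := by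
  have : (2 * n + 1) / 2 = n := by omega
  simp [dens, this]

theorem dens_odd_odd (n l : ℕ) : dens (2 * n + 1) (2 * l + 1) = MahlerQ.c n l := by
  have : (2 * n + 1) / 2 = n := by omega
  have : (2 * l + 1) / 2 = l := by omega
  simp [dens, *]

theorem sum_range_even_add_odd {M : Type*} [AddCommMonoid M] (f : ℕ → M) (n : ℕ) :
    ∑ k ∈ Finset.range (2 * n), f k =
      ∑ l ∈ Finset.range n, f (2 * l) + ∑ l ∈ Finset.range n, f (2 * l + 1) := by
  induction n with
  | zero => simp
  | succ n ih =>
    rw [show 2 * (n + 1) = 2 * n + 1 + 1 by ring, Finset.sum_range_succ, Finset.sum_range_succ, ih,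
      Finset.sum_range_succ, Finset.sum_range_succ]
    abel

theorem sum_range_even_add_odd_succ {M : Type*} [AddCommMonoid M] (f : ℕ → M) (n : ℕ) :
    ∑ k ∈ Finset.range (2 * n + 1), f k =
      ∑ l ∈ Finset.range (n + 1), f (2 * l) + ∑ l ∈ Finset.range n, f (2 * l + 1) := by
  rw [Finset.sum_range_succ, sum_range_even_add_odd, Finset.sum_range_succ]
  abel

theorem sum_Icc_eq_sum_range {M : Type*} [AddCommMonoid M] (f : ℕ → M) (j n : ℕ)
    (h : ∀ l < j, f l = 0) : ∑ l ∈ Finset.Icc j n, f l = ∑ l ∈ Finset.range (n + 1), f l := by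
  apply Finset.sum_subset
  · intro l hl
    have := Finset.mem_Icc.mp hl
    exact Finset.mem_range.mpr (by omega)
  · intro l hl hl'
    apply h
    have := Finset.mem_range.mp hl
    by_contra hc
    exact hl' (Finset.mem_Icc.mpr ⟨by omega, by omega⟩)

theorem sum_Icc_succ_eq_sum_range {M : Type*} [AddCommMonoid M] (f : ℕ → M) (j n : ℕ)
    (h : ∀ l < j, f (l + 1) = 0) :
    ∑ l ∈ Finset.Icc (j + 1) n, f l = ∑ l ∈ Finset.range n, f (l + 1) := by
  rcases n with _ | n
  · simp
  · rw [← sum_Icc_eq_sum_range (fun l => f (l + 1)) j n h, ← Finset.map_add_right_Icc, Finset.sum_map]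
    rfl

/-- The pairing of the polynomial `∑_{k < N} h_k x ^ k` with a power series: `x ^ k` is paired with
`t ^ l / l!` to `δ_{k l}`. -/
def pair (N : ℕ) (h : ℕ → ℝ) (f : ℂ⟦X⟧) : ℂ :=
  ∑ k ∈ Finset.range N, (k.factorial : ℂ) * (h k : ℂ) * coeff k f

/-- The combination of the two coefficients in `stepS m` vanishes, and one of them vanishes by
parity; hence so does the other. -/
theorem coeff_rpS_sqS_eq_zero {k m : ℕ} (h : k + 1 < m) :
    coeff k (rpS m) = 0 ∧ coeff k (sqS m) = 0 := by
  have h0 := coeff_stepS_eq_zero h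
  have hf : (m.factorial : ℂ) ≠ 0 := by exact_mod_cast m.factorial_ne_zero
  rw [stepS, coeff_C_mul, map_add, coeff_C_mul] at h0
  have h1 := (mul_eq_zero.mp h0).resolve_left hf
  by_cases hp : (-1 : ℂ) ^ k = (-1) ^ m
  · have h2 := coeff_rpS_eq_zero (by omega) hp
    rw [h2, zero_add] at h1
    refine ⟨h2, (mul_eq_zero.mp h1).resolve_left ?_⟩
    exact one_div_ne_zero sqrt_three_ne_zero
  · have h3 : (-1 : ℂ) ^ k = -(-1) ^ m := by
      rcases neg_one_pow_eq_or ℂ m with h | h <;> rcases neg_one_pow_eq_or ℂ k with h' | h' <;>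
        simp_all
    have h2 := coeff_sqS_eq_zero h3
    rw [h2, mul_zero, add_zero] at h1
    exact ⟨h1, h2⟩

theorem sum_sqOdd (x : ℕ → ℂ) (j n : ℕ) :
    ∑ l ∈ Finset.Icc (j + 1) n, x (l - 1) * ((MahlerQ.sqOdd l (j + 1) : ℚ) : ℂ) =
      ∑ l ∈ Finset.range n,
        x l * (((2 * l + 1).factorial : ℂ) * coeff (2 * l + 1) (sqS (2 * j + 1))) := by
  rw [sum_Icc_succ_eq_sum_range]
  · simp only [sqOdd_eq, Nat.add_sub_cancel]
  · intro l hl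
    rw [sqOdd_eq, (coeff_rpS_sqS_eq_zero (by omega)).2, mul_zero, mul_zero]

theorem sum_rpOdd (x : ℕ → ℂ) (h n : ℕ) :
    ∑ l ∈ Finset.Icc (h + 1) n, x (l - 1) * ((MahlerQ.rpOdd l (h + 1) : ℚ) : ℂ) =
      ∑ l ∈ Finset.range n,
        x l * (((2 * l + 1).factorial : ℂ) * coeff (2 * l + 1) (rpS (2 * (h + 1)))) := by
  rw [sum_Icc_succ_eq_sum_range]
  · simp only [rpOdd_eq, Nat.add_sub_cancel]
  · intro l hl
    rw [rpOdd_eq, (coeff_rpS_sqS_eq_zero (by omega)).1, mul_zero, mul_zero]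

theorem sum_rpEven (x : ℕ → ℂ) (j n : ℕ) :
    ∑ l ∈ Finset.Icc j n, x l * ((MahlerQ.rpEven l (j + 1) : ℚ) : ℂ) =
      ∑ l ∈ Finset.range (n + 1),
        x l * (((2 * l).factorial : ℂ) * coeff (2 * l) (rpS (2 * j + 1))) := by
  rw [sum_Icc_eq_sum_range]
  · simp only [rpEven_eq]
  · intro l hl
    rw [rpEven_eq, (coeff_rpS_sqS_eq_zero (by omega)).1, mul_zero, mul_zero]

/-- The free lower limit `i` serves both recursions: the sum starts at `h` for `b` and at `h + 1`
for `d`. -/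
theorem sum_sqEven (x : ℕ → ℂ) {i h : ℕ} (hi : i ≤ h + 1) (n : ℕ) :
    ∑ l ∈ Finset.Icc i n, x l * ((MahlerQ.sqEven l (h + 1) : ℚ) : ℂ) =
      ∑ l ∈ Finset.range (n + 1),
        x l * (((2 * l).factorial : ℂ) * coeff (2 * l) (sqS (2 * (h + 1)))) := by
  rw [sum_Icc_eq_sum_range]
  · simp only [sqEven_eq]
  · intro l hl
    rw [sqEven_eq, (coeff_rpS_sqS_eq_zero (by omega)).2, mul_zero, mul_zero]

theorem sum_constOdd (x : ℕ → ℂ) (n : ℕ) :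
    ∑ l ∈ Finset.Icc 1 n, x (l - 1) * ((MahlerQ.constOdd l : ℚ) : ℂ) =
      ∑ l ∈ Finset.range n,
        x l * (((2 * l + 1).factorial : ℂ) * coeff (2 * l + 1) constS) := by
  rw [sum_Icc_succ_eq_sum_range (j := 0) _ _ (fun l hl => absurd hl (Nat.not_lt_zero l))]
  simp only [constOdd_eq, Nat.add_sub_cancel]

theorem sum_constEven (x : ℕ → ℂ) (n : ℕ) :
    ∑ l ∈ Finset.Icc 0 n, x l * ((MahlerQ.constEven l : ℚ) : ℂ) =
      ∑ l ∈ Finset.range (n + 1),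
        x l * (((2 * l).factorial : ℂ) * coeff (2 * l) (sqS 0)) := by
  rw [sum_Icc_eq_sum_range _ _ _ (fun l hl => absurd hl (Nat.not_lt_zero l))]
  simp only [constEven_eq]

theorem coeff_even_stepS_odd (l j : ℕ) : coeff (2 * l) (stepS (2 * j + 1)) =
    ((2 * j + 1).factorial : ℂ) * coeff (2 * l) (rpS (2 * j + 1)) := by
  rw [stepS, coeff_C_mul, map_add, coeff_C_mul, coeff_sqS_eq_zero (by simp [pow_succ])]
  ring

theorem coeff_odd_stepS_odd (l j : ℕ) : coeff (2 * l + 1) (stepS (2 * j + 1)) =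
    ((2 * j + 1).factorial : ℂ) * (1 / ((√3 : ℝ) : ℂ) * coeff (2 * l + 1) (sqS (2 * j + 1))) := by
  rw [stepS, coeff_C_mul, map_add, coeff_C_mul, coeff_rpS_eq_zero (by simp) (by simp [pow_succ])]
  ring

theorem coeff_odd_stepS_even (l h : ℕ) : coeff (2 * l + 1) (stepS (2 * (h + 1))) =
    ((2 * (h + 1)).factorial : ℂ) * coeff (2 * l + 1) (rpS (2 * (h + 1))) := by
  rw [stepS, coeff_C_mul, map_add, coeff_C_mul, coeff_sqS_eq_zero (by simp [pow_succ])]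
  ring

theorem coeff_even_stepS_even (l h : ℕ) : coeff (2 * l) (stepS (2 * (h + 1))) =
    ((2 * (h + 1)).factorial : ℂ) * (1 / ((√3 : ℝ) : ℂ) * coeff (2 * l) (sqS (2 * (h + 1)))) := by
  rw [stepS, coeff_C_mul, map_add, coeff_C_mul, coeff_rpS_eq_zero (by simp) (by simp)]
  ring

theorem coeff_odd_stepConst (l : ℕ) : coeff (2 * l + 1) stepConst =
    1 / 3 * coeff (2 * l + 1) constS := by
  rw [stepConst, map_add, coeff_C_mul, coeff_C_mul, coeff_sqS_eq_zero (by simp [pow_succ])]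
  ring

theorem coeff_even_stepConst (l : ℕ) : coeff (2 * l) stepConst =
    2 / ((√3 : ℝ) : ℂ) * coeff (2 * l) (sqS 0) := by
  rw [stepConst, map_add, coeff_C_mul, coeff_C_mul, coeff_constS_eq_zero]
  ring

/-- By parity `stepS (2j+1)` contributes `rpS` at even indices, where `dens` is `d`, and `sqS / √3`
at odd indices, where it is `c`: these are the two sums in the recursion. The analogues for `b`,
`c`, `d` work the same way. -/
theorem factorial_mul_a (n j : ℕ) : ((2 * j + 1).factorial : ℂ) * (MahlerQ.a (n + 1) j : ℂ) =
    pair (2 * n + 1) (dens (2 * n + 1)) (stepS (2 * j + 1)) := by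
  rw [pair, sum_range_even_add_odd_succ, MahlerQ.a]
  push_cast
  rw [sum_sqOdd (fun l => (MahlerQ.c n l : ℂ)), sum_rpEven (fun l => (MahlerQ.d n l : ℂ))]
  simp only [dens_odd_even, dens_odd_odd, coeff_even_stepS_odd, coeff_odd_stepS_odd]
  simp only [Finset.mul_sum, mul_add]
  rw [add_comm]
  congr 1 <;> exact Finset.sum_congr rfl fun l _ => by ring

theorem factorial_mul_b (n h : ℕ) :
    ((2 * (h + 1)).factorial : ℂ) * (MahlerQ.b (n + 1) (h + 1) : ℂ) =
    pair (2 * n + 1) (dens (2 * n + 1)) (stepS (2 * (h + 1))) := by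
  rw [pair, sum_range_even_add_odd_succ, MahlerQ.b]
  push_cast
  rw [sum_rpOdd (fun l => (MahlerQ.c n l : ℂ)),
    sum_sqEven (fun l => (MahlerQ.d n l : ℂ)) (Nat.le_succ h)]
  simp only [dens_odd_even, dens_odd_odd, coeff_even_stepS_even, coeff_odd_stepS_even]
  simp only [Finset.mul_sum, mul_add]
  rw [add_comm]
  congr 1 <;> exact Finset.sum_congr rfl fun l _ => by ring

theorem b_zero_eq (n : ℕ) : (MahlerQ.b (n + 1) 0 : ℂ) =
    pair (2 * n + 1) (dens (2 * n + 1)) stepConst := by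
  rw [pair, sum_range_even_add_odd_succ, MahlerQ.b]
  push_cast
  rw [sum_constOdd (fun l => (MahlerQ.c n l : ℂ)), sum_constEven (fun l => (MahlerQ.d n l : ℂ))]
  simp only [dens_odd_even, dens_odd_odd, coeff_even_stepConst, coeff_odd_stepConst,
    Finset.mul_sum]
  rw [add_comm]
  congr 1 <;> exact Finset.sum_congr rfl fun l _ => by ring

theorem factorial_mul_c (n j : ℕ) : ((2 * j + 1).factorial : ℂ) * (MahlerQ.c (n + 1) j : ℂ) =
    pair (2 * (n + 1)) (dens (2 * (n + 1))) (stepS (2 * j + 1)) := by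
  rw [pair, sum_range_even_add_odd, MahlerQ.c]
  push_cast
  rw [sum_sqOdd (fun l => (MahlerQ.a (n + 1) l : ℂ)),
    sum_rpEven (fun l => (MahlerQ.b (n + 1) l : ℂ))]
  simp only [dens_even_even, dens_even_odd, coeff_even_stepS_odd, coeff_odd_stepS_odd]
  simp only [Finset.mul_sum, mul_add]
  rw [add_comm]
  congr 1 <;> exact Finset.sum_congr rfl fun l _ => by ring

theorem factorial_mul_d (n h : ℕ) :
    ((2 * (h + 1)).factorial : ℂ) * (MahlerQ.d (n + 1) (h + 1) : ℂ) =
    pair (2 * (n + 1)) (dens (2 * (n + 1))) (stepS (2 * (h + 1))) := by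
  rw [pair, sum_range_even_add_odd, MahlerQ.d]
  push_cast
  rw [sum_rpOdd (fun l => (MahlerQ.a (n + 1) l : ℂ)),
    sum_sqEven (fun l => (MahlerQ.b (n + 1) l : ℂ)) le_rfl]
  simp only [dens_even_even, dens_even_odd, coeff_even_stepS_even, coeff_odd_stepS_even]
  simp only [Finset.mul_sum, mul_add]
  rw [add_comm]
  congr 1 <;> exact Finset.sum_congr rfl fun l _ => by ring

theorem d_zero_eq (n : ℕ) : (MahlerQ.d (n + 1) 0 : ℂ) =
    pair (2 * (n + 1)) (dens (2 * (n + 1))) stepConst := by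
  rw [pair, sum_range_even_add_odd, MahlerQ.d]
  push_cast
  rw [sum_constOdd (fun l => (MahlerQ.a (n + 1) l : ℂ)),
    sum_constEven (fun l => (MahlerQ.b (n + 1) l : ℂ))]
  simp only [dens_even_even, dens_even_odd, coeff_even_stepConst, coeff_odd_stepConst,
    Finset.mul_sum]
  rw [add_comm]
  congr 1 <;> exact Finset.sum_congr rfl fun l _ => by ring

/-- The recursions for the four sequences away from the constant terms become a single rule, uniform
in the parity of the number of factors. -/
theorem factorial_mul_dens_succ (N m : ℕ) :
    ((m + 1).factorial : ℂ) * (dens (N + 2) (m + 1) : ℂ) =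
      pair (N + 1) (dens (N + 1)) (stepS (m + 1)) := by
  rcases Nat.even_or_odd' N with ⟨n, rfl | rfl⟩ <;>
    rcases Nat.even_or_odd' m with ⟨j, rfl | rfl⟩
  · rw [← factorial_mul_a, show 2 * n + 2 = 2 * (n + 1) by ring, dens_even_odd]
  · rw [show 2 * j + 1 + 1 = 2 * (j + 1) by ring, ← factorial_mul_b,
      show 2 * n + 2 = 2 * (n + 1) by ring, dens_even_even]
  · rw [show 2 * n + 1 + 1 = 2 * (n + 1) by ring, ← factorial_mul_c,
      show 2 * n + 1 + 2 = 2 * (n + 1) + 1 by ring, dens_odd_odd]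
  · rw [show 2 * n + 1 + 1 = 2 * (n + 1) by ring, show 2 * j + 1 + 1 = 2 * (j + 1) by ring,
      ← factorial_mul_d, show 2 * n + 1 + 2 = 2 * (n + 1) + 1 by ring, dens_odd_even]

theorem dens_zero_eq (N : ℕ) : (dens (N + 2) 0 : ℂ) = pair (N + 1) (dens (N + 1)) stepConst := by
  rcases Nat.even_or_odd' N with ⟨n, rfl | rfl⟩
  · rw [← b_zero_eq, show 2 * n + 2 = 2 * (n + 1) by ring, ← dens_even_even (n + 1) 0]
  · rw [show 2 * n + 1 + 1 = 2 * (n + 1) by ring, ← d_zero_eq,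
      show 2 * n + 1 + 2 = 2 * (n + 1) + 1 by ring, ← dens_odd_even (n + 1) 0]

theorem pair_add (N : ℕ) (h : ℕ → ℝ) (f g : ℂ⟦X⟧) :
    pair N h (f + g) = pair N h f + pair N h g := by
  simp only [pair, map_add, mul_add, Finset.sum_add_distrib]

theorem pair_C_mul (N : ℕ) (h : ℕ → ℝ) (c : ℂ) (f : ℂ⟦X⟧) :
    pair N h (C c * f) = c * pair N h f := by
  simp only [pair, coeff_C_mul, Finset.mul_sum]
  exact Finset.sum_congr rfl fun k _ => by ring

/-- One step of the recursion, tested against a power series without constant term. -/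
theorem pair_X_mul (N : ℕ) (g : ℂ⟦X⟧) :
    pair (N + 2) (dens (N + 2)) (X * g) = pair (N + 1) (dens (N + 1)) (stepF * g) := by
  have h1 : pair (N + 2) (dens (N + 2)) (X * g) =
      ∑ m ∈ Finset.range (N + 1), pair (N + 1) (dens (N + 1)) (stepS (m + 1)) * coeff m g := by
    rw [pair, Finset.sum_range_succ']
    simp only [coeff_succ_X_mul, factorial_mul_dens_succ]
    simp
  rw [h1]
  simp only [pair, Finset.sum_mul]
  rw [Finset.sum_comm]
  refine Finset.sum_congr rfl fun k hk => ?_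
  have hk' := Finset.mem_range.mp hk
  rw [mul_comm stepF g, coeff_mul, Finset.Nat.sum_antidiagonal_eq_sum_range_succ_mk, Finset.mul_sum]
  have hsub : Finset.range (k + 1) ⊆ Finset.range (N + 1) :=
    Finset.range_subset_range.mpr (by omega)
  -- For `m > k` the series `X^m * stepF` has no coefficient at `k`, so the sum can be cut down to
  -- the convolution range.
  rw [← Finset.sum_subset hsub]
  · refine Finset.sum_congr rfl fun m hm => ?_
    have hm' := Finset.mem_range.mp hm
    rw [stepS_succ, coeff_X_pow_mul', if_pos (by omega)]
    ring
  · intro m _ hm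
    have hm' : ¬ m < k + 1 := fun h => hm (Finset.mem_range.mpr h)
    rw [stepS_succ, coeff_X_pow_mul', if_neg (by omega)]
    ring

/-- Write `z = X Z`. The factor `X` is absorbed by `pair_X_mul`, and the remaining `Z * stepF` is
the constant `2√3`. -/
theorem pair_zS_mul (N : ℕ) (f : ℂ⟦X⟧) :
    pair (N + 2) (dens (N + 2)) (zS * f) =
      2 * ((√3 : ℝ) : ℂ) * pair (N + 1) (dens (N + 1)) f := by
  obtain ⟨Z, hZ, _⟩ := exists_zS_eq
  have h := zS_mul_stepF
  have hX : X * (Z * stepF) = X * C (2 * ((√3 : ℝ) : ℂ)) := by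
    rw [← mul_assoc, ← hZ, h, mul_comm]
  have h2 := mul_left_cancel₀ X_ne_zero hX
  rw [hZ, mul_assoc, pair_X_mul, ← pair_C_mul, ← h2]
  congr 1
  ring

/-- Write `z' = √3 + X w`. One recursion step backwards sends it to the functional at `√3 stepConst
+ stepF w`, and this series is zero because its product with `z` is `√3 (2√3 - 2 z') + 2√3 X w`. -/
theorem pair_zS' (N : ℕ) : pair (N + 2) (dens (N + 2)) zS' = 0 := by
  have h0 : constantCoeff (zS' - C ((√3 : ℝ) : ℂ)) = 0 := by
    rw [← coeff_zero_eq_constantCoeff_apply]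
    simp only [zS', cosS, sinS, map_sub, coeff_C_mul, coeff_mk, coeff_zero_C]
    simp
  obtain ⟨w, hw⟩ := X_dvd_iff.mpr h0
  have h1 : zS' = C ((√3 : ℝ) : ℂ) * 1 + X * w := by rw [← hw]; ring
  have h2 : pair (N + 2) (dens (N + 2)) 1 = (dens (N + 2) 0 : ℂ) := by
    rw [pair, Finset.sum_eq_single 0]
    · simp
    · intro k _ hk
      rw [coeff_one, if_neg hk, mul_zero]
    · simp
  have h3 : C ((√3 : ℝ) : ℂ) * stepConst + stepF * w = 0 := by
    apply mul_left_cancel₀ zS_ne_zero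
    have e1 := zS_mul_stepConst
    have e2 := zS_mul_stepF
    have e3 : (C (2 * ((√3 : ℝ) : ℂ)) : ℂ⟦X⟧) = 2 * C ((√3 : ℝ) : ℂ) := by
      rw [map_mul]; congr 1
    rw [e3] at e1 e2
    linear_combination C ((√3 : ℝ) : ℂ) * e1 + w * e2 - 2 * C ((√3 : ℝ) : ℂ) * hw
  rw [h1, pair_add, pair_C_mul, h2, pair_X_mul, dens_zero_eq, ← pair_C_mul, ← pair_add, h3]
  simp [pair]

theorem pair_one (f : ℂ⟦X⟧) : pair 1 (dens 1) f = constantCoeff f := by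
  have : dens 1 0 = 1 := by simpa [MahlerQ.d] using dens_odd_even 0 0
  simp [pair, this]

/-- The moments of a series `j` with `(q - z) j = c z'` against the polynomials with coefficients
`dens`. -/
theorem pair_eq_of_mul_eq {j : ℂ⟦X⟧} {q c : ℂ} (hq : q ≠ 0)
    (hj : C q * j - zS * j = C c * zS') (N : ℕ) :
    pair (N + 1) (dens (N + 1)) j =
      c * ((√3 : ℝ) : ℂ) * (2 * ((√3 : ℝ) : ℂ)) ^ N * (1 / q) ^ (N + 1) := by
  induction N with
  | zero =>
    have h := congrArg (constantCoeff (R := ℂ)) hj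
    have hz : constantCoeff zS = 0 := by
      obtain ⟨Z, hZ, _⟩ := exists_zS_eq
      rw [hZ]; simp
    have hz' : constantCoeff zS' = ((√3 : ℝ) : ℂ) := by
      rw [← coeff_zero_eq_constantCoeff_apply]
      simp only [zS', cosS, sinS, map_sub, coeff_C_mul, coeff_mk]
      simp
    rw [map_sub, map_mul, map_mul, map_mul, hz, hz', constantCoeff_C, constantCoeff_C] at h
    rw [zero_add, pair_one]
    field_simp
    linear_combination h
  | succ N ih =>
    -- The functional of the next level is applied to `z j = q j - c z'`: the last term dies, and
    -- what remains says that `q` times the new value is `2√3` times the old one.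
    have h1 := pair_zS_mul N j
    have h2 : zS * j = C q * j + C (-c) * zS' := by rw [map_neg]; linear_combination -hj
    rw [h2, pair_add, pair_C_mul, pair_C_mul, pair_zS', ih] at h1
    have h3 : pair (N + 2) (dens (N + 2)) j =
        2 * ((√3 : ℝ) : ℂ) * (c * ((√3 : ℝ) : ℂ) * (2 * ((√3 : ℝ) : ℂ)) ^ N *
          (1 / q) ^ (N + 1)) * (1 / q) := by
      rw [mul_one_div, eq_div_iff hq]
      linear_combination h1
    rw [h3]
    ring

end
end MahlerProof

-- The kernels and their integrals

namespace MahlerProof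
noncomputable section
open MeasureTheory Set Filter Topology

theorem integrableOn_pow_mul_exp_neg (k : ℕ) {b : ℝ} (hb : 0 < b) :
    IntegrableOn (fun u : ℝ => u ^ k * Real.exp (-b * u)) (Ioi 0) := by
  have h := integrableOn_rpow_mul_exp_neg_mul_rpow (p := 1) (s := (k : ℝ)) (b := b)
    (by have : (0 : ℝ) ≤ k := k.cast_nonneg
        linarith) one_pos hb
  simpa using h

theorem integral_pow_mul_exp_neg (k : ℕ) {b : ℝ} (hb : 0 < b) :
    ∫ u in Ioi (0 : ℝ), u ^ k * Real.exp (-b * u) = (k.factorial : ℝ) / b ^ (k + 1) := by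
  have h := Real.integral_rpow_mul_exp_neg_mul_Ioi (a := (k : ℝ) + 1) (r := b) (by positivity) hb
  rw [Real.Gamma_nat_eq_factorial] at h
  simp only [add_sub_cancel_right, Real.rpow_natCast, ← neg_mul] at h
  rw [h]
  have : ((k : ℝ) + 1) = ((k + 1 : ℕ) : ℝ) := by push_cast; ring
  rw [this, Real.rpow_natCast, one_div, inv_pow]
  ring

/-- After multiplication by `sinh 3u` this is `(1 + 6u) e^{-6u} ≤ 1`, a form of `1 + x ≤ e^x`. The
bound handles the singularity at `0` and the decay at infinity together. -/
theorem div_sinh_le {u : ℝ} (hu : 0 < u) :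
    u / Real.sinh (3 * u) ≤ (1 + 6 * u) / 3 * Real.exp (-3 * u) := by
  have hs : 0 < Real.sinh (3 * u) := Real.sinh_pos_iff.mpr (by linarith)
  rw [div_le_iff₀ hs, Real.sinh_eq]
  have h1 : Real.exp (-3 * u) * Real.exp (3 * u) = 1 := by rw [← Real.exp_add]; simp
  have h2 : Real.exp (-(3 * u)) = Real.exp (-3 * u) := by congr 1; ring
  have h3 : 6 * u + 1 ≤ Real.exp (6 * u) := Real.add_one_le_exp _
  have h4 : Real.exp (-3 * u) * Real.exp (-3 * u) * Real.exp (6 * u) = 1 := by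
    rw [← Real.exp_add, ← Real.exp_add]; ring_nf; simp
  rw [h2]
  have h5 : 0 < Real.exp (-3 * u) * Real.exp (-3 * u) := by positivity
  have h6 : (Real.exp (-3 * u) * Real.exp (-3 * u)) * (6 * u + 1) ≤ 1 := by
    exact (mul_le_mul_of_nonneg_left h3 h5.le).trans h4.le
  have h7 : (1 + 6 * u) / 3 * Real.exp (-3 * u) * ((Real.exp (3 * u) - Real.exp (-3 * u)) / 2) =
    (1 + 6 * u) / 6 * (1 - Real.exp (-3 * u) * Real.exp (-3 * u)) := by
    linear_combination (1 + 6 * u) / 6 * h1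
  rw [h7]
  linarith

/-- The kernel `u ^ k (e ^ {w u} - (-1) ^ k e ^ {-w u}) / (2 sinh 3u)`. -/
def kern (k : ℕ) (w : ℂ) (u : ℝ) : ℂ :=
  (u : ℂ) ^ k * (Complex.exp (w * u) - (-1) ^ k * Complex.exp (-(w * u))) /
    (2 * Real.sinh (3 * u) : ℝ)

/-- Mean value inequality on a half-plane containing both points. The factor `u` compensates the
zero of `sinh 3u` for `k = 0`, where the kernel has no power of `u` in front. -/
theorem norm_exp_sub_le (w : ℂ) {u : ℝ} (hu : 0 < u) :
    ‖Complex.exp (w * u) - Complex.exp (-(w * u))‖ ≤ 2 * ‖w‖ * u * Real.exp (|w.re| * u) := by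
  have hconv : Convex ℝ {z : ℂ | z.re ≤ |w.re| * u} := convex_halfSpace_re_le _
  have h := hconv.norm_image_sub_le_of_norm_hasDerivWithin_le (f := Complex.exp)
    (f' := Complex.exp) (C := Real.exp (|w.re| * u)) (x := -(w * u)) (y := w * u)
    (fun z _ => (Complex.hasDerivAt_exp z).hasDerivWithinAt)
    (fun z hz => by rw [Complex.norm_exp]; exact Real.exp_le_exp.mpr hz)
    (by
      simp only [mem_ofPred_eq, Complex.neg_re, Complex.re_mul_ofReal]
      rw [← neg_mul]
      exact mul_le_mul_of_nonneg_right (neg_le_abs _) hu.le)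
    (by
      simp only [mem_ofPred_eq, Complex.re_mul_ofReal]
      exact mul_le_mul_of_nonneg_right (le_abs_self _) hu.le)
  refine h.trans (le_of_eq ?_)
  have : w * u - -(w * u) = 2 * w * u := by ring
  rw [this, norm_mul, norm_mul, Complex.norm_real, Real.norm_of_nonneg hu.le]
  simp
  ring

theorem norm_exp_sub_sign_le (k : ℕ) (w : ℂ) {u : ℝ} (hu : 0 < u) :
    ‖Complex.exp (w * u) - (-1) ^ k * Complex.exp (-(w * u))‖ ≤ 2 * Real.exp (|w.re| * u) := by
  refine (norm_sub_le _ _).trans ?_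
  rw [norm_mul, norm_pow, norm_neg, norm_one, one_pow, one_mul, Complex.norm_exp, Complex.norm_exp]
  have h1 : Real.exp (w * u).re ≤ Real.exp (|w.re| * u) := by
    apply Real.exp_le_exp.mpr
    rw [Complex.re_mul_ofReal]
    exact mul_le_mul_of_nonneg_right (le_abs_self _) hu.le
  have h2 : Real.exp (-(w * u)).re ≤ Real.exp (|w.re| * u) := by
    apply Real.exp_le_exp.mpr
    rw [Complex.neg_re, Complex.re_mul_ofReal, ← neg_mul]
    exact mul_le_mul_of_nonneg_right (neg_le_abs _) hu.le
  linarith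

/-- An integrable majorant of the kernels. -/
def kernBound (k : ℕ) (ρ u : ℝ) : ℝ := u ^ k * ((1 + 6 * u) / 3 * Real.exp (-(3 - ρ) * u))

theorem kernBound_eq (k : ℕ) (ρ u : ℝ) :
    kernBound k ρ u = u ^ k * ((1 + 6 * u) / 3 * Real.exp (-3 * u)) * Real.exp (ρ * u) := by
  rw [kernBound, mul_assoc, mul_assoc, ← Real.exp_add]
  congr 3; ring

theorem integrableOn_kernBound (k : ℕ) {ρ : ℝ} (hρ : ρ < 3) :
    IntegrableOn (kernBound k ρ) (Ioi 0) := by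
  have h1 := (integrableOn_pow_mul_exp_neg k (b := 3 - ρ) (by linarith)).const_mul (1 / 3)
  have h2 := (integrableOn_pow_mul_exp_neg (k + 1) (b := 3 - ρ) (by linarith)).const_mul 2
  refine (h1.add h2).congr (Eventually.of_forall fun u => ?_)
  simp only [kernBound, Pi.add_apply]
  ring

theorem norm_kern_succ_le (k : ℕ) {w : ℂ} {ρ : ℝ} (hw : |w.re| ≤ ρ) {u : ℝ} (hu : 0 < u) :
    ‖kern (k + 1) w u‖ ≤ kernBound k ρ u := by
  have hs : 0 < Real.sinh (3 * u) := Real.sinh_pos_iff.mpr (by linarith)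
  have h1 := norm_exp_sub_sign_le (k + 1) w hu
  have h2 := div_sinh_le hu
  have h3 : Real.exp (|w.re| * u) ≤ Real.exp (ρ * u) :=
    Real.exp_le_exp.mpr (mul_le_mul_of_nonneg_right hw hu.le)
  rw [kern, norm_div, norm_mul, norm_pow, Complex.norm_real, Complex.norm_real,
    Real.norm_of_nonneg hu.le, Real.norm_of_nonneg (by linarith : 0 ≤ 2 * Real.sinh (3 * u))]
  calc u ^ (k + 1) * ‖Complex.exp (w * u) - (-1) ^ (k + 1) * Complex.exp (-(w * u))‖ /
      (2 * Real.sinh (3 * u)) ≤ u ^ (k + 1) * (2 * Real.exp (ρ * u)) / (2 * Real.sinh (3 * u)) := by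
        gcongr; linarith
    _ = u ^ k * (u / Real.sinh (3 * u)) * Real.exp (ρ * u) := by rw [pow_succ]; field_simp
    _ ≤ u ^ k * ((1 + 6 * u) / 3 * Real.exp (-3 * u)) * Real.exp (ρ * u) := by gcongr
    _ = kernBound k ρ u := (kernBound_eq _ _ _).symm

theorem norm_kern_zero_le (w : ℂ) {u : ℝ} (hu : 0 < u) :
    ‖kern 0 w u‖ ≤ ‖w‖ * kernBound 0 |w.re| u := by
  have hs : 0 < Real.sinh (3 * u) := Real.sinh_pos_iff.mpr (by linarith)
  have h1 := norm_exp_sub_le w hu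
  have h2 := div_sinh_le hu
  rw [kern, pow_zero, pow_zero, one_mul, one_mul, norm_div, Complex.norm_real,
    Real.norm_of_nonneg (by linarith : 0 ≤ 2 * Real.sinh (3 * u))]
  calc ‖Complex.exp (w * u) - Complex.exp (-(w * u))‖ / (2 * Real.sinh (3 * u)) ≤
      2 * ‖w‖ * u * Real.exp (|w.re| * u) / (2 * Real.sinh (3 * u)) := by gcongr
    _ = ‖w‖ * (u / Real.sinh (3 * u)) * Real.exp (|w.re| * u) := by field_simp
    _ ≤ ‖w‖ * ((1 + 6 * u) / 3 * Real.exp (-3 * u)) * Real.exp (|w.re| * u) := by gcongr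
    _ = ‖w‖ * kernBound 0 |w.re| u := by rw [kernBound_eq]; ring

theorem measurable_kern (k : ℕ) (w : ℂ) : Measurable (kern k w) := by
  unfold kern
  have : Measurable fun u : ℝ => Real.sinh (3 * u) := (by fun_prop : Continuous _).measurable
  fun_prop

theorem integrableOn_kern (k : ℕ) {w : ℂ} (hw : |w.re| < 3) : IntegrableOn (kern k w) (Ioi 0) := by
  rcases k with _ | k
  · refine ((integrableOn_kernBound 0 hw).const_mul ‖w‖).mono'
      (measurable_kern 0 w).aestronglyMeasurable ?_
    filter_upwards [ae_restrict_mem measurableSet_Ioi] with u hu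
    exact norm_kern_zero_le w hu
  · refine (integrableOn_kernBound k hw).mono' (measurable_kern _ w).aestronglyMeasurable ?_
    filter_upwards [ae_restrict_mem measurableSet_Ioi] with u hu
    exact norm_kern_succ_le k le_rfl hu

/-- The integral of the kernel. -/
def kernInt (k : ℕ) (w : ℂ) : ℂ := ∫ u in Ioi (0 : ℝ), kern k w u

/-- The sign `(-1)^k` in the kernel is what makes differentiation in `w` raise `k` by one. -/
theorem hasDerivAt_kern (k : ℕ) (w : ℂ) (u : ℝ) :
    HasDerivAt (fun w => kern k w u) (kern (k + 1) w u) w := by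
  have h1 : HasDerivAt (fun w : ℂ => Complex.exp (w * u)) (Complex.exp (w * u) * (1 * u)) w :=
    ((hasDerivAt_id w).mul_const (u : ℂ)).cexp
  have h2 : HasDerivAt (fun w : ℂ => Complex.exp (-(w * u)))
      (Complex.exp (-(w * u)) * (-(1 * u))) w :=
    (((hasDerivAt_id w).mul_const (u : ℂ)).neg).cexp
  have h3 := (((h1.sub (h2.const_mul ((-1 : ℂ) ^ k))).const_mul ((u : ℂ) ^ k)).div_const
    ((2 * Real.sinh (3 * u) : ℝ) : ℂ))
  refine h3.congr_deriv ?_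
  rw [kern]
  congr 1
  ring

/-- Differentiation under the integral; on a narrower strip `|Re v| < ρ` with `ρ < 3` the
derivatives are dominated by `kernBound k ρ`. -/
theorem hasDerivAt_kernInt (k : ℕ) {w : ℂ} (hw : |w.re| < 3) :
    HasDerivAt (kernInt k) (kernInt (k + 1) w) w := by
  obtain ⟨ρ, hρ1, hρ2⟩ := exists_between hw
  have hs : {v : ℂ | |v.re| < ρ} ∈ 𝓝 w :=
    (isOpen_lt (by fun_prop) (by fun_prop)).mem_nhds hρ1
  refine (hasDerivAt_integral_of_dominated_loc_of_deriv_le (μ := volume.restrict (Ioi (0 : ℝ)))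
    (F := fun w u => kern k w u) (F' := fun w u => kern (k + 1) w u) (bound := kernBound k ρ)
    hs (Eventually.of_forall fun v => (measurable_kern k v).aestronglyMeasurable)
    (integrableOn_kern k hw) (measurable_kern _ w).aestronglyMeasurable ?_
    (integrableOn_kernBound k hρ2) ?_).2
  · filter_upwards [ae_restrict_mem measurableSet_Ioi] with u hu v hv
    exact norm_kern_succ_le k (le_of_lt hv) hu
  · exact Eventually.of_forall fun u v _ => hasDerivAt_kern k v u

end
end MahlerProof

-- The kernel integral as a tangent

namespace MahlerProof
noncomputable section
open MeasureTheory Set Filter Topology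

theorem hasSum_inv_two_sinh {u : ℝ} (hu : 0 < u) :
    HasSum (fun j : ℕ => Real.exp (-(6 * j + 3) * u)) (1 / (2 * Real.sinh (3 * u))) := by
  have h1 : Real.exp (-6 * u) < 1 := by rw [Real.exp_lt_one_iff]; linarith
  have h := (hasSum_geometric_of_lt_one (Real.exp_pos _).le h1).mul_left (Real.exp (-3 * u))
  have e : Real.exp (-3 * u) * (1 - Real.exp (-6 * u))⁻¹ = 1 / (2 * Real.sinh (3 * u)) := by
    have hs : 0 < Real.sinh (3 * u) := Real.sinh_pos_iff.mpr (by linarith)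
    rw [← div_eq_mul_inv, div_eq_div_iff (by linarith) (by positivity), Real.sinh_eq]
    have h2 : Real.exp (-3 * u) * Real.exp (3 * u) = 1 := by rw [← Real.exp_add]; simp
    have h3 : Real.exp (-3 * u) * Real.exp (-(3 * u)) = Real.exp (-6 * u) := by
      rw [← Real.exp_add]; ring_nf
    linear_combination h2 - h3
  rw [e] at h
  refine h.congr_fun fun j => ?_
  rw [← Real.exp_nat_mul, ← Real.exp_add]
  congr 1; ring

theorem summable_one_div_sq {b : ℝ} (hb : 0 < b) :
    Summable fun j : ℕ => 1 / (6 * (j : ℝ) + b) ^ 2 := by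
  have h := (Real.summable_one_div_nat_add_rpow (b / 6) 2).mpr (by norm_num)
  refine (h.mul_left (1 / 36)).congr fun j => ?_
  have : (j : ℝ) + b / 6 > 0 := by positivity
  rw [abs_of_pos this, Real.rpow_two]
  have : 6 * (j : ℝ) + b > 0 := by positivity
  field_simp
  ring

/-- Termwise integration of the geometric expansion of `1/(2 sinh 3u)`. The two exponentials must be
kept together: their difference has `L¹` norm `O(j^{-2})`, whereas each alone is only `O(j^{-1})`.
-/
theorem hasSum_kernInt_zero {w : ℂ} (hw : |w.re| < 3) :
    HasSum (fun j : ℕ => 1 / (6 * (j : ℂ) + 3 - w) - 1 / (6 * (j : ℂ) + 3 + w)) (kernInt 0 w) := by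
  obtain ⟨hw1, hw2⟩ := abs_lt.mp hw
  have hre1 : ∀ j : ℕ, (w - (6 * j + 3)).re < 0 := by
    intro j
    have : (0 : ℝ) ≤ j := j.cast_nonneg
    simp; linarith
  have hre2 : ∀ j : ℕ, (-w - (6 * j + 3)).re < 0 := by
    intro j
    have : (0 : ℝ) ≤ j := j.cast_nonneg
    simp; linarith
  set F : ℕ → ℝ → ℂ := fun j u =>
    Complex.exp ((w - (6 * j + 3)) * u) - Complex.exp ((-w - (6 * j + 3)) * u) with hF
  have hF_int : ∀ j, Integrable (F j) (volume.restrict (Ioi 0)) := fun j =>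
    (integrableOn_exp_mul_complex_Ioi (hre1 j) 0).sub (integrableOn_exp_mul_complex_Ioi (hre2 j) 0)
  have hF_eq : ∀ j u, F j u =
      (Complex.exp (w * u) - Complex.exp (-(w * u))) * (Real.exp (-(6 * j + 3) * u) : ℝ) := by
    intro j u
    rw [hF]
    push_cast
    rw [sub_mul (Complex.exp _), ← Complex.exp_add, ← Complex.exp_add]
    congr 2 <;> ring
  have hF_norm : ∀ j, ∫ u in Ioi (0 : ℝ), ‖F j u‖ ≤
      2 * ‖w‖ * (1 / (6 * (j : ℝ) + (3 - |w.re|)) ^ 2) := by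
    intro j
    have hb : 0 < 6 * (j : ℝ) + (3 - |w.re|) := by
      have : (0 : ℝ) ≤ j := j.cast_nonneg
      linarith
    have hI := integral_pow_mul_exp_neg 1 hb
    have hI' := (integrableOn_pow_mul_exp_neg 1 hb).const_mul (2 * ‖w‖)
    have : 2 * ‖w‖ * (1 / (6 * (j : ℝ) + (3 - |w.re|)) ^ 2) =
        ∫ u in Ioi (0 : ℝ), 2 * ‖w‖ * (u ^ 1 * Real.exp (-(6 * (j : ℝ) + (3 - |w.re|)) * u)) := by
      rw [integral_const_mul, hI]; simp
    rw [this]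
    refine integral_mono_ae (hF_int j).norm hI' ?_
    filter_upwards [ae_restrict_mem measurableSet_Ioi] with u hu
    have hu' : 0 < u := hu
    rw [hF_eq, norm_mul, Complex.norm_real, Real.norm_of_nonneg (Real.exp_pos _).le]
    have e : Real.exp (-(6 * (j : ℝ) + (3 - |w.re|)) * u) =
        Real.exp (|w.re| * u) * Real.exp (-(6 * j + 3) * u) := by
      rw [← Real.exp_add]; congr 1; ring
    rw [e]
    have := mul_le_mul_of_nonneg_right (norm_exp_sub_le w hu') (Real.exp_pos (-(6 * j + 3) * u)).le
    refine this.trans (le_of_eq (by ring))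
  have hsum : Summable fun j => ∫ u in Ioi (0 : ℝ), ‖F j u‖ :=
    Summable.of_nonneg_of_le (fun j => integral_nonneg fun u => norm_nonneg _) hF_norm
      ((summable_one_div_sq (by linarith)).mul_left _)
  have h := hasSum_integral_of_summable_integral_norm hF_int hsum
  have hval : ∀ j, ∫ u in Ioi (0 : ℝ), F j u =
      1 / (6 * (j : ℂ) + 3 - w) - 1 / (6 * (j : ℂ) + 3 + w) := by
    intro j
    rw [hF]
    dsimp only
    rw [integral_sub (integrableOn_exp_mul_complex_Ioi (hre1 j) 0)
      (integrableOn_exp_mul_complex_Ioi (hre2 j) 0), integral_exp_mul_complex_Ioi (hre1 j),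
      integral_exp_mul_complex_Ioi (hre2 j)]
    simp only [Complex.ofReal_zero, mul_zero, Complex.exp_zero]
    have e1 : 6 * (j : ℂ) + 3 - w = -(w - (6 * j + 3)) := by ring
    have e2 : 6 * (j : ℂ) + 3 + w = -(-w - (6 * j + 3)) := by ring
    rw [e1, e2, div_neg, div_neg, neg_div, neg_div]
  simp only [hval] at h
  suffices hT : kernInt 0 w = ∫ u in Ioi (0 : ℝ), ∑' j, F j u by rw [hT]; exact h
  unfold kernInt
  refine setIntegral_congr_fun measurableSet_Ioi fun u hu => ?_
  have h2 := (hasSum_inv_two_sinh hu).mapL Complex.ofRealCLM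
  have h3 := h2.mul_left (Complex.exp (w * u) - Complex.exp (-(w * u)))
  simp only [Complex.ofRealCLM_apply, ← hF_eq] at h3
  rw [h3.tsum_eq, kern]
  push_cast
  ring

/-- The partial fractions of the cotangent at `x = w/6 + 1/2`, where `cot πx = -tan(πw/6)`. -/
theorem kernInt_zero_eq {w : ℂ} (hw : |w.re| < 3) :
    kernInt 0 w = Real.pi / 6 * Complex.tan (Real.pi * w / 6) := by
  obtain ⟨hw1, hw2⟩ := abs_lt.mp hw
  set x : ℂ := w / 6 + 1 / 2 with hx
  have hxre : x.re = w.re / 6 + 1 / 2 := by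
    rw [hx]
    simp
  have hxi : x ∈ Complex.integerComplement := by
    rw [Complex.mem_integerComplement_iff]
    rintro ⟨n, hn⟩
    have h1 : (n : ℝ) = w.re / 6 + 1 / 2 := by rw [← hxre, ← hn]; simp
    have h2 : (0 : ℝ) < n := by linarith
    have h3 : (n : ℝ) < 1 := by linarith
    norm_cast at h2 h3
    omega
  have ht := tendsto_logDeriv_euler_cot_sub hxi
  have hne1 : ∀ n : ℕ, 6 * (n : ℂ) + 3 - w ≠ 0 := by
    intro n h
    have := congrArg Complex.re h
    have hn : (0 : ℝ) ≤ n := n.cast_nonneg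
    simp at this; linarith
  have hne2 : ∀ n : ℕ, 6 * (n : ℂ) + 3 + w ≠ 0 := by
    intro n h
    have := congrArg Complex.re h
    have hn : (0 : ℝ) ≤ n := n.cast_nonneg
    simp at this; linarith
  -- The cotangent series pairs `x - n` with `x + n`, which in terms of `w` shifts one of the two
  -- families by one place. The mismatch is the boundary term at `N`, which tends to `0`, and the
  -- first term `1/x`.
  have hpart : ∀ N : ℕ, ∑ j ∈ Finset.range N, cotTerm x j =
      -6 * ∑ j ∈ Finset.range N, (1 / (6 * (j : ℂ) + 3 - w) - 1 / (6 * (j : ℂ) + 3 + w))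
        + 6 / (6 * (N : ℂ) + 3 + w) - 1 / x := by
    intro N
    have hx0 : 1 / x = 6 / (3 + w) := by
      have h3 := hne2 0
      simp only [Nat.cast_zero, mul_zero, zero_add] at h3
      have : x = (3 + w) / 6 := by rw [hx]; ring
      rw [this, one_div_div]
    induction N with
    | zero => simp [hx0]
    | succ N ih =>
      rw [Finset.sum_range_succ, ih, Finset.sum_range_succ, cotTerm]
      have h1 := hne1 N
      have h2 := hne2 N
      have h3 := hne2 (N + 1)
      have e1 : x - (N + 1) = -(6 * (N : ℂ) + 3 - w) / 6 := by rw [hx]; ring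
      have e2 : x + (N + 1) = (6 * ((N + 1 : ℕ) : ℂ) + 3 + w) / 6 := by rw [hx]; push_cast; ring
      rw [e1, e2, one_div_div, one_div_div, div_neg]
      ring
  have hs := (hasSum_kernInt_zero hw).tendsto_sum_nat
  have h0 : Tendsto (fun N : ℕ => 6 / (6 * (N : ℂ) + 3 + w)) atTop (𝓝 0) := by
    rw [tendsto_zero_iff_norm_tendsto_zero]
    have hlim : Tendsto (fun N : ℕ => 6 * (1 / (6 * (N : ℝ) + (3 + w.re)))) atTop (𝓝 (6 * 0)) := by
      refine Tendsto.const_mul _ ?_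
      refine tendsto_const_nhds.div_atTop ?_
      exact tendsto_atTop_add_const_right _ _
        (tendsto_natCast_atTop_atTop.const_mul_atTop (by norm_num))
    rw [mul_zero] at hlim
    refine squeeze_zero (fun _ => norm_nonneg _) (fun N => ?_) hlim
    rw [norm_div]
    have hN : (0 : ℝ) ≤ N := N.cast_nonneg
    have h1 : 6 * (N : ℝ) + (3 + w.re) ≤ ‖6 * (N : ℂ) + 3 + w‖ := by
      refine le_trans (le_of_eq ?_) (Complex.re_le_norm _)
      simp; ring
    have h2 : 0 < 6 * (N : ℝ) + (3 + w.re) := by linarith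
    rw [mul_one_div]
    have : ‖(6 : ℂ)‖ = 6 := by simp
    rw [this]
    gcongr
  have hlim := ((hs.const_mul (-6)).add h0).sub_const (1 / x)
  simp only [← hpart] at hlim
  have heq := tendsto_nhds_unique ht hlim
  have hcot : Complex.cot (Real.pi * x) = -Complex.tan (Real.pi * w / 6) := by
    have : Real.pi * x = Real.pi * w / 6 + Real.pi / 2 := by rw [hx]; ring
    rw [this, Complex.cot, Complex.cos_add_pi_div_two, Complex.sin_add_pi_div_two, Complex.tan]
    ring
  rw [hcot] at heq
  linear_combination (1 / 6) * heq

end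
end MahlerProof

-- The generating function of the cosine transforms

namespace MahlerProof
noncomputable section
open PowerSeries Filter Topology

/-- The Taylor series at `0`. -/
def taylorS (f : ℂ → ℂ) : ℂ⟦X⟧ := mk fun k => iteratedDeriv k f 0 / (k.factorial : ℂ)

theorem taylorS_congr {f g : ℂ → ℂ} (h : f =ᶠ[𝓝 0] g) : taylorS f = taylorS g := by
  ext k
  simp only [taylorS, coeff_mk, (h.iteratedDeriv k).eq_of_nhds]

theorem taylorS_mul {f g : ℂ → ℂ} (hf : AnalyticAt ℂ f 0) (hg : AnalyticAt ℂ g 0) :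
    taylorS (fun τ => f τ * g τ) = taylorS f * taylorS g := by
  ext k
  rw [coeff_mul, Finset.Nat.sum_antidiagonal_eq_sum_range_succ_mk]
  simp only [taylorS, coeff_mk]
  rw [iteratedDeriv_fun_mul hf.contDiffAt hg.contDiffAt, Finset.sum_div]
  refine Finset.sum_congr rfl fun i hi => ?_
  have hi' : i ≤ k := by have := Finset.mem_range.mp hi; omega
  have h1 : (k.factorial : ℂ) ≠ 0 := by exact_mod_cast k.factorial_ne_zero
  have h2 : (i.factorial : ℂ) ≠ 0 := by exact_mod_cast i.factorial_ne_zero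
  have h3 : ((k - i).factorial : ℂ) ≠ 0 := by exact_mod_cast (k - i).factorial_ne_zero
  rw [Nat.cast_choose ℂ hi']
  field_simp

theorem taylorS_add {f g : ℂ → ℂ} (hf : AnalyticAt ℂ f 0) (hg : AnalyticAt ℂ g 0) :
    taylorS (fun τ => f τ + g τ) = taylorS f + taylorS g := by
  ext k
  simp only [taylorS, coeff_mk, map_add]
  rw [iteratedDeriv_fun_add hf.contDiffAt hg.contDiffAt, add_div]

theorem taylorS_const_mul (c : ℂ) (f : ℂ → ℂ) : taylorS (fun τ => c * f τ) = C c * taylorS f := by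
  ext k
  simp only [taylorS, coeff_mk, coeff_C_mul, iteratedDeriv_const_mul_field]
  ring

theorem taylorS_const (c : ℂ) : taylorS (fun _ => c) = C c := by
  ext k
  simp only [taylorS, coeff_mk, coeff_C, iteratedDeriv_const]
  split_ifs with h
  · simp [h]
  · simp

theorem taylorS_cos : taylorS Complex.cos = cosS 1 := by
  ext k
  simp only [taylorS, cosS, coeff_mk]
  rcases Nat.even_or_odd' k with ⟨n, rfl | rfl⟩
  · simp
  · rw [Complex.iteratedDeriv_odd_cos]; simp

theorem taylorS_sin : taylorS Complex.sin = sinS 1 := by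
  ext k
  simp only [taylorS, sinS, coeff_mk]
  rcases Nat.even_or_odd' k with ⟨n, rfl | rfl⟩
  · simp
  · have h : (2 * n + 1) / 2 = n := by omega
    rw [Complex.iteratedDeriv_odd_sin, h]; simp

/-- The generating function of the moments of the kernel. -/
def momentFun (t : ℝ) (τ : ℂ) : ℂ :=
  kernInt 0 (2 + 3 / Real.pi * τ + t * Complex.I) + kernInt 0 (2 + 3 / Real.pi * τ - t * Complex.I)

theorem isOpen_strip : IsOpen {τ : ℂ | |(2 + 3 / (Real.pi : ℂ) * τ).re| < 3} :=
  isOpen_lt (by fun_prop) (by fun_prop)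

theorem zero_mem_strip : (0 : ℂ) ∈ {τ : ℂ | |(2 + 3 / (Real.pi : ℂ) * τ).re| < 3} := by
  simp only [Set.mem_ofPred_eq, mul_zero, add_zero, Complex.re_ofNat]
  norm_num

theorem iteratedDeriv_momentFun (t : ℝ) (k : ℕ) :
    ∀ τ : ℂ, |(2 + 3 / (Real.pi : ℂ) * τ).re| < 3 → iteratedDeriv k (momentFun t) τ =
      (3 / Real.pi) ^ k * (kernInt k (2 + 3 / Real.pi * τ + t * Complex.I) +
        kernInt k (2 + 3 / Real.pi * τ - t * Complex.I)) := by
  induction k with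
  | zero => intro τ _; simp [momentFun]
  | succ k ih =>
    intro τ hτ
    rw [iteratedDeriv_succ]
    have hev : iteratedDeriv k (momentFun t) =ᶠ[𝓝 τ] fun τ =>
        (3 / Real.pi) ^ k * (kernInt k (2 + 3 / Real.pi * τ + t * Complex.I) +
          kernInt k (2 + 3 / Real.pi * τ - t * Complex.I)) := by
      filter_upwards [isOpen_strip.mem_nhds hτ] with v hv
      exact ih v hv
    rw [hev.deriv_eq]
    have hr1 : |(2 + 3 / (Real.pi : ℂ) * τ + t * Complex.I).re| < 3 := by
      rw [Complex.add_re, Complex.re_ofReal_mul, Complex.I_re, mul_zero, add_zero]; exact hτ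
    have hr2 : |(2 + 3 / (Real.pi : ℂ) * τ - t * Complex.I).re| < 3 := by
      rw [Complex.sub_re, Complex.re_ofReal_mul, Complex.I_re, mul_zero, sub_zero]; exact hτ
    have hlin : HasDerivAt (fun τ : ℂ => 2 + 3 / (Real.pi : ℂ) * τ) (3 / (Real.pi : ℂ)) τ := by
      simpa using ((hasDerivAt_id τ).const_mul (3 / (Real.pi : ℂ))).const_add 2
    have h1 := (hasDerivAt_kernInt k hr1).comp τ (hlin.add_const (t * Complex.I))
    have h2 := (hasDerivAt_kernInt k hr2).comp τ (hlin.sub_const (t * Complex.I))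
    have h3 := (h1.add h2).const_mul ((3 / (Real.pi : ℂ)) ^ k)
    refine (h3.congr_deriv ?_).deriv
    ring

theorem analyticAt_momentFun (t : ℝ) : AnalyticAt ℂ (momentFun t) 0 := by
  refine DifferentiableOn.analyticAt (s := {τ : ℂ | |(2 + 3 / (Real.pi : ℂ) * τ).re| < 3})
    (fun τ hτ => DifferentiableAt.differentiableWithinAt ?_) (isOpen_strip.mem_nhds zero_mem_strip)
  have hr1 : |(2 + 3 / (Real.pi : ℂ) * τ + t * Complex.I).re| < 3 := by
    rw [Complex.add_re, Complex.re_ofReal_mul, Complex.I_re, mul_zero, add_zero]; exact hτ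
  have hr2 : |(2 + 3 / (Real.pi : ℂ) * τ - t * Complex.I).re| < 3 := by
    rw [Complex.sub_re, Complex.re_ofReal_mul, Complex.I_re, mul_zero, sub_zero]; exact hτ
  have h1 := (hasDerivAt_kernInt 0 hr1).differentiableAt.comp τ
    (f := fun τ : ℂ => 2 + 3 / (Real.pi : ℂ) * τ + t * Complex.I) (by fun_prop)
  have h2 := (hasDerivAt_kernInt 0 hr2).differentiableAt.comp τ
    (f := fun τ : ℂ => 2 + 3 / (Real.pi : ℂ) * τ - t * Complex.I) (by fun_prop)
  exact h1.add h2

theorem cos_ne_zero_of_strip {w : ℂ} (hw : |w.re| < 3) : Complex.cos (Real.pi * w / 6) ≠ 0 := by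
  obtain ⟨h1, h2⟩ := abs_lt.mp hw
  rw [Complex.cos_ne_zero_iff]
  intro k hk
  have hk' : w = 3 * (2 * k + 1) := by
    have hpi : (Real.pi : ℂ) ≠ 0 := by exact_mod_cast Real.pi_ne_zero
    field_simp at hk
    linear_combination hk / 2
  have h3 : w.re = 3 * (2 * k + 1) := by rw [hk']; simp
  rw [h3] at h1 h2
  have h4 : (-1 : ℝ) < 2 * k + 1 := by linarith
  have h5 : (2 * k + 1 : ℝ) < 1 := by linarith
  norm_cast at h4 h5
  omega

theorem cos_pi_div_three' : Complex.cos (Real.pi / 3) = 1 / 2 := by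
  have := Real.cos_pi_div_three
  rw [← Complex.ofReal_inj] at this
  push_cast at this
  exact this

theorem sin_pi_div_three' : Complex.sin (Real.pi / 3) = ((√3 : ℝ) : ℂ) / 2 := by
  have := Real.sin_pi_div_three
  rw [← Complex.ofReal_inj] at this
  push_cast at this
  exact this

/-- Let `x, y` be the two arguments `πw/6`. Then `tan x + tan y = 2 sin(x+y) / (cos(x+y) +
cos(x-y))` with `x + y = 2π/3 + τ` and `x - y = iπt/3`. The scale `3/π` of `τ` is chosen so that `x
+ y` depends on `τ` with slope one. -/
theorem momentFun_eq (t : ℝ) {τ : ℂ} (hτ : |(2 + 3 / (Real.pi : ℂ) * τ).re| < 3) :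
    (2 * Complex.cosh (Real.pi * t / 3) - (Complex.cos τ + ((√3 : ℝ) : ℂ) * Complex.sin τ)) *
      momentFun t τ =
      Real.pi / 3 * (((√3 : ℝ) : ℂ) * Complex.cos τ - Complex.sin τ) := by
  have hr1 : |(2 + 3 / (Real.pi : ℂ) * τ + t * Complex.I).re| < 3 := by
    rw [Complex.add_re, Complex.re_ofReal_mul, Complex.I_re, mul_zero, add_zero]; exact hτ
  have hr2 : |(2 + 3 / (Real.pi : ℂ) * τ - t * Complex.I).re| < 3 := by
    rw [Complex.sub_re, Complex.re_ofReal_mul, Complex.I_re, mul_zero, sub_zero]; exact hτ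
  have hpi : (Real.pi : ℂ) ≠ 0 := by exact_mod_cast Real.pi_ne_zero
  rw [momentFun, kernInt_zero_eq hr1, kernInt_zero_eq hr2]
  have hc1 := cos_ne_zero_of_strip hr1
  have hc2 := cos_ne_zero_of_strip hr2
  set x := Real.pi * (2 + 3 / (Real.pi : ℂ) * τ + t * Complex.I) / 6 with hx
  set y := Real.pi * (2 + 3 / (Real.pi : ℂ) * τ - t * Complex.I) / 6 with hy
  have hxy : x + y = Real.pi - (Real.pi / 3 - τ) := by rw [hx, hy]; field_simp; ring
  have hxy' : x - y = (Real.pi * t / 3) * Complex.I := by rw [hx, hy]; ring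
  have hs : Complex.sin x * Complex.cos y + Complex.cos x * Complex.sin y =
      ((√3 : ℝ) : ℂ) / 2 * Complex.cos τ - 1 / 2 * Complex.sin τ := by
    rw [← Complex.sin_add, hxy, Complex.sin_pi_sub, Complex.sin_sub, cos_pi_div_three',
      sin_pi_div_three']
  have hcs : Complex.cos x * Complex.cos y - Complex.sin x * Complex.sin y =
      -(1 / 2 * Complex.cos τ + ((√3 : ℝ) : ℂ) / 2 * Complex.sin τ) := by
    rw [← Complex.cos_add, hxy, Complex.cos_pi_sub, Complex.cos_sub, cos_pi_div_three',
      sin_pi_div_three']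
  have hcd : Complex.cos x * Complex.cos y + Complex.sin x * Complex.sin y =
      Complex.cosh (Real.pi * t / 3) := by
    rw [← Complex.cos_sub, hxy', Complex.cos_mul_I]
  rw [Complex.tan, Complex.tan]
  field_simp
  generalize Complex.cos x = cx at *
  generalize Complex.cos y = cy at *
  generalize Complex.sin x = sx at *
  generalize Complex.sin y = sy at *
  rw [← hcd]
  linear_combination -6 * (sx * cy + cx * sy) * hcs + 12 * cx * cy * hs

/-- The Taylor series of `momentFun`. -/
theorem coeff_taylorS_momentFun (t : ℝ) (k : ℕ) : coeff k (taylorS (momentFun t)) =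
    (3 / Real.pi) ^ k * (kernInt k (2 + t * Complex.I) + kernInt k (2 - t * Complex.I)) /
      (k.factorial : ℂ) := by
  rw [taylorS, coeff_mk, iteratedDeriv_momentFun t k 0 zero_mem_strip]
  simp

/-- The hypothesis of `pair_eq_of_mul_eq`, with `q = 2 cosh(πt/3) - 1` the inverse of the
characteristic function and `c = π/3`. -/
theorem taylorS_momentFun (t : ℝ) :
    C (2 * Complex.cosh (Real.pi * t / 3) - 1) * taylorS (momentFun t) -
      zS * taylorS (momentFun t) = C (Real.pi / 3 : ℂ) * zS' := by
  have hcos : AnalyticAt ℂ Complex.cos 0 := by fun_prop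
  have hsin : AnalyticAt ℂ Complex.sin 0 := by fun_prop
  have h1 : taylorS (fun τ => (2 * Complex.cosh (Real.pi * t / 3) +
      (-1) * (Complex.cos τ + ((√3 : ℝ) : ℂ) * Complex.sin τ)) * momentFun t τ) =
      taylorS (fun τ => Real.pi / 3 * (((√3 : ℝ) : ℂ) * Complex.cos τ + (-1) * Complex.sin τ)) := by
    refine taylorS_congr ?_
    filter_upwards [isOpen_strip.mem_nhds zero_mem_strip] with τ hτ
    have := momentFun_eq t hτ
    linear_combination this
  rw [taylorS_mul (by fun_prop) (analyticAt_momentFun t), taylorS_add (by fun_prop) (by fun_prop),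
    taylorS_const, taylorS_const_mul, taylorS_add (by fun_prop) (by fun_prop), taylorS_const_mul,
    taylorS_const_mul, taylorS_add (by fun_prop) (by fun_prop), taylorS_const_mul,
    taylorS_const_mul, taylorS_cos, taylorS_sin] at h1
  rw [zS, zS', map_sub, map_one]
  rw [map_neg, map_one] at h1
  linear_combination h1

theorem two_cosh_sub_one_ne_zero (t : ℝ) : (2 * Complex.cosh (Real.pi * t / 3) - 1 : ℂ) ≠ 0 := by
  have h : (2 * Complex.cosh (Real.pi * t / 3) - 1 : ℂ) =
      ((2 * Real.cosh (Real.pi * t / 3) - 1 : ℝ) : ℂ) := by push_cast; rfl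
  rw [h, Complex.ofReal_ne_zero]
  have := Real.one_le_cosh (Real.pi * t / 3)
  linarith

/-- The `k`-th Taylor coefficient carries the cosine transform of the `k`-th kernel, so the left
side is the transform of a combination of kernels with coefficients `dens`, and the right side is
the required power. -/
theorem pair_taylorS_momentFun (t : ℝ) (N : ℕ) :
    pair (N + 1) (dens (N + 1)) (taylorS (momentFun t)) =
      Real.pi / 3 * ((√3 : ℝ) : ℂ) * (2 * ((√3 : ℝ) : ℂ)) ^ N *
        (1 / (2 * Complex.cosh (Real.pi * t / 3) - 1)) ^ (N + 1) :=
  pair_eq_of_mul_eq (two_cosh_sub_one_ne_zero t) (taylorS_momentFun t) N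

end
end MahlerProof

-- Sums over residue classes modulo 6 and derivatives at trivial zeros

namespace MahlerProof
noncomputable section
open Filter Topology

/-- The sum over the residue class of `b` modulo `6` of `1 / n ^ s`. -/
def resSum (s b : ℕ) : ℂ := ∑' m : ℕ, 1 / ((b + 6 * m : ℕ) : ℂ) ^ s

theorem tsum_eq_sum_residues_six {f : ℕ → ℂ} (hf : Summable f) :
    ∑' n, f n = ∑' m, f (0 + 6 * m) + ∑' m, f (1 + 6 * m) + ∑' m, f (2 + 6 * m) +
      ∑' m, f (3 + 6 * m) + ∑' m, f (4 + 6 * m) + ∑' m, f (5 + 6 * m) := by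
  rw [Nat.sumByResidueClasses hf 6]
  exact Fin.sum_univ_six (fun j : Fin 6 => ∑' m, f (ZMod.val (n := 6) j + 6 * m))

theorem tsum_eq_sum_residues_three {f : ℕ → ℂ} (hf : Summable f) :
    ∑' n, f n = ∑' m, f (0 + 3 * m) + ∑' m, f (1 + 3 * m) + ∑' m, f (2 + 3 * m) := by
  rw [Nat.sumByResidueClasses hf 3]
  exact Fin.sum_univ_three (fun j : Fin 3 => ∑' m, f (ZMod.val (n := 3) j + 3 * m))

theorem tsum_eq_sum_residues_two {f : ℕ → ℂ} (hf : Summable f) :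
    ∑' n, f n = ∑' m, f (0 + 2 * m) + ∑' m, f (1 + 2 * m) := by
  rw [Nat.sumByResidueClasses hf 2]
  exact Fin.sum_univ_two (fun j : Fin 2 => ∑' m, f (ZMod.val (n := 2) j + 2 * m))

theorem summable_one_div_natCast_pow {s : ℕ} (hs : 1 < s) :
    Summable fun n : ℕ => 1 / (n : ℂ) ^ s := by
  have h := Real.summable_one_div_nat_pow.mpr hs
  have h2 := Complex.ofRealCLM.summable h
  refine h2.congr fun n => ?_
  simp

/-- The classes `1` and `5` are those prime to `6`: inclusion-exclusion removes the Euler factors at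
`2` and `3`. -/
theorem resSum_one_add_resSum_five {s : ℕ} (hs : 1 < s) :
    resSum s 1 + resSum s 5 = (1 - 1 / 2 ^ s) * (1 - 1 / 3 ^ s) * riemannZeta s := by
  have hf := summable_one_div_natCast_pow hs
  have h6 := tsum_eq_sum_residues_six hf
  have h3 := tsum_eq_sum_residues_three (hf.mul_left (1 / 2 ^ s))
  have h2 := tsum_eq_sum_residues_two (hf.mul_left (1 / 3 ^ s))
  have h1 : ∑' n : ℕ, (1 / 6 ^ s : ℂ) * (1 / (n : ℂ) ^ s) = resSum s 0 := by
    refine tsum_congr fun m => ?_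
    rw [one_div_mul_one_div, ← mul_pow]; push_cast; ring
  rw [tsum_mul_left] at h1 h2 h3
  rw [← zeta_nat_eq_tsum_of_gt_one hs] at h1 h2 h3 h6
  have e3 : ∀ b : ℕ, ∑' m : ℕ, (1 / 2 ^ s : ℂ) * (1 / ((b + 3 * m : ℕ) : ℂ) ^ s) =
      resSum s (2 * b) := by
    intro b
    refine tsum_congr fun m => ?_
    rw [one_div_mul_one_div, ← mul_pow]; push_cast; ring
  have e2 : ∀ b : ℕ, ∑' m : ℕ, (1 / 3 ^ s : ℂ) * (1 / ((b + 2 * m : ℕ) : ℂ) ^ s) =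
      resSum s (3 * b) := by
    intro b
    refine tsum_congr fun m => ?_
    rw [one_div_mul_one_div, ← mul_pow]; push_cast; ring
  rw [e3, e3, e3] at h3
  rw [e2, e2] at h2
  have e6 : (1 / 6 ^ s : ℂ) = 1 / 2 ^ s * (1 / 3 ^ s) := by
    rw [one_div_mul_one_div, ← mul_pow]; norm_num
  rw [e6] at h1
  change riemannZeta s = resSum s 0 + resSum s 1 + resSum s 2 + resSum s 3 + resSum s 4 +
    resSum s 5 at h6
  norm_num only [Nat.mul_zero, Nat.mul_one] at h2 h3
  linear_combination -h6 + h3 + h2 - h1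

theorem chi3_natCast (n : ℕ) :
    MahlerQ.chi3 (n : ZMod 3) = if n % 3 = 0 then 0 else if n % 3 = 1 then 1 else -1 := by
  rw [MahlerQ.chi3_apply]
  have h : (n : ZMod 3) = ((n % 3 : ℕ) : ZMod 3) := by simp
  have hlt : n % 3 < 3 := Nat.mod_lt _ (by norm_num)
  rw [h]
  generalize n % 3 = r at *
  interval_cases r
  · simp
  · have : (1 : ZMod 3) ≠ 0 := by decide
    simp
  · have h1 : ((2 : ℕ) : ZMod 3) ≠ 0 := by decide
    have h2 : ((2 : ℕ) : ZMod 3) ≠ 1 := by decide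
    simp only [h1, h2, if_false]
    norm_num

/-- The even classes `2` and `4` are the doubles of the classes modulo `3`; removing them gives the
factor `1 - χ(2) 2^{-s} = 1 + 2^{-s}`. -/
theorem resSum_one_sub_resSum_five {s : ℕ} (hs : 1 < s) :
    resSum s 1 - resSum s 5 = (1 + 1 / 2 ^ s) * MahlerQ.chi3.LFunction s := by
  set f : ℕ → ℂ := fun n => MahlerQ.chi3 (n : ZMod 3) * (1 / (n : ℂ) ^ s) with hfdef
  have hf : Summable f := by
    refine Summable.of_norm_bounded (summable_one_div_natCast_pow hs).norm fun n => ?_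
    rw [hfdef]
    dsimp only
    rw [norm_mul]
    exact mul_le_of_le_one_left (norm_nonneg _) (MahlerQ.chi3.norm_le_one _)
  have hL : MahlerQ.chi3.LFunction s = ∑' n, f n := by
    rw [DirichletCharacter.LFunction_eq_LSeries _ (by simpa using hs), LSeries]
    refine tsum_congr fun n => ?_
    rcases Nat.eq_zero_or_pos n with rfl | hn
    · have : s ≠ 0 := by omega
      simp [hfdef, this]
    · rw [LSeries.term_of_ne_zero hn.ne', Complex.cpow_natCast, hfdef]
      ring
  have h6 := tsum_eq_sum_residues_six hf
  have h3 := tsum_eq_sum_residues_three (hf.mul_left (1 / 2 ^ s))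
  rw [tsum_mul_left, ← hL] at h3
  rw [← hL] at h6
  have e6 : ∀ b m : ℕ, f (b + 6 * m) =
      (if b % 3 = 0 then 0 else if b % 3 = 1 then 1 else -1) * (1 / ((b + 6 * m : ℕ) : ℂ) ^ s) := by
    intro b m
    have : (b + 6 * m) % 3 = b % 3 := by omega
    rw [hfdef]
    dsimp only
    rw [chi3_natCast, this]
  have e3 : ∀ b m : ℕ, (1 / 2 ^ s : ℂ) * f (b + 3 * m) =
      (if b % 3 = 0 then 0 else if b % 3 = 1 then 1 else -1) *
        (1 / ((2 * b + 6 * m : ℕ) : ℂ) ^ s) := by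
    intro b m
    have : (b + 3 * m) % 3 = b % 3 := by omega
    have e : ((2 * b + 6 * m : ℕ) : ℂ) ^ s = 2 ^ s * ((b + 3 * m : ℕ) : ℂ) ^ s := by
      rw [← mul_pow]; push_cast; ring
    rw [hfdef]
    dsimp only
    rw [chi3_natCast, this, e, ← one_div_mul_one_div]
    ring
  simp only [e6, e3, tsum_mul_left] at h6 h3
  norm_num only [Nat.mul_zero, Nat.mul_one, zero_mul, zero_add, if_true, if_false, one_mul] at h3 h6
  change (1 / 2 ^ s) * _ = resSum s 2 + -1 * resSum s 4 at h3
  change _ = resSum s 1 + -1 * resSum s 2 + 0 + resSum s 4 + -1 * resSum s 5 at h6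
  linear_combination -h6 - h3

theorem exp_two_pi_I_div_three :
    Complex.exp (2 * Real.pi * Complex.I / 3) = -1 / 2 + ((√3 : ℝ) : ℂ) / 2 * Complex.I := by
  have h : (2 * Real.pi * Complex.I / 3 : ℂ) = ((Real.pi - Real.pi / 3 : ℝ) : ℂ) * Complex.I := by
    push_cast; ring
  rw [h, Complex.exp_mul_I, ← Complex.ofReal_cos, ← Complex.ofReal_sin, Real.cos_pi_sub,
    Real.sin_pi_sub, Real.cos_pi_div_three, Real.sin_pi_div_three]
  push_cast
  ring

/-- The Gauss sum: `ω - ω̄ = i√3`, with a minus sign because the transform uses the conjugate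
additive character. -/
theorem dft_chi3 : ZMod.dft (MahlerQ.chi3 ·) =
    fun k => -(Complex.I * ((√3 : ℝ) : ℂ)) * MahlerQ.chi3 k := by
  have v1 : ZMod.stdAddChar (1 : ZMod 3) = -1 / 2 + ((√3 : ℝ) : ℂ) / 2 * Complex.I := by
    have := ZMod.stdAddChar_coe (N := 3) 1
    rw [Int.cast_one] at this
    rw [this, ← exp_two_pi_I_div_three]
    push_cast; ring_nf
  have v2 : ZMod.stdAddChar (2 : ZMod 3) = -1 / 2 - ((√3 : ℝ) : ℂ) / 2 * Complex.I := by
    have h2 : (2 : ZMod 3) = 1 + 1 := by decide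
    rw [h2, AddChar.map_add_eq_mul, v1]
    have h3 := sqrt_three_sq
    linear_combination (((√3 : ℝ) : ℂ) ^ 2 / 4) * Complex.I_sq - 1 / 4 * h3
  have c0 : MahlerQ.chi3 0 = 0 := by simpa using chi3_natCast 0
  have c1 : MahlerQ.chi3 1 = 1 := by simp
  have c2 : MahlerQ.chi3 2 = -1 := by simpa using chi3_natCast 2
  have key : ∀ k : ZMod 3, ZMod.dft (MahlerQ.chi3 ·) k =
      ZMod.stdAddChar (-k) - ZMod.stdAddChar (-(2 * k)) := by
    intro k
    rw [ZMod.dft_apply]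
    let F : ZMod 3 → ℂ := fun j => ZMod.stdAddChar (-(j * k)) • MahlerQ.chi3 j
    refine (Fin.sum_univ_three (show Fin 3 → ℂ from F)).trans ?_
    change ZMod.stdAddChar (-((0 : ZMod 3) * k)) • MahlerQ.chi3 0 +
      ZMod.stdAddChar (-((1 : ZMod 3) * k)) • MahlerQ.chi3 1 +
      ZMod.stdAddChar (-((2 : ZMod 3) * k)) • MahlerQ.chi3 2 = _
    rw [c0, c1, c2, one_mul]
    simp only [smul_eq_mul]
    ring
  funext k
  rw [key]
  have hk : k = 0 ∨ k = 1 ∨ k = 2 := by revert k; decide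
  rcases hk with rfl | rfl | rfl
  · rw [c0]; simp
  · have e1 : -(1 : ZMod 3) = 2 := by decide
    have e2 : -(2 * 1 : ZMod 3) = 1 := by decide
    rw [e1, e2, v1, v2, c1]; ring
  · have e1 : -(2 : ZMod 3) = 1 := by decide
    have e2 : -(2 * 2 : ZMod 3) = 2 := by decide
    rw [e1, e2, v1, v2, c2]; ring

theorem natCast_ne_neg_natCast {k : ℕ} (hk : 0 < k) (n : ℕ) : (k : ℂ) ≠ -n := by
  intro h
  have h2 : ((k + n : ℕ) : ℂ) = 0 := by push_cast; rw [h]; ring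
  have h3 : k + n = 0 := by exact_mod_cast h2
  omega

theorem eventually_ne_neg_natCast {k : ℕ} (hk : 1 < k) :
    ∀ᶠ s in 𝓝 (k : ℂ), 1 < s.re :=
  (isOpen_lt continuous_const Complex.continuous_re).mem_nhds (by
    show (1 : ℝ) < (k : ℂ).re
    simpa using hk)

theorem ne_neg_natCast_of_one_lt_re {s : ℂ} (hs : 1 < s.re) (n : ℕ) : s ≠ -n := by
  intro h
  rw [h] at hs
  have : (0 : ℝ) ≤ n := n.cast_nonneg
  simp at hs
  linarith

theorem differentiableAt_two_pi_cpow_neg (s : ℂ) :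
    DifferentiableAt ℂ (fun s : ℂ => (2 * Real.pi : ℂ) ^ (-s)) s := by
  refine DifferentiableAt.const_cpow (by fun_prop) (Or.inl ?_)
  simp

theorem cos_natCast_mul_pi (n : ℕ) : Complex.cos (n * Real.pi) = (-1) ^ n := by
  have h := congrArg (fun x : ℝ => (x : ℂ)) (Real.cos_nat_mul_pi n)
  push_cast at h
  exact h

/-- In the functional equation the factor `cos(πs/2)` vanishes at `s = 2h + 1`, so only its
derivative contributes by the product rule. -/
theorem deriv_riemannZeta_neg_two_mul {h : ℕ} (hh : 1 ≤ h) :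
    deriv riemannZeta (-2 * (h : ℂ)) =
      (-1) ^ h * ((2 * h).factorial : ℂ) / (2 * (2 * Real.pi) ^ (2 * h)) *
        riemannZeta ((2 * h + 1 : ℕ) : ℂ) := by
  have hpi : (Real.pi : ℂ) ≠ 0 := by exact_mod_cast Real.pi_ne_zero
  set s₀ : ℂ := ((2 * h + 1 : ℕ) : ℂ) with hs₀
  have hk : 1 < 2 * h + 1 := by omega
  have h1 : ∀ᶠ s in 𝓝 s₀, riemannZeta (1 - s) =
      (2 * (2 * Real.pi) ^ (-s) * Complex.Gamma s * riemannZeta s) * Complex.cos (Real.pi * s / 2) := by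
    filter_upwards [eventually_ne_neg_natCast hk] with s hs
    rw [riemannZeta_one_sub (ne_neg_natCast_of_one_lt_re hs) (by rintro rfl; simp at hs)]
    ring
  have hs1 : s₀ ≠ 1 := by
    rw [hs₀]; norm_cast; omega
  have hA : DifferentiableAt ℂ (fun s : ℂ =>
      2 * (2 * Real.pi : ℂ) ^ (-s) * Complex.Gamma s * riemannZeta s) s₀ :=
    (((differentiableAt_two_pi_cpow_neg s₀).const_mul 2).mul
      (Complex.differentiableAt_Gamma _ (natCast_ne_neg_natCast (by omega)))).mul
      (differentiableAt_riemannZeta hs1)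
  have hB : HasDerivAt (fun s : ℂ => Complex.cos (Real.pi * s / 2))
      (-Complex.sin (Real.pi * s₀ / 2) * (Real.pi * 1 / 2)) s₀ :=
    (((hasDerivAt_id s₀).const_mul (Real.pi : ℂ)).div_const 2).ccos
  have harg : Real.pi * s₀ / 2 = h * Real.pi + Real.pi / 2 := by rw [hs₀]; push_cast; ring
  have hsin : Complex.sin (Real.pi * s₀ / 2) = (-1) ^ h := by
    rw [harg, Complex.sin_add_pi_div_two, cos_natCast_mul_pi]
  have hcos : Complex.cos (Real.pi * s₀ / 2) = 0 := by
    rw [harg, Complex.cos_add_pi_div_two, Complex.sin_nat_mul_pi, neg_zero]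
  have hR := hA.hasDerivAt.mul hB
  have h1s : 1 - s₀ = -2 * (h : ℂ) := by rw [hs₀]; push_cast; ring
  have hne : (1 : ℂ) - s₀ ≠ 1 := by
    rw [h1s]
    intro h'
    have := congrArg Complex.re h'
    have hn : (0 : ℝ) ≤ h := h.cast_nonneg
    simp at this
    linarith
  have hL : HasDerivAt (fun s => riemannZeta (1 - s)) (deriv riemannZeta (1 - s₀) * (-1)) s₀ :=
    (differentiableAt_riemannZeta hne).hasDerivAt.comp s₀ ((hasDerivAt_id s₀).const_sub 1)
  have heq := (hL.congr_of_eventuallyEq (h1.mono fun s hs => hs.symm)).unique hR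
  rw [hcos, hsin, h1s] at heq
  have hG : Complex.Gamma s₀ = ((2 * h).factorial : ℂ) := by
    rw [hs₀, Nat.cast_add, Nat.cast_one, Complex.Gamma_nat_eq_factorial]
  have hp : (2 * Real.pi : ℂ) ^ (-s₀) = ((2 * Real.pi : ℂ) ^ (2 * h + 1))⁻¹ := by
    rw [Complex.cpow_neg, hs₀, Complex.cpow_natCast]
  rw [hG, hp] at heq
  have : deriv riemannZeta (-2 * (h : ℂ)) = 2 * ((2 * Real.pi : ℂ) ^ (2 * h + 1))⁻¹ *
      ((2 * h).factorial : ℂ) * riemannZeta s₀ * ((-1) ^ h * (Real.pi / 2)) := by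
    linear_combination -heq
  rw [this, pow_succ (2 * (Real.pi : ℂ)) (2 * h)]
  field_simp

/-- As `χ₋₃` is odd, the two exponentials of the general functional equation occur with opposite
signs and combine to a sine. -/
theorem LFunction_chi3_one_sub {s : ℂ} (hs : 1 < s.re) :
    MahlerQ.chi3.LFunction (1 - s) = (2 * ((√3 : ℝ) : ℂ) * (3 : ℂ) ^ (s - 1) *
      (2 * Real.pi) ^ (-s) * Complex.Gamma s * MahlerQ.chi3.LFunction s) *
        Complex.sin (Real.pi * s / 2) := by
  have h := ZMod.LFunction_one_sub (MahlerQ.chi3 ·) (ne_neg_natCast_of_one_lt_re hs)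
    (Or.inl (by simpa using chi3_natCast 0))
  have hneg : (fun x : ZMod 3 => MahlerQ.chi3 (-x)) = fun x => (-1) * MahlerQ.chi3 x := by
    funext x
    have c2 : MahlerQ.chi3 (-1) = -1 := by
      have e : (-1 : ZMod 3) = ((2 : ℕ) : ZMod 3) := by decide
      rw [e]; simpa using chi3_natCast 2
    rw [← neg_one_mul, map_mul, c2]
  have hmul : ∀ c : ℂ, ZMod.LFunction (fun x : ZMod 3 => c * MahlerQ.chi3 x) s =
      c * MahlerQ.chi3.LFunction s := by
    intro c
    change ZMod.LFunction _ s = c * ZMod.LFunction (MahlerQ.chi3 ·) s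
    rw [ZMod.LFunction, ZMod.LFunction, ← mul_assoc, mul_comm c,
      mul_assoc]
    congr 1
    rw [Finset.mul_sum]
    exact Finset.sum_congr rfl fun j _ => by ring
  have hdft2 : ZMod.dft (fun x : ZMod 3 => (-1) * MahlerQ.chi3 x) =
      fun k => (Complex.I * ((√3 : ℝ) : ℂ)) * MahlerQ.chi3 k := by
    have : (fun x : ZMod 3 => (-1) * MahlerQ.chi3 x) = (-1 : ℂ) • (MahlerQ.chi3 ·) := by
      funext x; simp
    rw [this, map_smul, dft_chi3]
    funext k
    simp
  rw [hneg, hdft2, dft_chi3, hmul, hmul] at h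
  change ZMod.LFunction (MahlerQ.chi3 ·) (1 - s) = _
  rw [h, Complex.sin]
  have e1 : Real.pi * Complex.I * s / 2 = Real.pi * s / 2 * Complex.I := by ring
  have e2 : -Real.pi * Complex.I * s / 2 = -(Real.pi * s / 2) * Complex.I := by ring
  rw [e1, e2]
  push_cast
  ring

/-- As for the zeta function: the factor `sin(πs/2)` vanishes at `s = 2h + 2`. -/
theorem deriv_LFunction_chi3 (h : ℕ) :
    deriv MahlerQ.chi3.LFunction (-2 * (h : ℂ) - 1) =
      (-1) ^ h * ((√3 : ℝ) : ℂ) * 3 ^ (2 * h + 1) * ((2 * h + 1).factorial : ℂ) /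
        (2 * (2 * Real.pi) ^ (2 * h + 1)) * MahlerQ.chi3.LFunction ((2 * h + 2 : ℕ) : ℂ) := by
  have hpi : (Real.pi : ℂ) ≠ 0 := by exact_mod_cast Real.pi_ne_zero
  have hchi : MahlerQ.chi3 ≠ 1 := by
    intro hc
    have h1 := chi3_natCast 2
    rw [hc] at h1
    have : IsUnit ((2 : ℕ) : ZMod 3) := by decide
    rw [MulChar.one_apply this] at h1
    norm_num at h1
  have hdiff := DirichletCharacter.differentiable_LFunction hchi
  set s₀ : ℂ := ((2 * h + 2 : ℕ) : ℂ) with hs₀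
  have hk : 1 < 2 * h + 2 := by omega
  have h1 : ∀ᶠ s in 𝓝 s₀, MahlerQ.chi3.LFunction (1 - s) =
      (2 * ((√3 : ℝ) : ℂ) * (3 : ℂ) ^ (s - 1) *
      (2 * Real.pi) ^ (-s) * Complex.Gamma s * MahlerQ.chi3.LFunction s) *
        Complex.sin (Real.pi * s / 2) := by
    filter_upwards [eventually_ne_neg_natCast hk] with s hs
    exact LFunction_chi3_one_sub hs
  have hA : DifferentiableAt ℂ (fun s : ℂ => 2 * ((√3 : ℝ) : ℂ) * (3 : ℂ) ^ (s - 1) *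
      (2 * Real.pi : ℂ) ^ (-s) * Complex.Gamma s * MahlerQ.chi3.LFunction s) s₀ := by
    have h3 : DifferentiableAt ℂ (fun s : ℂ => (3 : ℂ) ^ (s - 1)) s₀ :=
      DifferentiableAt.const_cpow (by fun_prop) (Or.inl (by norm_num))
    exact (((h3.const_mul _).mul (differentiableAt_two_pi_cpow_neg s₀)).mul
      (Complex.differentiableAt_Gamma _ (natCast_ne_neg_natCast (by omega)))).mul (hdiff s₀)
  have hB : HasDerivAt (fun s : ℂ => Complex.sin (Real.pi * s / 2))
      (Complex.cos (Real.pi * s₀ / 2) * (Real.pi * 1 / 2)) s₀ :=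
    (((hasDerivAt_id s₀).const_mul (Real.pi : ℂ)).div_const 2).csin
  have harg : Real.pi * s₀ / 2 = ((h + 1 : ℕ) : ℂ) * Real.pi := by rw [hs₀]; push_cast; ring
  have hsin : Complex.sin (Real.pi * s₀ / 2) = 0 := by
    rw [harg, Complex.sin_nat_mul_pi]
  have hcos : Complex.cos (Real.pi * s₀ / 2) = (-1) ^ (h + 1) := by
    rw [harg, cos_natCast_mul_pi]
  have hR := hA.hasDerivAt.mul hB
  have h1s : 1 - s₀ = -2 * (h : ℂ) - 1 := by rw [hs₀]; push_cast; ring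
  have hL : HasDerivAt (fun s => MahlerQ.chi3.LFunction (1 - s))
      (deriv MahlerQ.chi3.LFunction (1 - s₀) * (-1)) s₀ :=
    (hdiff (1 - s₀)).hasDerivAt.comp s₀ ((hasDerivAt_id s₀).const_sub 1)
  have heq := (hL.congr_of_eventuallyEq (h1.mono fun s hs => hs.symm)).unique hR
  rw [hcos, hsin, h1s] at heq
  have hG : Complex.Gamma s₀ = ((2 * h + 1).factorial : ℂ) := by
    have : s₀ = ((2 * h + 1 : ℕ) : ℂ) + 1 := by rw [hs₀]; push_cast; ring
    rw [this, Complex.Gamma_nat_eq_factorial]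
  have hp : (2 * Real.pi : ℂ) ^ (-s₀) = ((2 * Real.pi : ℂ) ^ (2 * h + 2))⁻¹ := by
    rw [Complex.cpow_neg, hs₀, Complex.cpow_natCast]
  have h3 : (3 : ℂ) ^ (s₀ - 1) = 3 ^ (2 * h + 1) := by
    have : s₀ - 1 = ((2 * h + 1 : ℕ) : ℂ) := by rw [hs₀]; push_cast; ring
    rw [this, Complex.cpow_natCast]
  rw [hG, hp, h3] at heq
  have : deriv MahlerQ.chi3.LFunction (-2 * (h : ℂ) - 1) =
      2 * ((√3 : ℝ) : ℂ) * 3 ^ (2 * h + 1) * ((2 * Real.pi : ℂ) ^ (2 * h + 2))⁻¹ *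
      ((2 * h + 1).factorial : ℂ) * MahlerQ.chi3.LFunction s₀ * ((-1) ^ h * (Real.pi / 2)) := by
    rw [pow_succ (-1 : ℂ) h] at heq
    linear_combination -heq
  rw [this, pow_succ (2 * Real.pi : ℂ) (2 * h + 1)]
  field_simp

end
end MahlerProof

-- Moments of the kernels as special values

namespace MahlerProof
noncomputable section
open MeasureTheory Set Filter Topology

/-- The real kernel `u ^ k (e ^ {2u} - (-1) ^ k e ^ {-2u}) / (2 sinh 3u)`. -/
def realKern (k : ℕ) (u : ℝ) : ℝ :=
  u ^ k * (Real.exp (2 * u) - (-1) ^ k * Real.exp (-(2 * u))) / (2 * Real.sinh (3 * u))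

theorem ofReal_realKern (k : ℕ) (u : ℝ) : (realKern k u : ℂ) = kern k 2 u := by
  rw [realKern, kern]; push_cast; rfl

theorem integrableOn_realKern (k : ℕ) : IntegrableOn (realKern k) (Ioi 0) := by
  have h := integrableOn_kern k (w := 2) (by norm_num)
  refine (h.re).congr (Eventually.of_forall fun u => ?_)
  simp [← ofReal_realKern]

theorem measurable_realKern (k : ℕ) : Measurable (realKern k) := by
  unfold realKern
  have : Measurable fun u : ℝ => Real.sinh (3 * u) := (by fun_prop : Continuous _).measurable
  fun_prop

theorem norm_id_mul_realKern_le (k : ℕ) {u : ℝ} (hu : 0 < u) :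
    ‖u * realKern k u‖ ≤ kernBound k 2 u := by
  have hs : 0 < Real.sinh (3 * u) := Real.sinh_pos_iff.mpr (by linarith)
  have h1 := norm_exp_sub_sign_le k 2 hu
  have h2 := div_sinh_le hu
  rw [norm_mul, ← Complex.norm_real (realKern k u), ofReal_realKern, Real.norm_of_nonneg hu.le,
    kern, norm_div, norm_mul, norm_pow, Complex.norm_real, Complex.norm_real,
    Real.norm_of_nonneg hu.le, Real.norm_of_nonneg (by linarith : 0 ≤ 2 * Real.sinh (3 * u))]
  have h3 : |(2 : ℂ).re| = 2 := by norm_num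
  rw [h3] at h1
  calc u * (u ^ k * ‖Complex.exp (2 * u) - (-1) ^ k * Complex.exp (-(2 * u))‖ /
      (2 * Real.sinh (3 * u))) ≤ u * (u ^ k * (2 * Real.exp (2 * u)) / (2 * Real.sinh (3 * u))) := by
        gcongr
    _ = u ^ k * (u / Real.sinh (3 * u)) * Real.exp (2 * u) := by field_simp
    _ ≤ u ^ k * ((1 + 6 * u) / 3 * Real.exp (-3 * u)) * Real.exp (2 * u) := by gcongr
    _ = kernBound k 2 u := (kernBound_eq _ _ _).symm

theorem integrableOn_id_mul_realKern (k : ℕ) :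
    IntegrableOn (fun u => u * realKern k u) (Ioi 0) := by
  refine (integrableOn_kernBound k (ρ := 2) (by norm_num)).mono'
    (measurable_id.mul (measurable_realKern k)).aestronglyMeasurable ?_
  filter_upwards [ae_restrict_mem measurableSet_Ioi] with u hu
  exact norm_id_mul_realKern_le k hu

theorem summable_one_div_six_mul_add_pow (k : ℕ) {b : ℝ} (hb : 1 ≤ b) :
    Summable fun j : ℕ => 1 / (6 * (j : ℝ) + b) ^ (k + 2) := by
  refine Summable.of_nonneg_of_le (fun j => by positivity) (fun j => ?_)
    (summable_one_div_sq (by linarith : 0 < b))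
  have h1 : 1 ≤ 6 * (j : ℝ) + b := by
    have : (0 : ℝ) ≤ j := j.cast_nonneg
    linarith
  exact one_div_le_one_div_of_le (by positivity) (pow_le_pow_right₀ h1 (by omega))

/-- Multiplying `e^{±2u}` into the expansion of `1/(2 sinh 3u)` produces the exponents `6j + 1` and
`6j + 5`. Thanks to the extra factor `u` the powers are at least `2`, so the two series converge
separately. -/
theorem hasSum_integral_id_mul_realKern (k : ℕ) :
    HasSum (fun j : ℕ => ((k + 1).factorial : ℝ) * (1 / (6 * (j : ℝ) + 1) ^ (k + 2) -
      (-1) ^ k * (1 / (6 * (j : ℝ) + 5) ^ (k + 2))))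
      (∫ u in Ioi (0 : ℝ), u * realKern k u) := by
  have hb : ∀ (j : ℕ) (b : ℝ), 0 < b → 0 < 6 * (j : ℝ) + b := fun j b h => by positivity
  set E : ℕ → ℝ → ℝ → ℝ := fun j b u => u ^ (k + 1) * Real.exp (-(6 * (j : ℝ) + b) * u) with hE
  have hEi : ∀ j b, 0 < b → IntegrableOn (E j b) (Ioi 0) := fun j b h =>
    integrableOn_pow_mul_exp_neg (k + 1) (hb j b h)
  have hEv : ∀ j b, 0 < b → ∫ u in Ioi (0 : ℝ), E j b u =
      ((k + 1).factorial : ℝ) * (1 / (6 * (j : ℝ) + b) ^ (k + 2)) := fun j b h => by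
    rw [hE, integral_pow_mul_exp_neg (k + 1) (hb j b h)]; ring
  set F : ℕ → ℝ → ℝ := fun j u => E j 1 u - (-1) ^ k * E j 5 u with hF
  have hFi : ∀ j, IntegrableOn (F j) (Ioi 0) := fun j =>
    (hEi j 1 one_pos).sub ((hEi j 5 (by norm_num)).const_mul _)
  have hFn : ∀ j, ∫ u in Ioi (0 : ℝ), ‖F j u‖ ≤ ((k + 1).factorial : ℝ) *
      (1 / (6 * (j : ℝ) + 1) ^ (k + 2)) + ((k + 1).factorial : ℝ) *
      (1 / (6 * (j : ℝ) + 5) ^ (k + 2)) := by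
    intro j
    rw [← hEv j 1 one_pos, ← hEv j 5 (by norm_num),
      ← integral_add (hEi j 1 one_pos) (hEi j 5 (by norm_num))]
    refine integral_mono_ae (hFi j).norm ((hEi j 1 one_pos).add (hEi j 5 (by norm_num))) ?_
    filter_upwards [ae_restrict_mem measurableSet_Ioi] with u hu
    have hu' : 0 < u := hu
    have hpos : ∀ b, 0 ≤ E j b u := fun b => by rw [hE]; positivity
    refine (norm_sub_le _ _).trans ?_
    rw [norm_mul ((-1) ^ k), norm_pow (-1 : ℝ), norm_neg, norm_one, one_pow, one_mul,
      Real.norm_of_nonneg (hpos 1), Real.norm_of_nonneg (hpos 5)]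
  have hsum : Summable fun j => ∫ u in Ioi (0 : ℝ), ‖F j u‖ :=
    Summable.of_nonneg_of_le (fun j => integral_nonneg fun u => norm_nonneg _) hFn
      (((summable_one_div_six_mul_add_pow k le_rfl).mul_left _).add
        ((summable_one_div_six_mul_add_pow k (by norm_num)).mul_left _))
  have h := hasSum_integral_of_summable_integral_norm hFi hsum
  have hval : ∀ j, ∫ u in Ioi (0 : ℝ), F j u = ((k + 1).factorial : ℝ) *
      (1 / (6 * (j : ℝ) + 1) ^ (k + 2) - (-1) ^ k * (1 / (6 * (j : ℝ) + 5) ^ (k + 2))) := by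
    intro j
    rw [hF]
    dsimp only
    rw [integral_sub (hEi j 1 one_pos) ((hEi j 5 (by norm_num)).const_mul _),
      integral_const_mul, hEv j 1 one_pos, hEv j 5 (by norm_num)]
    ring
  simp only [hval] at h
  suffices hT : ∫ u in Ioi (0 : ℝ), u * realKern k u = ∫ u in Ioi (0 : ℝ), ∑' j, F j u by
    rw [hT]; exact h
  refine setIntegral_congr_fun measurableSet_Ioi fun u hu => ?_
  have h3 := (hasSum_inv_two_sinh hu).mul_left
    (u ^ (k + 1) * (Real.exp (2 * u) - (-1) ^ k * Real.exp (-(2 * u))))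
  have h4 : ∀ j, F j u = u ^ (k + 1) * (Real.exp (2 * u) - (-1) ^ k * Real.exp (-(2 * u))) *
      Real.exp (-(6 * j + 3) * u) := by
    intro j
    have e1 : Real.exp (2 * u) * Real.exp (-(6 * j + 3) * u) =
        Real.exp (-(6 * (j : ℝ) + 1) * u) := by rw [← Real.exp_add]; ring_nf
    have e2 : Real.exp (-(2 * u)) * Real.exp (-(6 * j + 3) * u) =
        Real.exp (-(6 * (j : ℝ) + 5) * u) := by rw [← Real.exp_add]; ring_nf
    simp only [hF, hE]
    linear_combination -u ^ (k + 1) * e1 + (-1) ^ k * u ^ (k + 1) * e2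
  simp only [← h4] at h3
  change u * realKern k u = ∑' j, F j u
  rw [h3.tsum_eq, realKern]
  ring

theorem integral_id_mul_realKern_eq_resSum (k : ℕ) :
    ((∫ u in Ioi (0 : ℝ), u * realKern k u : ℝ) : ℂ) = ((k + 1).factorial : ℂ) *
      (resSum (k + 2) 1 - (-1) ^ k * resSum (k + 2) 5) := by
  have h1 := ((summable_one_div_six_mul_add_pow k le_rfl).mapL Complex.ofRealCLM).hasSum
  have h5 := ((summable_one_div_six_mul_add_pow k (b := 5) (by norm_num)).mapL
    Complex.ofRealCLM).hasSum
  have h := (hasSum_integral_id_mul_realKern k).mapL Complex.ofRealCLM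
  have h' := (h1.sub (h5.mul_left ((-1) ^ k))).mul_left ((k + 1).factorial : ℂ)
  refine (h.unique (h'.congr_fun fun j => ?_)).trans ?_
  · simp
  · simp only [resSum, Complex.ofRealCLM_apply]
    push_cast
    simp only [add_comm]

/-- The moments with even exponent are values of the `L`-function of conductor three. -/
theorem integral_id_mul_realKern_even (h : ℕ) :
    (((√3 / Real.pi) * (3 / Real.pi) ^ (2 * h) * ∫ u in Ioi (0 : ℝ), u * realKern (2 * h) u : ℝ) : ℂ) =
      (-1) ^ h * (2 ^ (2 * h + 2) + 1) / 3 * deriv MahlerQ.chi3.LFunction (-2 * (h : ℂ) - 1) := by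
  have hpi : (Real.pi : ℂ) ≠ 0 := by exact_mod_cast Real.pi_ne_zero
  have h3 : (-1 : ℂ) ^ h * (-1) ^ h = 1 := by rw [← mul_pow]; simp
  rw [Complex.ofReal_mul, integral_id_mul_realKern_eq_resSum, pow_mul (-1 : ℂ), neg_one_sq, one_pow, one_mul,
    resSum_one_sub_resSum_five (by omega), deriv_LFunction_chi3]
  have h4 : (2 * Real.pi : ℂ) ^ (2 * h + 1) = 2 ^ (2 * h + 1) * (Real.pi * Real.pi ^ (2 * h)) := by
    rw [mul_pow, pow_succ']; ring
  rw [h4]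
  push_cast
  rw [pow_succ' (3 : ℂ), div_pow]
  have h5 : (2 : ℂ) ^ (2 * h + 2) = 2 * 2 ^ (2 * h + 1) := by rw [pow_succ']
  rw [h5]
  generalize MahlerQ.chi3.LFunction _ = Z
  generalize ((2 * h + 1).factorial : ℂ) = G
  field_simp
  linear_combination (-(2 * (2 : ℂ) ^ (2 * h + 1) + 1) * Z * G) * h3

/-- The moments with odd exponent are values of the zeta function. -/
theorem integral_id_mul_realKern_odd {h : ℕ} (hh : 1 ≤ h) :
    (((√3 / Real.pi) * (3 / Real.pi) ^ (2 * h - 1) *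
      ∫ u in Ioi (0 : ℝ), u * realKern (2 * h - 1) u : ℝ) : ℂ) =
      (-1) ^ h * ((3 ^ (2 * h + 1) - 1) * (2 ^ (2 * h + 1) - 1)) * ((√3 : ℝ) : ℂ) / 9 *
        deriv riemannZeta (-2 * (h : ℂ)) := by
  have hpi : (Real.pi : ℂ) ≠ 0 := by exact_mod_cast Real.pi_ne_zero
  have h3 : (-1 : ℂ) ^ h * (-1) ^ h = 1 := by rw [← mul_pow]; simp
  have e1 : 2 * h - 1 + 1 = 2 * h := by omega
  have e2 : 2 * h - 1 + 2 = 2 * h + 1 := by omega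
  have e3 : (-1 : ℂ) ^ (2 * h - 1) = -1 := Odd.neg_one_pow ⟨h - 1, by omega⟩
  rw [Complex.ofReal_mul, integral_id_mul_realKern_eq_resSum, e1, e2, e3, neg_one_mul,
    sub_neg_eq_add, resSum_one_add_resSum_five (by omega), deriv_riemannZeta_neg_two_mul hh]
  have h4 : (2 * Real.pi : ℂ) ^ (2 * h) = 2 ^ (2 * h) * (Real.pi * Real.pi ^ (2 * h - 1)) := by
    rw [mul_pow, ← pow_succ', e1]
  rw [h4]
  push_cast
  rw [div_pow]
  have h5 : (2 : ℂ) ^ (2 * h + 1) = 2 * 2 ^ (2 * h) := by rw [pow_succ']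
  have h6 : (3 : ℂ) ^ (2 * h + 1) = 9 * 3 ^ (2 * h - 1) := by
    rw [show 2 * h + 1 = 2 * h - 1 + 2 by omega, pow_add]; ring
  rw [h5, h6]
  generalize riemannZeta _ = Z
  generalize ((2 * h).factorial : ℂ) = G
  field_simp
  linear_combination (-((2 * (2 : ℂ) ^ (2 * h) - 1) * (9 * 3 ^ (2 * h - 1) - 1)) * Z * G) * h3

end
end MahlerProof

-- The law of the logarithm of one factor

namespace MahlerProof
noncomputable section
open MeasureTheory Set Filter Topology
open scoped ENNReal

/-- The factor `(e^{iθ} + ω) / (e^{iθ} + 1)`. -/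
def ratio (θ : ℝ) : ℂ :=
  (Complex.exp ((θ : ℂ) * Complex.I) + MahlerQ.omega) / (Complex.exp ((θ : ℂ) * Complex.I) + 1)

theorem measurable_ratio : Measurable ratio := by
  unfold ratio
  fun_prop

theorem ratio_add_two_pi (θ : ℝ) : ratio (θ + 2 * Real.pi) = ratio θ := by
  have : Complex.exp (((θ + 2 * Real.pi : ℝ) : ℂ) * Complex.I) =
      Complex.exp ((θ : ℂ) * Complex.I) := by
    rw [← Complex.exp_periodic ((θ : ℂ) * Complex.I)]
    congr 1; push_cast; ring
  rw [ratio, ratio, this]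

/-- Half angles: `e^{iθ} + 1 = 2 e^{iθ/2} cos(θ/2)` and `e^{iθ} + ω = e^{iθ/2} e^{iπ/3} (cos(θ/2) +
√3 sin(θ/2))`. -/
theorem norm_ratio {θ : ℝ} (h : Real.cos (θ / 2) ≠ 0) :
    ‖ratio θ‖ = |1 + √3 * Real.tan (θ / 2)| / 2 := by
  have hE : Complex.exp ((θ : ℂ) * Complex.I) =
      ((Real.cos (θ / 2) : ℝ) + (Real.sin (θ / 2) : ℝ) * Complex.I) ^ 2 := by
    rw [Complex.ofReal_cos, Complex.ofReal_sin, ← Complex.exp_mul_I, ← Complex.exp_nat_mul]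
    congr 1; push_cast; ring
  have hρ : (1 / 2 + ((√3 : ℝ) : ℂ) / 2 * Complex.I) =
      Complex.exp ((Real.pi / 3 : ℝ) * Complex.I) := by
    rw [Complex.exp_mul_I, ← Complex.ofReal_cos, ← Complex.ofReal_sin, Real.cos_pi_div_three,
      Real.sin_pi_div_three]
    push_cast; ring
  have hcs : ((Real.cos (θ / 2) : ℝ) : ℂ) ^ 2 + ((Real.sin (θ / 2) : ℝ) : ℂ) ^ 2 = 1 := by
    exact_mod_cast Real.cos_sq_add_sin_sq (θ / 2)
  have h3 := sqrt_three_sq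
  have hunit : ‖((Real.cos (θ / 2) : ℝ) : ℂ) + (Real.sin (θ / 2) : ℝ) * Complex.I‖ = 1 := by
    rw [Complex.ofReal_cos, Complex.ofReal_sin, ← Complex.exp_mul_I, Complex.norm_exp_ofReal_mul_I]
  rw [ratio, hE, MahlerQ.omega, exp_two_pi_I_div_three, Real.tan_eq_sin_div_cos]
  generalize hc : Real.cos (θ / 2) = c at *
  generalize hs : Real.sin (θ / 2) = s at *
  have e1 : ((c : ℂ) + s * Complex.I) ^ 2 + (-1 / 2 + ((√3 : ℝ) : ℂ) / 2 * Complex.I) =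
      ((c : ℂ) + s * Complex.I) * (1 / 2 + ((√3 : ℝ) : ℂ) / 2 * Complex.I) *
        ((c + √3 * s : ℝ) : ℂ) := by
    push_cast
    linear_combination (1 / 2 - ((√3 : ℝ) : ℂ) / 2 * Complex.I) * hcs +
      ((s : ℂ) ^ 2 - ((√3 : ℝ) : ℂ) / 2 * s * (c + ((√3 : ℝ) : ℂ) * s)) * Complex.I_sq +
      ((s : ℂ) ^ 2 / 2 - c * s * Complex.I / 2) * h3
  have e2 : ((c : ℂ) + s * Complex.I) ^ 2 + 1 =
      ((c : ℂ) + s * Complex.I) * ((2 * c : ℝ) : ℂ) := by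
    push_cast
    linear_combination (s : ℂ) ^ 2 * Complex.I_sq - hcs
  rw [e1, e2, hρ, norm_div, norm_mul, norm_mul, norm_mul, hunit, Complex.norm_exp_ofReal_mul_I,
    Complex.norm_real, Complex.norm_real, Real.norm_eq_abs, Real.norm_eq_abs, one_mul, one_mul,
    one_mul, abs_mul, abs_two, ← div_div, div_right_comm, ← abs_div]
  congr 2
  field_simp

/-- The angle at which `1 + √3 tan (θ / 2)` equals `2 σ e ^ u`. -/
def angle (σ u : ℝ) : ℝ := 2 * Real.arctan ((2 * σ * Real.exp u - 1) / √3)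

theorem sqrt_three_pos : 0 < √3 := Real.sqrt_pos.mpr (by norm_num)

theorem one_add_tan_angle (σ u : ℝ) : 1 + √3 * Real.tan (angle σ u / 2) = 2 * σ * Real.exp u := by
  have := sqrt_three_pos.ne'
  rw [angle, mul_div_cancel_left₀ _ two_ne_zero, Real.tan_arctan]
  field_simp
  ring

theorem angle_mem (σ u : ℝ) : angle σ u ∈ Ioo (-Real.pi) Real.pi := by
  have h1 := Real.neg_pi_div_two_lt_arctan ((2 * σ * Real.exp u - 1) / √3)
  have h2 := Real.arctan_lt_pi_div_two ((2 * σ * Real.exp u - 1) / √3)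
  rw [angle]
  constructor <;> linarith

theorem cos_half_ne_zero {x : ℝ} (hx : x ∈ Ioo (-Real.pi) Real.pi) : Real.cos (x / 2) ≠ 0 :=
  (Real.cos_pos_of_mem_Ioo ⟨by linarith [hx.1], by linarith [hx.2]⟩).ne'

theorem norm_ratio_angle {σ : ℝ} (hσ : |σ| = 1) (u : ℝ) : ‖ratio (angle σ u)‖ = Real.exp u := by
  rw [norm_ratio (cos_half_ne_zero (angle_mem σ u)), one_add_tan_angle, abs_mul, abs_mul, hσ,
    abs_two, abs_of_pos (Real.exp_pos u)]
  ring

theorem angle_injective {σ : ℝ} (hσ : |σ| = 1) : Function.Injective (angle σ) := by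
  intro u v h
  have h1 := norm_ratio_angle hσ u
  rw [h, norm_ratio_angle hσ v] at h1
  exact (Real.exp_injective h1).symm

/-- The absolute value of the derivative of `angle σ`. -/
def angleDens (σ u : ℝ) : ℝ := √3 * Real.exp u / (Real.exp u ^ 2 - σ * Real.exp u + 1)

theorem hasDerivAt_angle {σ : ℝ} (hσ : σ ^ 2 = 1) (u : ℝ) :
    HasDerivAt (angle σ) (σ * angleDens σ u) u := by
  have h1 : HasDerivAt (fun u => (2 * σ * Real.exp u - 1) / √3) (2 * σ * Real.exp u / √3) u :=
    (((Real.hasDerivAt_exp u).const_mul (2 * σ)).sub_const 1).div_const _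
  refine (h1.arctan.const_mul 2).congr_deriv ?_
  have h3 : (√3 : ℝ) ^ 2 = 3 := Real.sq_sqrt (by norm_num)
  have hs := sqrt_three_pos.ne'
  rw [angleDens]
  generalize Real.exp u = x
  have hd : 0 < x ^ 2 - σ * x + 1 := by nlinarith [sq_nonneg (2 * x - σ)]
  have hd' : 1 + ((2 * σ * x - 1) / √3) ^ 2 = 4 * (x ^ 2 - σ * x + 1) / 3 := by
    rw [div_pow, h3]
    linear_combination (4 / 3) * x ^ 2 * hσ
  rw [hd']
  field_simp
  rw [h3]
  ring

theorem angleDens_pos {σ : ℝ} (hσ : σ ^ 2 = 1) (u : ℝ) : 0 < angleDens σ u := by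
  have hd : 0 < Real.exp u ^ 2 - σ * Real.exp u + 1 := by nlinarith [sq_nonneg (2 * Real.exp u - σ)]
  have := sqrt_three_pos
  rw [angleDens]
  positivity

theorem continuous_angle (σ : ℝ) : Continuous (angle σ) := by
  unfold angle
  exact (Real.continuous_arctan.comp (by fun_prop)).const_mul 2

/-- The sign of `1 + √3 tan(x/2)` decides between the two branches; `angle 0 0` is the single point
where it vanishes. -/
theorem Ioo_eq_range_angle :
    Ioo (-Real.pi) Real.pi = range (angle 1) ∪ range (angle (-1)) ∪ {angle 0 0} := by
  apply Subset.antisymm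
  · intro x hx
    have hx2 : Real.arctan (Real.tan (x / 2)) = x / 2 :=
      Real.arctan_tan (by linarith [hx.1]) (by linarith [hx.2])
    have hs := sqrt_three_pos.ne'
    have key : ∀ σ u, 1 + √3 * Real.tan (x / 2) = 2 * σ * Real.exp u → angle σ u = x := by
      intro σ u h
      rw [angle, ← h, add_sub_cancel_left, mul_div_cancel_left₀ _ hs, hx2]
      ring
    rcases lt_trichotomy (1 + √3 * Real.tan (x / 2)) 0 with h | h | h
    · refine Or.inl (Or.inr ⟨Real.log (-(1 + √3 * Real.tan (x / 2)) / 2), key _ _ ?_⟩)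
      rw [Real.exp_log (by linarith)]; ring
    · exact Or.inr (key 0 0 (by rw [h]; ring)).symm
    · refine Or.inl (Or.inl ⟨Real.log ((1 + √3 * Real.tan (x / 2)) / 2), key _ _ ?_⟩)
      rw [Real.exp_log (by linarith)]; ring
  · rintro x ((⟨u, rfl⟩ | ⟨u, rfl⟩) | h)
    · exact angle_mem _ _
    · exact angle_mem _ _
    · rw [mem_singleton_iff.mp h]; exact angle_mem _ _

theorem disjoint_range_angle : Disjoint (range (angle 1)) (range (angle (-1))) := by
  rw [Set.disjoint_left]
  rintro x ⟨u, rfl⟩ ⟨v, hv⟩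
  have h1 := one_add_tan_angle 1 u
  rw [← hv, one_add_tan_angle] at h1
  have := Real.exp_pos u
  have := Real.exp_pos v
  linarith

theorem setLIntegral_range_angle {σ : ℝ} (hσ : |σ| = 1) (G : ℝ → ℝ≥0∞) :
    ∫⁻ x in range (angle σ), G x = ∫⁻ u, ENNReal.ofReal (angleDens σ u) * G (angle σ u) := by
  have hσ2 : σ ^ 2 = 1 := by rw [← sq_abs, hσ, one_pow]
  have h := lintegral_image_eq_lintegral_abs_deriv_mul MeasurableSet.univ
    (fun u _ => (hasDerivAt_angle hσ2 u).hasDerivWithinAt) (angle_injective hσ).injOn G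
  rw [image_univ, Measure.restrict_univ] at h
  rw [h]
  refine lintegral_congr fun u => ?_
  rw [abs_mul, hσ, one_mul, abs_of_pos (angleDens_pos hσ2 u)]

/-- Periodicity moves the integral to `(-π, π)`, where the two branches of `angle` are coordinates
up to one point. -/
theorem setLIntegral_Icc_of_periodic {G : ℝ → ℝ≥0∞} (hG : ∀ x, G (x + 2 * Real.pi) = G x) :
    ∫⁻ x in Icc 0 (2 * Real.pi), G x = (∫⁻ u, ENNReal.ofReal (angleDens 1 u) * G (angle 1 u)) +
      ∫⁻ u, ENNReal.ofReal (angleDens (-1) u) * G (angle (-1) u) := by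
  have hper : ∀ (g : AddSubgroup.zmultiples (2 * Real.pi)) (x : ℝ), G (g +ᵥ x) = G x := by
    rintro ⟨_, n, rfl⟩ x
    change G (n • (2 * Real.pi) + x) = G x
    have hp : Function.Periodic G (2 * Real.pi) := hG
    rw [add_comm]
    exact hp.zsmul n x
  have h1 := (isAddFundamentalDomain_Ioc Real.two_pi_pos 0).setLIntegral_eq
    (isAddFundamentalDomain_Ioc Real.two_pi_pos (-Real.pi)) G hper
  have e : -Real.pi + 2 * Real.pi = Real.pi := by ring
  rw [zero_add, e] at h1
  have hm : ∀ σ, |σ| = 1 → MeasurableSet (range (angle σ)) := fun σ hσ =>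
    ((continuous_angle σ).measurableEmbedding (angle_injective hσ)).measurableSet_range
  rw [← setLIntegral_congr Ioc_ae_eq_Icc, h1, ← setLIntegral_congr Ioo_ae_eq_Ioc,
    Ioo_eq_range_angle, setLIntegral_congr (union_ae_eq_left_of_ae_eq_empty
      (ae_eq_empty.mpr (measure_singleton _))), lintegral_union (hm _ (by norm_num))
      disjoint_range_angle, setLIntegral_range_angle (by norm_num),
    setLIntegral_range_angle (by norm_num)]

/-- The density of `log ‖ratio θ‖` with respect to `dθ` on `[0, 2π]`. -/
def ratioDens (u : ℝ) : ℝ := angleDens 1 u + angleDens (-1) u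

theorem ratioDens_nonneg (u : ℝ) : 0 ≤ ratioDens u :=
  add_nonneg (angleDens_pos (by norm_num) u).le (angleDens_pos (by norm_num) u).le

theorem angleDens_neg (σ u : ℝ) : angleDens σ (-u) = angleDens σ u := by
  rw [angleDens, angleDens, Real.exp_neg]
  have h := (Real.exp_pos u).ne'
  generalize Real.exp u = x at *
  have e : (x⁻¹) ^ 2 - σ * x⁻¹ + 1 = (x ^ 2 - σ * x + 1) / x ^ 2 := by field_simp; ring
  rw [e]
  by_cases h0 : x ^ 2 - σ * x + 1 = 0
  · simp [h0]
  · field_simp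

theorem ratioDens_neg (u : ℝ) : ratioDens (-u) = ratioDens u := by
  rw [ratioDens, ratioDens, angleDens_neg, angleDens_neg]

/-- With `x = e^u`, the denominators of the two branches multiply to `x⁴ + x² + 1 = (x⁶ - 1)/(x² -
1)`, whence `sinh 3u`. -/
theorem ratioDens_eq {u : ℝ} (hu : 0 < u) : ratioDens u = 2 * √3 * realKern 0 u := by
  have hs : 0 < Real.sinh (3 * u) := Real.sinh_pos_iff.mpr (by linarith)
  have h2 : Real.exp (2 * u) = Real.exp u ^ 2 := by rw [← Real.exp_nat_mul]; norm_num
  have h3 : Real.exp (3 * u) = Real.exp u ^ 3 := by rw [← Real.exp_nat_mul]; norm_num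
  have hx : 1 < Real.exp u := by rw [Real.one_lt_exp_iff]; exact hu
  rw [Real.sinh_eq, Real.exp_neg, h3] at hs
  rw [ratioDens, realKern, pow_zero, pow_zero, one_mul, one_mul, angleDens, angleDens,
    Real.sinh_eq, Real.exp_neg, Real.exp_neg, h2, h3]
  generalize Real.exp u = x at *
  have h1 : 0 < x ^ 2 - 1 * x + 1 := by nlinarith
  have h1' : 0 < x ^ 2 - -1 * x + 1 := by nlinarith
  have h6 : 0 < x ^ 2 - 1 := by nlinarith
  have e6 : x ^ 3 - (x ^ 3)⁻¹ = (x ^ 2 - 1) * (x ^ 2 - 1 * x + 1) * (x ^ 2 - -1 * x + 1) / x ^ 3 := by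
    field_simp; ring
  rw [e6]
  generalize hA : x ^ 2 - 1 * x + 1 = A at *
  generalize hB : x ^ 2 - -1 * x + 1 = B at *
  have hAB : A + B = 2 * (x ^ 2 + 1) := by rw [← hA, ← hB]; ring
  field_simp
  linear_combination (x ^ 2 - 1) * hAB

theorem measurable_ratioDens : Measurable ratioDens := by
  unfold ratioDens angleDens
  fun_prop

theorem lintegral_comp_log_norm_ratio {F : ℝ → ℝ≥0∞} (hF : Measurable F) :
    ∫⁻ θ in Icc 0 (2 * Real.pi), F (Real.log ‖ratio θ‖) =
      ∫⁻ u, ENNReal.ofReal (ratioDens u) * F u := by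
  rw [setLIntegral_Icc_of_periodic (G := fun θ => F (Real.log ‖ratio θ‖))
    (fun x => by rw [ratio_add_two_pi])]
  simp only [norm_ratio_angle (σ := 1) (by norm_num), norm_ratio_angle (σ := -1) (by norm_num),
    Real.log_exp]
  have hm : Measurable fun u => ENNReal.ofReal (angleDens 1 u) * F u := by
    have : Measurable (angleDens 1) := by unfold angleDens; fun_prop
    fun_prop
  rw [← lintegral_add_left hm]
  refine lintegral_congr fun u => ?_
  rw [ratioDens, ENNReal.ofReal_add (angleDens_pos (by norm_num) u).le
    (angleDens_pos (by norm_num) u).le, add_mul]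

/-- The change of variables is applied to the indicator of the zero set, which vanishes on both
branches because the modulus there is `e^u`. -/
theorem ae_ratio_ne_zero : ∀ᵐ θ ∂volume.restrict (Icc 0 (2 * Real.pi)), ratio θ ≠ 0 := by
  have hm : MeasurableSet {θ : ℝ | ratio θ = 0} := measurable_ratio (measurableSet_singleton 0)
  have h := setLIntegral_Icc_of_periodic (G := {θ : ℝ | ratio θ = 0}.indicator 1)
    (fun x => by simp only [indicator, mem_ofPred_eq, ratio_add_two_pi, Pi.one_apply])
  have h0 : ∀ σ, |σ| = 1 → ∀ u, {θ : ℝ | ratio θ = 0}.indicator (1 : ℝ → ℝ≥0∞) (angle σ u) = 0 := by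
    intro σ hσ u
    refine indicator_of_notMem (fun hc => ?_) _
    have h1 := norm_ratio_angle hσ u
    rw [mem_ofPred_eq.mp hc, norm_zero] at h1
    exact (Real.exp_pos u).ne h1
  simp only [h0 1 (by norm_num), h0 (-1) (by norm_num), mul_zero, lintegral_zero, add_zero] at h
  rw [lintegral_indicator_one hm] at h
  rw [ae_iff]
  simpa using h

/-- Lebesgue measure on `[0, 2π]`. -/
def circleMeasure : Measure ℝ := volume.restrict (Icc 0 (2 * Real.pi))

instance : IsFiniteMeasure circleMeasure := by
  unfold circleMeasure; infer_instance

/-- The function `log |(e^{iθ} + ω) / (e^{iθ} + 1)|`. -/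
def logRatio (θ : ℝ) : ℝ := Real.log ‖ratio θ‖

theorem measurable_logRatio : Measurable logRatio :=
  Real.measurable_log.comp measurable_ratio.norm

theorem map_logRatio :
    circleMeasure.map logRatio = volume.withDensity fun u => ENNReal.ofReal (ratioDens u) := by
  ext s hs
  have hF : Measurable (s.indicator (1 : ℝ → ℝ≥0∞)) := measurable_one.indicator hs
  have h := lintegral_comp_log_norm_ratio hF
  rw [Measure.map_apply measurable_logRatio hs, withDensity_apply _ hs,
    ← lintegral_indicator_one (measurable_logRatio hs), ← lintegral_indicator hs]
  refine h.trans (lintegral_congr fun u => ?_)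
  by_cases hu : u ∈ s <;> simp [hu]

theorem integral_comp_logRatio {E : Type*} [NormedAddCommGroup E] [NormedSpace ℝ E] {G : ℝ → E}
    (hG : StronglyMeasurable G) :
    ∫ θ, G (logRatio θ) ∂circleMeasure = ∫ u, ratioDens u • G u := by
  rw [← integral_map measurable_logRatio.aemeasurable hG.aestronglyMeasurable, map_logRatio,
    integral_withDensity_eq_integral_toReal_smul (by have := measurable_ratioDens; fun_prop)
      (Eventually.of_forall fun u => ENNReal.ofReal_lt_top)]
  simp only [ENNReal.toReal_ofReal (ratioDens_nonneg _)]

theorem integrable_comp_logRatio_iff {E : Type*} [NormedAddCommGroup E] [NormedSpace ℝ E]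
    {G : ℝ → E} (hG : StronglyMeasurable G) :
    Integrable (fun θ => G (logRatio θ)) circleMeasure ↔
      Integrable (fun u => ratioDens u • G u) := by
  have h := integrable_map_measure (μ := circleMeasure) hG.aestronglyMeasurable
    measurable_logRatio.aemeasurable
  rw [map_logRatio, integrable_withDensity_iff_integrable_smul'
    (by have := measurable_ratioDens; fun_prop)
    (Eventually.of_forall fun u => ENNReal.ofReal_lt_top)] at h
  simp only [ENNReal.toReal_ofReal (ratioDens_nonneg _)] at h
  exact h.symm

theorem integrable_logRatio : Integrable logRatio circleMeasure := by
  refine (integrable_comp_logRatio_iff (G := id) stronglyMeasurable_id).mpr ?_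
  have h1 : IntegrableOn (fun u => ratioDens u • id u) (Ioi 0) := by
    refine ((integrableOn_id_mul_realKern 0).const_mul (2 * √3)).congr ?_
    filter_upwards [ae_restrict_mem measurableSet_Ioi] with u hu
    rw [ratioDens_eq hu, smul_eq_mul, id]
    ring
  have h2 : IntegrableOn (fun u => ratioDens u • id u) (Iic 0) := by
    have h3 := h1.comp_neg
    rw [Set.neg_Ioi, neg_zero] at h3
    rw [integrableOn_Iic_iff_integrableOn_Iio]
    refine h3.neg.congr (Eventually.of_forall fun u => ?_)
    simp [ratioDens_neg]
  have h := h2.union h1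
  rwa [Iic_union_Ioi, integrableOn_univ] at h

theorem integral_logRatio : ∫ θ, logRatio θ ∂circleMeasure = 0 := by
  refine (integral_comp_logRatio (G := id) stronglyMeasurable_id).trans ?_
  have h := integral_neg_eq_self (fun u => ratioDens u • id u) volume
  simp only [ratioDens_neg, id, smul_eq_mul, mul_neg, integral_neg] at h ⊢
  linarith

theorem kern_add_kern (k : ℕ) (t u : ℝ) :
    kern k (2 + t * Complex.I) u + kern k (2 - t * Complex.I) u =
      ((2 * Real.cos (t * u) * realKern k u : ℝ) : ℂ) := by
  have h1 : Complex.exp ((2 + t * Complex.I) * u) =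
      Complex.exp (2 * u) * Complex.exp ((t * u) * Complex.I) := by
    rw [← Complex.exp_add]; ring_nf
  have h2 : Complex.exp ((2 - t * Complex.I) * u) =
      Complex.exp (2 * u) * Complex.exp (-(t * u) * Complex.I) := by
    rw [← Complex.exp_add]; ring_nf
  have h3 : Complex.exp (-((2 + t * Complex.I) * u)) =
      Complex.exp (-(2 * u)) * Complex.exp (-(t * u) * Complex.I) := by
    rw [← Complex.exp_add]; ring_nf
  have h4 : Complex.exp (-((2 - t * Complex.I) * u)) =
      Complex.exp (-(2 * u)) * Complex.exp ((t * u) * Complex.I) := by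
    rw [← Complex.exp_add]; ring_nf
  have hc : Complex.cos (t * u) = (Complex.exp ((t * u) * Complex.I) +
      Complex.exp (-(t * u) * Complex.I)) / 2 := rfl
  rw [kern, kern, h1, h2, h3, h4, realKern]
  push_cast
  rw [hc]
  ring

theorem integrableOn_cos_mul_realKern (k : ℕ) (t : ℝ) :
    IntegrableOn (fun u => Real.cos (t * u) * realKern k u) (Ioi 0) := by
  refine (integrableOn_realKern k).bdd_mul (c := 1) (by fun_prop) (Eventually.of_forall fun u => ?_)
  rw [Real.norm_eq_abs]
  exact Real.abs_cos_le_one _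

theorem kernInt_add_kernInt (k : ℕ) (t : ℝ) :
    kernInt k (2 + t * Complex.I) + kernInt k (2 - t * Complex.I) =
      ((2 * ∫ u in Ioi (0 : ℝ), Real.cos (t * u) * realKern k u : ℝ) : ℂ) := by
  rw [kernInt, kernInt, ← integral_add (integrableOn_kern k (by simp; norm_num))
    (integrableOn_kern k (by simp; norm_num))]
  simp only [kern_add_kern]
  rw [integral_complex_ofReal, ← integral_const_mul]
  simp only [mul_assoc]

/-- Evenness folds the integral onto the half-line. The cosine transform of `realKern 0` is then the
case `N = 0` of `pair_taylorS_momentFun`, since `d_{0,0} = 1`. -/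
theorem integral_exp_logRatio (t : ℝ) :
    ∫ θ, Complex.exp ((t * logRatio θ : ℝ) * Complex.I) ∂circleMeasure =
      2 * Real.pi * (1 / (2 * Complex.cosh (Real.pi * t / 3) - 1)) := by
  have hm : StronglyMeasurable fun u : ℝ => Complex.exp ((t * u : ℝ) * Complex.I) :=
    (by fun_prop : Continuous _).stronglyMeasurable
  rw [integral_comp_logRatio (G := fun u : ℝ => Complex.exp ((t * u : ℝ) * Complex.I)) hm]
  have hd : Integrable ratioDens := by
    have := (integrable_comp_logRatio_iff (G := fun _ => (1 : ℝ)) stronglyMeasurable_const).mp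
      (integrable_const _)
    simpa using this
  have hint : Integrable fun u : ℝ => ratioDens u • Complex.exp ((t * u : ℝ) * Complex.I) := by
    refine (hd.ofReal.bdd_mul (c := 1) hm.aestronglyMeasurable
      (Eventually.of_forall fun u => ?_)).congr (Eventually.of_forall fun u => ?_)
    · rw [Complex.norm_exp_ofReal_mul_I]
    · exact (mul_comm _ _).trans (Complex.real_smul).symm
  have hneg := integral_comp_neg_Ioi 0
    (fun u : ℝ => ratioDens u • Complex.exp ((t * u : ℝ) * Complex.I))
  rw [neg_zero] at hneg
  have hint2 : IntegrableOn (fun u : ℝ => ratioDens (-u) •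
      Complex.exp ((t * -u : ℝ) * Complex.I)) (Ioi 0) := hint.comp_neg.integrableOn
  rw [← integral_add_compl measurableSet_Ioi hint (s := Ioi (0 : ℝ)), compl_Ioi, ← hneg,
    ← integral_add hint.integrableOn hint2]
  have h1 : ∫ u in Ioi (0 : ℝ), (ratioDens u • Complex.exp ((t * u : ℝ) * Complex.I) +
      ratioDens (-u) • Complex.exp ((t * -u : ℝ) * Complex.I)) =
      ((2 * √3 * (2 * ∫ u in Ioi (0 : ℝ), Real.cos (t * u) * realKern 0 u) : ℝ) : ℂ) := by
    rw [← integral_const_mul, ← integral_const_mul, ← integral_complex_ofReal]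
    refine setIntegral_congr_fun measurableSet_Ioi fun u hu => ?_
    have hc : Complex.cos ((t * u : ℝ)) = (Complex.exp ((t * u : ℝ) * Complex.I) +
      Complex.exp (-(t * u : ℝ) * Complex.I)) / 2 := rfl
    have e : ((t * -u : ℝ) : ℂ) = -(t * u : ℝ) := by push_cast; ring
    simp only [ratioDens_neg, Complex.real_smul, ratioDens_eq hu]
    rw [e, Complex.ofReal_mul, Complex.ofReal_mul _ (2 * _), Complex.ofReal_mul 2 (_ * _),
      Complex.ofReal_mul (Real.cos _), Complex.ofReal_cos, hc]
    push_cast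
    ring
  have h2 := pair_taylorS_momentFun t 0
  rw [pair, zero_add, Finset.sum_range_one, coeff_taylorS_momentFun, kernInt_add_kernInt] at h2
  have h3 : dens 1 0 = 1 := by
    have := dens_odd_even 0 0
    simpa [MahlerQ.d] using this
  rw [h3] at h2
  rw [h1, Complex.ofReal_mul]
  simp only [Nat.factorial_zero, Nat.cast_one, pow_zero, pow_one, mul_one, one_mul, div_one,
    Complex.ofReal_one] at h2
  rw [h2]
  push_cast
  linear_combination (2 / 3 * Real.pi * (1 / (2 * Complex.cosh (Real.pi * t / 3) - 1))) *
    sqrt_three_sq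

end
end MahlerProof

-- Jensen's formula and independence on the torus

namespace MahlerProof
noncomputable section
open MeasureTheory Set Filter Topology

/-- Lebesgue measure on `[0, 2π] ^ N`. -/
def torusMeasure (N : ℕ) : Measure (Fin N → ℝ) := Measure.pi fun _ => circleMeasure

instance (N : ℕ) : IsFiniteMeasure (torusMeasure N) := by
  unfold torusMeasure; infer_instance

theorem volume_restrict_Icc_eq_torusMeasure (N : ℕ) :
    (volume : Measure (Fin N → ℝ)).restrict (Icc 0 (fun _ => 2 * Real.pi)) = torusMeasure N := by
  rw [← pi_univ_Icc]
  exact Measure.restrict_pi_pi (fun _ => volume) _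

theorem measurePreserving_split (N : ℕ) :
    MeasurePreserving (MeasurableEquiv.piFinSuccAbove (fun _ => ℝ) (Fin.last N))
      (torusMeasure (N + 1)) (circleMeasure.prod (torusMeasure N)) :=
  measurePreserving_piFinSuccAbove (fun _ => circleMeasure) (Fin.last N)

/-- The product of the factors `(e^{iθ_j} + ω) / (e^{iθ_j} + 1)`. -/
def prodRatio {N : ℕ} (x : Fin N → ℝ) : ℂ := ∏ j, ratio (x j)

theorem measurable_prodRatio (N : ℕ) : Measurable (prodRatio (N := N)) :=
  Finset.measurable_prod _ fun j _ => measurable_ratio.comp (measurable_pi_apply j)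

theorem ratQ_torusPoint (N : ℕ) (θ : Fin (N + 1) → ℝ) :
    MahlerQ.ratQ N (MahlerQ.torusPoint θ) =
      Complex.exp ((((MeasurableEquiv.piFinSuccAbove (fun _ => ℝ) (Fin.last N)) θ).1 : ℂ) *
        Complex.I) + prodRatio ((MeasurableEquiv.piFinSuccAbove (fun _ => ℝ) (Fin.last N)) θ).2 := by
  have h : ∀ j : Fin N, ((MeasurableEquiv.piFinSuccAbove (fun _ => ℝ) (Fin.last N)) θ).2 j =
      θ j.castSucc := by
    intro j
    rw [← Fin.succAbove_last_apply]
    rfl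
  simp only [MahlerQ.ratQ, MahlerQ.torusPoint, prodRatio, ratio, h]
  rfl

theorem integrable_log_norm_exp_add (c : ℂ) :
    Integrable (fun y : ℝ => Real.log ‖Complex.exp (y * Complex.I) + c‖) circleMeasure := by
  have h := circleIntegrable_log_norm_sub_const (a := -c) (c := 0) 1
  rw [CircleIntegrable, intervalIntegrable_iff_integrableOn_Icc_of_le Real.two_pi_pos.le] at h
  refine h.congr (Eventually.of_forall fun y => ?_)
  simp [circleMap]

theorem integral_log_norm_exp_add (c : ℂ) :
    ∫ y : ℝ, Real.log ‖Complex.exp (y * Complex.I) + c‖ ∂circleMeasure =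
      2 * Real.pi * Real.posLog ‖c‖ := by
  have h := circleAverage_log_norm_add_const_eq_posLog (a := c)
  rw [Real.circleAverage_def, intervalIntegral.integral_of_le Real.two_pi_pos.le,
    ← integral_Icc_eq_integral_Ioc, smul_eq_mul, inv_mul_eq_iff_eq_mul₀ Real.two_pi_pos.ne'] at h
  rw [← h]
  simp [circleMeasure, circleMap]

theorem circleMeasure_real_univ : circleMeasure.real univ = 2 * Real.pi := by
  simp [circleMeasure, Measure.real, Real.pi_pos.le]

/-- From `|log r| = 2 log⁺ r - log r`, with `log⁺` bounded by the triangle inequality and the mean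
of `log` given by Jensen. This is the `L¹` bound that Fubini's theorem needs. -/
theorem integral_norm_log_norm_exp_add_le (c : ℂ) :
    ∫ y : ℝ, ‖Real.log ‖Complex.exp (y * Complex.I) + c‖‖ ∂circleMeasure ≤
      2 * Real.pi * (2 * Real.log 2 + Real.posLog ‖c‖) := by
  have hint := integrable_log_norm_exp_add c
  have hle : ∀ y : ℝ, ‖Real.log ‖Complex.exp (y * Complex.I) + c‖‖ ≤
      2 * (Real.log 2 + Real.posLog ‖c‖) - Real.log ‖Complex.exp (y * Complex.I) + c‖ := by
    intro y
    have h1 := Real.posLog_norm_add_le (Complex.exp (y * Complex.I)) c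
    rw [Complex.norm_exp_ofReal_mul_I, Real.posLog_one, zero_add] at h1
    have h2 := Real.half_mul_log_add_log_abs (x := ‖Complex.exp (y * Complex.I) + c‖)
    rw [Real.norm_eq_abs]
    linarith
  refine (integral_mono hint.norm ((integrable_const _).sub hint) hle).trans (le_of_eq ?_)
  simp only [Pi.sub_apply]
  rw [integral_sub (integrable_const _) hint, integral_log_norm_exp_add, integral_const,
    circleMeasure_real_univ, smul_eq_mul]
  ring

/-- The sum of the functions `log |(e^{iθ_j} + ω) / (e^{iθ_j} + 1)|`. -/
def logSum {N : ℕ} (x : Fin N → ℝ) : ℝ := ∑ j, logRatio (x j)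

theorem measurable_logSum (N : ℕ) : Measurable (logSum (N := N)) :=
  Finset.measurable_sum _ fun j _ => measurable_logRatio.comp (measurable_pi_apply j)

theorem prod_ite_eq_logRatio {N : ℕ} (j : Fin N) (x : Fin N → ℝ) :
    ∏ i, (if i = j then logRatio else fun _ => 1) (x i) = logRatio (x j) := by
  rw [Finset.prod_eq_single j (fun i _ hi => by rw [if_neg hi]) (by simp), if_pos rfl]

theorem integrable_logRatio_eval {N : ℕ} (j : Fin N) :
    Integrable (fun x : Fin N → ℝ => logRatio (x j)) (torusMeasure N) := by
  have h := Integrable.fintype_prod (μ := fun _ : Fin N => circleMeasure)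
    (f := fun i => if i = j then logRatio else fun _ => 1)
    (fun i => by
      split_ifs
      · exact integrable_logRatio
      · exact integrable_const _)
  simp only [prod_ite_eq_logRatio] at h
  exact h

theorem integral_logRatio_eval {N : ℕ} (j : Fin N) :
    ∫ x : Fin N → ℝ, logRatio (x j) ∂torusMeasure N = 0 := by
  have h := integral_fintype_prod_eq_prod (μ := fun _ : Fin N => circleMeasure)
    (fun i => if i = j then logRatio else fun _ => 1)
  simp only [prod_ite_eq_logRatio] at h
  rw [torusMeasure, h]
  refine Finset.prod_eq_zero (Finset.mem_univ j) ?_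
  simp [integral_logRatio]

theorem integrable_logSum (N : ℕ) : Integrable (logSum (N := N)) (torusMeasure N) :=
  integrable_finsetSum _ fun j _ => integrable_logRatio_eval j

theorem integral_logSum (N : ℕ) : ∫ x, logSum x ∂torusMeasure N = 0 := by
  simp only [logSum]
  rw [integral_finsetSum _ fun j _ => integrable_logRatio_eval j]
  simp [integral_logRatio_eval]

theorem ae_log_norm_prodRatio (N : ℕ) :
    ∀ᵐ x ∂torusMeasure N, Real.log ‖prodRatio x‖ = logSum x := by
  -- Points with a vanishing factor must be discarded: there `log 0 = 0` would break additivity.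
  have h : ∀ᵐ x ∂torusMeasure N, ∀ j : Fin N, ratio (x j) ≠ 0 := by
    rw [ae_all_iff]
    intro j
    exact (Measure.quasiMeasurePreserving_eval (fun _ : Fin N => circleMeasure) j).ae
      ae_ratio_ne_zero
  filter_upwards [h] with x hx
  rw [prodRatio, norm_prod, Real.log_prod fun j _ => norm_ne_zero_iff.mpr (hx j)]
  rfl

theorem ae_posLog_norm_prodRatio (N : ℕ) :
    ∀ᵐ x ∂torusMeasure N, Real.posLog ‖prodRatio x‖ = 2⁻¹ * (logSum x + |logSum x|) := by
  filter_upwards [ae_log_norm_prodRatio N] with x hx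
  rw [← Real.half_mul_log_add_log_abs, hx]

theorem integrable_posLog_norm_prodRatio (N : ℕ) :
    Integrable (fun x => Real.posLog ‖prodRatio x‖) (torusMeasure N) :=
  (((integrable_logSum N).add (integrable_logSum N).abs).const_mul 2⁻¹).congr
    ((ae_posLog_norm_prodRatio N).mono fun _ hx => hx.symm)

theorem integral_posLog_norm_prodRatio (N : ℕ) :
    ∫ x, Real.posLog ‖prodRatio x‖ ∂torusMeasure N = 1 / 2 * ∫ x, |logSum x| ∂torusMeasure N := by
  rw [integral_congr_ae (ae_posLog_norm_prodRatio N), integral_const_mul,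
    integral_add (integrable_logSum N) (integrable_logSum N).abs, integral_logSum]
  ring

theorem measurable_log_norm_prod (N : ℕ) : Measurable fun z : ℝ × (Fin N → ℝ) =>
    Real.log ‖Complex.exp (z.1 * Complex.I) + prodRatio z.2‖ := by
  have h : Measurable fun z : ℝ × (Fin N → ℝ) => prodRatio z.2 :=
    (measurable_prodRatio N).comp measurable_snd
  have h2 : Measurable fun z : ℝ × (Fin N → ℝ) => Complex.exp (z.1 * Complex.I) := by fun_prop
  exact Real.measurable_log.comp (h2.add h).norm

theorem integrable_log_norm_prod (N : ℕ) :
    Integrable (fun z : ℝ × (Fin N → ℝ) =>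
      Real.log ‖Complex.exp (z.1 * Complex.I) + prodRatio z.2‖)
      (circleMeasure.prod (torusMeasure N)) := by
  have hm := measurable_log_norm_prod N
  have hb : Integrable (fun x : Fin N → ℝ => 2 * Real.pi * (2 * Real.log 2 +
      Real.posLog ‖prodRatio x‖)) (torusMeasure N) := by
    refine Integrable.const_mul (Integrable.add (integrable_const _) ?_) _
    exact integrable_posLog_norm_prodRatio N
  have hm2 : AEStronglyMeasurable (fun x : Fin N → ℝ => ∫ y : ℝ,
      ‖Real.log ‖Complex.exp (y * Complex.I) + prodRatio x‖‖ ∂circleMeasure) (torusMeasure N) :=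
    StronglyMeasurable.aestronglyMeasurable
      (StronglyMeasurable.integral_prod_left' (μ := circleMeasure) hm.norm.stronglyMeasurable)
  rw [integrable_prod_iff' hm.aestronglyMeasurable]
  refine ⟨Eventually.of_forall fun x => integrable_log_norm_exp_add (prodRatio x), ?_⟩
  refine hb.mono' hm2 (Eventually.of_forall fun x => ?_)
  rw [Real.norm_of_nonneg (integral_nonneg fun y => norm_nonneg _)]
  exact integral_norm_log_norm_exp_add_le (prodRatio x)

theorem mahlerIntegrable_ratQ (N : ℕ) : MahlerQ.MahlerIntegrable (MahlerQ.ratQ N) := by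
  rw [MahlerQ.MahlerIntegrable, IntegrableOn, volume_restrict_Icc_eq_torusMeasure]
  simp only [ratQ_torusPoint]
  exact (measurePreserving_split N).integrable_comp_of_integrable (integrable_log_norm_prod N)

/-- The integral over `y` gives `2π log⁺`, which lowers the exponent of `2π` from `N + 1` to `N`;
the signed half of `log⁺` integrates to zero. -/
theorem mahlerMeasure_ratQ (N : ℕ) : MahlerQ.mahlerMeasure (MahlerQ.ratQ N) =
    1 / (2 * Real.pi) ^ N * (1 / 2 * ∫ x, |logSum x| ∂torusMeasure N) := by
  have h := (measurePreserving_split N).integral_comp' (g := fun z : ℝ × (Fin N → ℝ) =>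
      Real.log ‖Complex.exp (z.1 * Complex.I) + prodRatio z.2‖)
  rw [MahlerQ.mahlerMeasure, volume_restrict_Icc_eq_torusMeasure]
  simp only [ratQ_torusPoint]
  rw [h, integral_prod_symm _ (integrable_log_norm_prod N)]
  simp only [integral_log_norm_exp_add]
  rw [integral_const_mul, integral_posLog_norm_prodRatio, pow_succ]
  have := Real.pi_pos.ne'
  field_simp

theorem integral_exp_logSum (N : ℕ) (t : ℝ) :
    ∫ x, Complex.exp ((t * logSum x : ℝ) * Complex.I) ∂torusMeasure N =
      (2 * Real.pi * (1 / (2 * Complex.cosh (Real.pi * t / 3) - 1))) ^ N := by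
  have h := integral_fintype_prod_eq_pow (ι := Fin N) (μ := circleMeasure)
    (fun θ => Complex.exp ((t * logRatio θ : ℝ) * Complex.I))
  rw [integral_exp_logRatio, Fintype.card_fin] at h
  rw [← h, torusMeasure]
  refine integral_congr_ae (Eventually.of_forall fun x => ?_)
  simp only
  rw [← Complex.exp_sum, ← Finset.sum_mul, ← Complex.ofReal_sum, ← Finset.mul_sum]
  rfl

theorem integral_cos_logSum (N : ℕ) (t : ℝ) :
    ∫ x, Real.cos (t * logSum x) ∂torusMeasure N =
      (2 * Real.pi * (1 / (2 * Real.cosh (Real.pi * t / 3) - 1))) ^ N := by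
  have hint : Integrable (fun x => Complex.exp ((t * logSum x : ℝ) * Complex.I))
      (torusMeasure N) := by
    have hm : Measurable fun x : Fin N → ℝ => Complex.exp ((t * logSum x : ℝ) * Complex.I) := by
      have := measurable_logSum N
      fun_prop
    refine (integrable_const (1 : ℝ)).mono' hm.aestronglyMeasurable
      (Eventually.of_forall fun x => ?_)
    rw [Complex.norm_exp_ofReal_mul_I]
  have h := congrArg Complex.re (integral_exp_logSum N t)
  rw [← RCLike.re_eq_complex_re, ← integral_re hint] at h
  simp only [RCLike.re_eq_complex_re, Complex.exp_ofReal_mul_I_re] at h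
  rw [h]
  have e : (2 * Real.pi * (1 / (2 * Complex.cosh (Real.pi * t / 3) - 1)) : ℂ) ^ N =
      (((2 * Real.pi * (1 / (2 * Real.cosh (Real.pi * t / 3) - 1))) ^ N : ℝ) : ℂ) := by
    push_cast; rfl
  rw [e, Complex.ofReal_re]

end
end MahlerProof

-- The absolute moment from the cosine transform

namespace MahlerProof
noncomputable section
open MeasureTheory Set Filter Topology

theorem integrableOn_one_sub_cos_div_sq :
    IntegrableOn (fun t : ℝ => (1 - Real.cos t) / t ^ 2) (Ioi 0) := by
  refine (integrable_inv_one_add_sq.const_mul 4).integrableOn.mono'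
    (by fun_prop : Measurable fun t : ℝ => (1 - Real.cos t) / t ^ 2).aestronglyMeasurable ?_
  filter_upwards [ae_restrict_mem measurableSet_Ioi] with t ht
  have ht' : 0 < t := ht
  have h0 := Real.cos_le_one t
  have h1 := Real.neg_one_le_cos t
  have h2 := Real.one_sub_sq_div_two_le_cos (x := t)
  rw [Real.norm_of_nonneg (div_nonneg (by linarith) (by positivity)), ← div_eq_mul_inv,
    div_le_div_iff₀ (by positivity) (by positivity)]
  nlinarith [sq_nonneg t]

/-- The constant `∫ (1 - cos t) / t ^ 2` over the positive half-line. -/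
def cosConst : ℝ := ∫ t in Ioi (0 : ℝ), (1 - Real.cos t) / t ^ 2

/-- The constant is cancelled in the end, so its positivity suffices and its value is not needed. -/
theorem cosConst_pos : 0 < cosConst := by
  have hnn : ∀ t : ℝ, 0 ≤ (1 - Real.cos t) / t ^ 2 := fun t =>
    div_nonneg (by linarith [Real.cos_le_one t]) (sq_nonneg t)
  rw [cosConst, setIntegral_pos_iff_support_of_nonneg_ae (Eventually.of_forall hnn)
    integrableOn_one_sub_cos_div_sq]
  refine lt_of_lt_of_le ?_ (measure_mono (s := Ioo (0 : ℝ) 1) fun t ht => ⟨?_, ht.1⟩)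
  · simp
  · have h : Real.cos t < Real.cos 0 :=
      Real.cos_lt_cos_of_nonneg_of_le_pi le_rfl (by linarith [ht.2, Real.pi_gt_three]) ht.1
    rw [Real.cos_zero] at h
    have ht0 := ht.1
    exact (div_pos (by linarith) (by positivity)).ne'

theorem one_sub_cos_mul_div_sq {x : ℝ} (hx : x ≠ 0) (t : ℝ) :
    (1 - Real.cos (t * x)) / t ^ 2 =
      |x| ^ 2 * ((1 - Real.cos (|x| * t)) / (|x| * t) ^ 2) := by
  have h : Real.cos (|x| * t) = Real.cos (t * x) := by
    rw [← Real.cos_abs (|x| * t), abs_mul, abs_abs, ← abs_mul, Real.cos_abs, mul_comm]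
  have hx' := abs_ne_zero.mpr hx
  rw [h, mul_pow]
  by_cases ht : t = 0
  · simp [ht]
  · field_simp

theorem integrableOn_one_sub_cos_mul_div_sq (x : ℝ) :
    IntegrableOn (fun t : ℝ => (1 - Real.cos (t * x)) / t ^ 2) (Ioi 0) := by
  by_cases hx : x = 0
  · simp [hx]
  · simp only [one_sub_cos_mul_div_sq hx]
    refine Integrable.const_mul ?_ _
    have h := (integrableOn_Ioi_comp_mul_left_iff (fun t : ℝ => (1 - Real.cos t) / t ^ 2) 0
      (abs_pos.mpr hx)).mpr (by rw [mul_zero]; exact integrableOn_one_sub_cos_div_sq)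
    exact h

theorem integral_one_sub_cos_mul_div_sq (x : ℝ) :
    ∫ t in Ioi (0 : ℝ), (1 - Real.cos (t * x)) / t ^ 2 = cosConst * |x| := by
  by_cases hx : x = 0
  · simp [hx]
  · simp only [one_sub_cos_mul_div_sq hx]
    rw [integral_const_mul, integral_comp_mul_left_Ioi (fun t : ℝ => (1 - Real.cos t) / t ^ 2) 0
      (abs_pos.mpr hx), mul_zero, smul_eq_mul, ← cosConst]
    have hx' := abs_ne_zero.mpr hx
    field_simp

/-- Fubini. Since `1 - cos ≥ 0`, the `L¹` norm in `t` is again `cosConst` times the absolute value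
of the integrand on the right, which gives integrability on the product even for signed `w`. -/
theorem integral_integral_one_sub_cos {Ω : Type*} [MeasurableSpace Ω] {μ : Measure Ω} [SFinite μ]
    {X w : Ω → ℝ} (hX : Measurable X) (hw : Measurable w)
    (hint : Integrable (fun ω => |X ω| * w ω) μ) :
    ∫ t in Ioi (0 : ℝ), (∫ ω, (1 - Real.cos (t * X ω)) * w ω ∂μ) / t ^ 2 =
      cosConst * ∫ ω, |X ω| * w ω ∂μ := by
  have hm : Measurable fun z : ℝ × Ω => (1 - Real.cos (z.1 * X z.2)) / z.1 ^ 2 * w z.2 := by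
    fun_prop
  have hnorm : ∀ ω, ∫ t in Ioi (0 : ℝ), ‖(1 - Real.cos (t * X ω)) / t ^ 2 * w ω‖ =
      cosConst * ‖|X ω| * w ω‖ := by
    intro ω
    have h : ∀ t : ℝ, ‖(1 - Real.cos (t * X ω)) / t ^ 2 * w ω‖ =
        (1 - Real.cos (t * X ω)) / t ^ 2 * ‖w ω‖ := fun t => by
      rw [norm_mul, Real.norm_of_nonneg
        (div_nonneg (by linarith [Real.cos_le_one (t * X ω)]) (sq_nonneg t))]
    simp only [h]
    rw [integral_mul_const, integral_one_sub_cos_mul_div_sq, norm_mul, Real.norm_eq_abs |X ω|,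
      abs_abs]
    ring
  have hF : Integrable (fun z : ℝ × Ω => (1 - Real.cos (z.1 * X z.2)) / z.1 ^ 2 * w z.2)
      ((volume.restrict (Ioi 0)).prod μ) := by
    rw [integrable_prod_iff' hm.aestronglyMeasurable]
    refine ⟨Eventually.of_forall fun ω =>
      Integrable.mul_const (integrableOn_one_sub_cos_mul_div_sq (X ω)) (w ω), ?_⟩
    simp only [hnorm]
    exact hint.norm.const_mul _
  have hswap := integral_integral_swap
    (f := fun t ω => (1 - Real.cos (t * X ω)) / t ^ 2 * w ω) hF
  rw [← integral_const_mul]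
  refine Eq.trans ?_ (hswap.trans ?_)
  · refine integral_congr_ae (Eventually.of_forall fun t => ?_)
    simp only
    rw [← integral_div]
    congr 1
    funext ω
    ring
  · congr 1
    funext ω
    rw [integral_mul_const, integral_one_sub_cos_mul_div_sq]
    ring

/-- The absolute moment is determined by the cosine transform. -/
theorem integral_abs_mul_eq_of_integral_cos_eq {Ω Ω' : Type*} [MeasurableSpace Ω]
    [MeasurableSpace Ω'] {μ : Measure Ω} {ν : Measure Ω'} [SFinite μ] [SFinite ν]
    {X w : Ω → ℝ} {Y v : Ω' → ℝ} (hX : Measurable X) (hw : Measurable w) (hY : Measurable Y)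
    (hv : Measurable v) (hwi : Integrable w μ) (hvi : Integrable v ν)
    (hXw : Integrable (fun ω => |X ω| * w ω) μ) (hYv : Integrable (fun ω => |Y ω| * v ω) ν)
    (h : ∀ t : ℝ, ∫ ω, Real.cos (t * X ω) * w ω ∂μ = ∫ ω, Real.cos (t * Y ω) * v ω ∂ν) :
    ∫ ω, |X ω| * w ω ∂μ = ∫ ω, |Y ω| * v ω ∂ν := by
  -- At `t = 0` the hypothesis equates the total masses, so it passes from `cos` to `1 - cos`.
  have h0 : ∫ ω, w ω ∂μ = ∫ ω, v ω ∂ν := by simpa using h 0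
  have hc : ∀ t : ℝ, ∫ ω, (1 - Real.cos (t * X ω)) * w ω ∂μ =
      ∫ ω, (1 - Real.cos (t * Y ω)) * v ω ∂ν := by
    intro t
    have h1 : Integrable (fun ω => Real.cos (t * X ω) * w ω) μ :=
      hwi.bdd_mul (c := 1) (by fun_prop) (Eventually.of_forall fun ω => by
        rw [Real.norm_eq_abs]; exact Real.abs_cos_le_one _)
    have h2 : Integrable (fun ω => Real.cos (t * Y ω) * v ω) ν :=
      hvi.bdd_mul (c := 1) (by fun_prop) (Eventually.of_forall fun ω => by
        rw [Real.norm_eq_abs]; exact Real.abs_cos_le_one _)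
    simp only [sub_mul, one_mul]
    rw [integral_sub hwi h1, integral_sub hvi h2, h0, h t]
  have h1 := integral_integral_one_sub_cos hX hw hXw
  have h2 := integral_integral_one_sub_cos hY hv hYv
  simp only [hc] at h1
  exact mul_left_cancel₀ cosConst_pos.ne' (h1.symm.trans h2)

/-- A weight on the positive half-line with the cosine transform of the law of `logSum`. -/
def sumWeight (N : ℕ) (u : ℝ) : ℝ :=
  2 * √3 / Real.pi / (2 * √3) ^ N *
    ∑ k ∈ Finset.range (N + 1), dens (N + 1) k * (3 / Real.pi) ^ k * realKern k u

theorem measurable_sumWeight (N : ℕ) : Measurable (sumWeight N) :=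
  (Finset.measurable_sum _ fun k _ => (measurable_realKern k).const_mul _).const_mul _

theorem integrableOn_sumWeight (N : ℕ) : IntegrableOn (sumWeight N) (Ioi 0) :=
  (integrable_finsetSum _ fun k _ => (integrableOn_realKern k).const_mul _).const_mul _

/-- Integration of the weight against a factor `g`. -/
theorem mul_sumWeight (N : ℕ) (g : ℝ → ℝ) (u : ℝ) : g u * sumWeight N u =
    2 * √3 / Real.pi / (2 * √3) ^ N * ∑ k ∈ Finset.range (N + 1),
      dens (N + 1) k * (3 / Real.pi) ^ k * (g u * realKern k u) := by
  rw [sumWeight, mul_left_comm, Finset.mul_sum]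
  congr 1
  exact Finset.sum_congr rfl fun k _ => by ring

theorem integral_mul_sumWeight (N : ℕ) {g : ℝ → ℝ}
    (hg : ∀ k, IntegrableOn (fun u => g u * realKern k u) (Ioi 0)) :
    ∫ u in Ioi (0 : ℝ), g u * sumWeight N u =
      2 * √3 / Real.pi / (2 * √3) ^ N * ∑ k ∈ Finset.range (N + 1),
        dens (N + 1) k * (3 / Real.pi) ^ k * ∫ u in Ioi (0 : ℝ), g u * realKern k u := by
  simp only [mul_sumWeight]
  rw [integral_const_mul, integral_finsetSum _ fun k _ => (hg k).const_mul _]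
  congr 1
  exact Finset.sum_congr rfl fun k _ => integral_const_mul _ _

/-- Each Taylor coefficient is `(3/π)^k / k!` times twice a cosine transform, and the factor `k!` in
`pair` cancels the factorial; the prefactor of `sumWeight` normalizes the constant. -/
theorem integral_cos_mul_sumWeight (N : ℕ) (t : ℝ) :
    ∫ u in Ioi (0 : ℝ), Real.cos (t * u) * sumWeight N u =
      (1 / (2 * Real.cosh (Real.pi * t / 3) - 1)) ^ (N + 1) := by
  rw [integral_mul_sumWeight N fun k => integrableOn_cos_mul_realKern k t]
  have h := pair_taylorS_momentFun t N
  simp only [pair, coeff_taylorS_momentFun, kernInt_add_kernInt] at h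
  have h2 : ∑ k ∈ Finset.range (N + 1), dens (N + 1) k * (3 / Real.pi) ^ k *
      ∫ u in Ioi (0 : ℝ), Real.cos (t * u) * realKern k u =
      1 / 2 * (Real.pi / 3 * √3 * (2 * √3) ^ N *
        (1 / (2 * Real.cosh (Real.pi * t / 3) - 1)) ^ (N + 1)) := by
    apply Complex.ofReal_injective
    push_cast
    rw [← h, Finset.mul_sum]
    refine Finset.sum_congr rfl fun k _ => ?_
    have hk : (k.factorial : ℂ) ≠ 0 := by exact_mod_cast k.factorial_ne_zero
    push_cast
    field_simp
  rw [h2]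
  have h3 := sqrt_three_pos.ne'
  have h4 := Real.pi_pos.ne'
  have h5 : (√3 : ℝ) ^ 2 = 3 := Real.sq_sqrt (by norm_num)
  generalize (1 / (2 * Real.cosh (Real.pi * t / 3) - 1)) ^ (N + 1) = φ
  field_simp
  linear_combination φ * h5

/-- The weight need not be known to be a density or even nonnegative: equal cosine transforms are
enough. -/
theorem integral_abs_logSum (N : ℕ) :
    1 / (2 * Real.pi) ^ (N + 1) * ∫ x, |logSum x| ∂torusMeasure (N + 1) =
      ∫ u in Ioi (0 : ℝ), |u| * sumWeight N u := by
  have hp : (2 * Real.pi) ^ (N + 1) ≠ 0 := (pow_pos Real.two_pi_pos _).ne'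
  have habs : IntegrableOn (fun u => |u| * sumWeight N u) (Ioi 0) := by
    simp only [mul_sumWeight N fun u => |u|]
    refine (integrable_finsetSum _ fun k _ => Integrable.const_mul ?_ _).const_mul _
    refine (integrableOn_id_mul_realKern k).congr ?_
    filter_upwards [ae_restrict_mem measurableSet_Ioi] with u hu
    rw [abs_of_pos hu]
  have h := integral_abs_mul_eq_of_integral_cos_eq (μ := torusMeasure (N + 1))
    (ν := volume.restrict (Ioi (0 : ℝ))) (X := logSum)
    (w := fun _ => 1 / (2 * Real.pi) ^ (N + 1)) (Y := fun u => u) (v := sumWeight N)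
    (measurable_logSum _) measurable_const measurable_id (measurable_sumWeight N)
    (integrable_const _) (integrableOn_sumWeight N) ((integrable_logSum _).abs.mul_const _) habs
    (fun t => by
      rw [integral_mul_const, integral_cos_logSum, integral_cos_mul_sumWeight, mul_pow]
      field_simp)
  rw [← h, integral_mul_const, mul_comm]

theorem mahlerMeasure_ratQ_succ (N : ℕ) : MahlerQ.mahlerMeasure (MahlerQ.ratQ (N + 1)) =
    1 / (2 * √3) ^ N * ∑ k ∈ Finset.range (N + 1), dens (N + 1) k *
      (√3 / Real.pi * (3 / Real.pi) ^ k * ∫ u in Ioi (0 : ℝ), u * realKern k u) := by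
  have e : ∫ u in Ioi (0 : ℝ), |u| * sumWeight N u = ∫ u in Ioi (0 : ℝ), u * sumWeight N u :=
    setIntegral_congr_fun measurableSet_Ioi fun u hu => by simp only [abs_of_pos (mem_Ioi.mp hu)]
  rw [mahlerMeasure_ratQ, mul_left_comm, integral_abs_logSum, e,
    integral_mul_sumWeight N integrableOn_id_mul_realKern, Finset.mul_sum, Finset.mul_sum,
    Finset.mul_sum]
  exact Finset.sum_congr rfl fun k _ => by ring

end
end MahlerProof

-- The formulas for even and odd `N`, rationality, and the first two cases

namespace MahlerProof
noncomputable section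
open Set

theorem sum_range_moment_even (n : ℕ) (f : ℕ → ℝ) :
    ((∑ h ∈ Finset.range n, f h * (√3 / Real.pi * (3 / Real.pi) ^ (2 * h) *
      ∫ u in Ioi (0 : ℝ), u * realKern (2 * h) u) : ℝ) : ℂ) =
      ∑ h ∈ Finset.range n, (f h : ℂ) * ((-1) ^ h * (2 ^ (2 * h + 2) + 1) / 3 *
        deriv MahlerQ.chi3.LFunction (-2 * (h : ℂ) - 1)) := by
  rw [Complex.ofReal_sum]
  exact Finset.sum_congr rfl fun h _ => by
    rw [Complex.ofReal_mul, integral_id_mul_realKern_even]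

theorem sum_range_moment_odd (n : ℕ) (f : ℕ → ℝ) :
    ((∑ h ∈ Finset.range n, f h * (√3 / Real.pi * (3 / Real.pi) ^ (2 * h + 1) *
      ∫ u in Ioi (0 : ℝ), u * realKern (2 * h + 1) u) : ℝ) : ℂ) =
      ∑ h ∈ Finset.Icc 1 n, (f (h - 1) : ℂ) * ((-1) ^ h *
        ((3 ^ (2 * h + 1) - 1) * (2 ^ (2 * h + 1) - 1)) * ((√3 : ℝ) : ℂ) / 9 *
        deriv riemannZeta (-2 * (h : ℂ))) := by
  rw [Complex.ofReal_sum, ← Finset.Ico_add_one_right_eq_Icc, Finset.sum_Ico_eq_sum_range]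
  refine Finset.sum_congr rfl fun h _ => ?_
  have e : 2 * h + 1 = 2 * (1 + h) - 1 := by omega
  rw [Complex.ofReal_mul, e, integral_id_mul_realKern_odd (by omega : 1 ≤ 1 + h),
    Nat.add_sub_cancel_left]

/-- Odd indices carry `a` and give `ζ'`, even indices carry `b` and give `L'`. The factor `2` in
front comes from `(2√3)^{2n-1} = 12^n / (2√3)`. -/
theorem mahlerMeasure_ratQ_even {n : ℕ} (hn : 1 ≤ n) :
    (MahlerQ.mahlerMeasure (MahlerQ.ratQ (2 * n)) : ℂ) =
      2 / 12 ^ n *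
        (∑ h ∈ Finset.Icc 1 n,
            (-1) ^ h * (MahlerQ.a n (h - 1) : ℂ) / 3 *
              (3 ^ (2 * h + 1) - 1) * (2 ^ (2 * h + 1) - 1) *
              deriv riemannZeta (-2 * (h : ℂ))
          + ∑ h ∈ Finset.Icc 0 (n - 1),
            (-1) ^ h * (MahlerQ.b n h : ℂ) / ((√3 : ℝ) : ℂ) *
              (2 ^ (2 * h + 2) + 1) *
              deriv MahlerQ.chi3.LFunction (-2 * (h : ℂ) - 1)) := by
  have e : 2 * n = 2 * n - 1 + 1 := by omega
  have h1 : Finset.Icc 0 (n - 1) = Finset.range n := by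
    ext; simp only [Finset.mem_Icc, Finset.mem_range]; omega
  have h2 := mahlerMeasure_ratQ_succ (2 * n - 1)
  rw [← e, sum_range_even_add_odd] at h2
  simp only [dens_even_even, dens_even_odd] at h2
  have h3 : (2 * ((√3 : ℝ) : ℂ)) ^ (2 * n - 1) * (2 * ((√3 : ℝ) : ℂ)) = 12 ^ n := by
    rw [← pow_succ, ← e, pow_mul, mul_pow, sqrt_three_sq]; norm_num
  have h4 : 1 / (2 * ((√3 : ℝ) : ℂ)) ^ (2 * n - 1) = 2 * ((√3 : ℝ) : ℂ) / 12 ^ n := by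
    rw [← h3]
    have := sqrt_three_ne_zero
    field_simp
  have h5 : ∀ x : ℂ, x / ((√3 : ℝ) : ℂ) = x * ((√3 : ℝ) : ℂ) / 3 := fun x => by
    rw [← sqrt_three_sq]
    have := sqrt_three_ne_zero
    field_simp
  rw [h2, h1, Complex.ofReal_mul, Complex.ofReal_add, sum_range_moment_even,
    sum_range_moment_odd]
  push_cast
  rw [h4, add_comm, mul_div_right_comm, mul_assoc, mul_add]
  have h6 := sqrt_three_sq
  congr 1
  rw [Finset.mul_sum, Finset.mul_sum]
  congr 1
  · refine Finset.sum_congr rfl fun h _ => ?_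
    linear_combination ((MahlerQ.a n (h - 1) : ℂ) * ((-1) ^ h * ((3 ^ (2 * h + 1) - 1) * (2 ^ (2 * h + 1) - 1)) / 9 *
        deriv riemannZeta (-2 * (h : ℂ)))) * h6
  · exact Finset.sum_congr rfl fun h _ => by rw [h5]; ring

theorem mahlerMeasure_ratQ_odd (n : ℕ) :
    (MahlerQ.mahlerMeasure (MahlerQ.ratQ (2 * n + 1)) : ℂ) =
      1 / 12 ^ n *
        (∑ h ∈ Finset.Icc 1 n,
            (-1) ^ h * (MahlerQ.c n (h - 1) : ℂ) / (3 * ((√3 : ℝ) : ℂ)) *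
              (3 ^ (2 * h + 1) - 1) * (2 ^ (2 * h + 1) - 1) *
              deriv riemannZeta (-2 * (h : ℂ))
          + ∑ h ∈ Finset.Icc 0 n,
            (-1) ^ h * (MahlerQ.d n h : ℂ) / 3 *
              (2 ^ (2 * h + 2) + 1) *
              deriv MahlerQ.chi3.LFunction (-2 * (h : ℂ) - 1)) := by
  have h1 : Finset.Icc 0 n = Finset.range (n + 1) := by
    ext; simp only [Finset.mem_Icc, Finset.mem_range]; omega
  have h2 := mahlerMeasure_ratQ_succ (2 * n)
  rw [sum_range_even_add_odd_succ] at h2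
  simp only [dens_odd_even, dens_odd_odd] at h2
  have h3 : (2 * ((√3 : ℝ) : ℂ)) ^ (2 * n) = 12 ^ n := by
    rw [pow_mul, mul_pow, sqrt_three_sq]; norm_num
  have h5 : ∀ x : ℂ, x / (3 * ((√3 : ℝ) : ℂ)) = x * ((√3 : ℝ) : ℂ) / 9 := fun x => by
    have h6 := sqrt_three_sq
    have := sqrt_three_ne_zero
    field_simp
    linear_combination -3 * x * h6
  rw [h2, h1, Complex.ofReal_mul, Complex.ofReal_add, sum_range_moment_even,
    sum_range_moment_odd, add_comm]
  push_cast
  rw [h3]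
  congr 2
  · exact Finset.sum_congr rfl fun h _ => by rw [h5]; ring
  · exact Finset.sum_congr rfl fun h _ => by ring

/-- The real number `x` is a rational multiple of `c`. -/
def IsRatMul (c x : ℝ) : Prop := ∃ t : ℚ, x = c * t

theorem IsRatMul.add {c x y : ℝ} (hx : IsRatMul c x) (hy : IsRatMul c y) : IsRatMul c (x + y) := by
  obtain ⟨s, rfl⟩ := hx
  obtain ⟨t, rfl⟩ := hy
  exact ⟨s + t, by push_cast; ring⟩

theorem IsRatMul.mul_ratCast {c x : ℝ} (hx : IsRatMul c x) (q : ℚ) : IsRatMul c (x * q) := by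
  obtain ⟨s, rfl⟩ := hx
  exact ⟨s * q, by push_cast; ring⟩

theorem IsRatMul.zero (c : ℝ) : IsRatMul c 0 := ⟨0, by simp⟩

theorem IsRatMul.sum_mul {c : ℝ} (s : Finset ℕ) {f : ℕ → ℝ} (g : ℕ → ℚ)
    (hf : ∀ l, IsRatMul c (f l)) : IsRatMul c (∑ l ∈ s, f l * (g l : ℝ)) :=
  Finset.sum_induction _ _ (fun _ _ => IsRatMul.add) (IsRatMul.zero c)
    fun l _ => (hf l).mul_ratCast (g l)

theorem IsRatMul.one_div_three_mul {c x : ℝ} (hx : IsRatMul c x) : IsRatMul c (1 / 3 * x) := by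
  have := hx.mul_ratCast (1 / 3)
  rwa [mul_comm, Rat.cast_div, Rat.cast_one, Rat.cast_ofNat] at this

theorem IsRatMul.div_sqrt_three_mul {x : ℝ} (hx : IsRatMul (√3) x) : IsRatMul 1 (1 / √3 * x) := by
  obtain ⟨s, rfl⟩ := hx
  have := sqrt_three_pos.ne'
  exact ⟨s, by field_simp⟩

theorem IsRatMul.natCast_div_sqrt_three_mul {x : ℝ} (hx : IsRatMul 1 x) (k : ℕ) :
    IsRatMul (√3) (k / √3 * x) := by
  obtain ⟨s, rfl⟩ := hx
  have := sqrt_three_pos.ne'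
  have h5 : (√3 : ℝ) ^ 2 = 3 := Real.sq_sqrt (by norm_num)
  refine ⟨k * s / 3, ?_⟩
  push_cast
  field_simp
  linear_combination -(k * s : ℝ) * h5

/-- Every factor `1/√3` in the recursion exchanges `ℚ` and `√3 ℚ`, and it occurs exactly where the
sequences on the two sides belong to different classes. -/
theorem isRatMul_coeffs (n : ℕ) :
    ((∀ j, IsRatMul 1 (MahlerQ.a n j)) ∧ ∀ j, IsRatMul (√3) (MahlerQ.b n j)) ∧
      (∀ j, IsRatMul (√3) (MahlerQ.c n j)) ∧ ∀ j, IsRatMul 1 (MahlerQ.d n j) := by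
  induction n with
  | zero =>
    refine ⟨⟨fun j => ?_, fun j => ?_⟩, fun j => ?_, fun j => ?_⟩
    · rw [MahlerQ.a]; exact IsRatMul.zero _
    · rw [MahlerQ.b]; exact IsRatMul.zero _
    · rw [MahlerQ.c]; exact IsRatMul.zero _
    · cases j
      · rw [MahlerQ.d]; exact ⟨1, by simp⟩
      · rw [MahlerQ.d]; exact IsRatMul.zero _
  | succ n ih =>
    obtain ⟨-, hc, hd⟩ := ih
    have h1 : ∀ {x : ℝ}, IsRatMul 1 x → IsRatMul (√3) (1 / √3 * x) := fun hx => by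
      simpa using hx.natCast_div_sqrt_three_mul 1
    have h2 : ∀ {x : ℝ}, IsRatMul 1 x → IsRatMul (√3) (2 / √3 * x) := fun hx => by
      simpa using hx.natCast_div_sqrt_three_mul 2
    have ha : ∀ j, IsRatMul 1 (MahlerQ.a (n + 1) j) := fun j => by
      rw [MahlerQ.a]
      exact (IsRatMul.sum_mul _ _ fun l => hc _).div_sqrt_three_mul.add
        (IsRatMul.sum_mul _ _ fun l => hd _)
    have hb : ∀ j, IsRatMul (√3) (MahlerQ.b (n + 1) j) := fun j => by
      cases j
      · rw [MahlerQ.b]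
        exact (IsRatMul.sum_mul _ _ fun l => hc _).one_div_three_mul.add
          (h2 (IsRatMul.sum_mul _ _ fun l => hd _))
      · rw [MahlerQ.b]
        exact (IsRatMul.sum_mul _ _ fun l => hc _).add (h1 (IsRatMul.sum_mul _ _ fun l => hd _))
    refine ⟨⟨ha, hb⟩, fun j => ?_, fun j => ?_⟩
    · rw [MahlerQ.c]
      exact (h1 (IsRatMul.sum_mul _ _ fun l => ha _)).add (IsRatMul.sum_mul _ _ fun l => hb _)
    · cases j
      · rw [MahlerQ.d]
        have h3 := (IsRatMul.sum_mul (Finset.Icc 0 n) MahlerQ.constEven hb).div_sqrt_three_mul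
        refine (IsRatMul.sum_mul _ _ fun l => ha _).one_div_three_mul.add ?_
        -- The coefficient `2/√3` is obtained as two copies of `1/√3`.
        have h4 := h3.add h3
        rwa [← two_mul, ← mul_assoc, mul_one_div] at h4
      · rw [MahlerQ.d]
        exact (IsRatMul.sum_mul _ _ fun l => ha _).add
          (IsRatMul.sum_mul _ _ fun l => hb _).div_sqrt_three_mul

theorem recPoly_zero (c : ℚ) (g : ℕ → Polynomial ℚ) : MahlerQ.recPoly c g 0 = g 0 := by
  rw [MahlerQ.recPoly_eq]
  have h : (Finset.Icc 2 (0 + 1)).filter Odd = ∅ := by decide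
  rw [h, Finset.sum_empty, mul_zero, zero_add]

theorem evenPart_zero (w : ℕ → ℚ) :
    MahlerQ.evenPart w 0 = Polynomial.C (w 0) * Polynomial.X := by
  have h : (Finset.Icc 0 (0 + 1)).filter Even = {0} := by decide
  rw [MahlerQ.evenPart, h, Finset.sum_singleton]
  simp

theorem oddPart_zero (w : ℕ → ℚ) : MahlerQ.oddPart w 0 = Polynomial.C (w 1) := by
  have h : (Finset.Icc 1 (0 + 1)).filter Odd = {1} := by decide
  rw [MahlerQ.oddPart, h, Finset.sum_singleton]
  simp

theorem rpEven_zero_one : MahlerQ.rpEven 0 1 = 2 := by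
  simp [MahlerQ.rpEven, MahlerQ.r, MahlerQ.p, MahlerQ.coeffRPYZ, MahlerQ.polyR, MahlerQ.polyP,
    recPoly_zero, evenPart_zero]
  norm_num

theorem constEven_zero : MahlerQ.constEven 0 = 1 := by
  simp [MahlerQ.constEven, MahlerQ.s, MahlerQ.q, MahlerQ.coeffSQ, MahlerQ.polyS, MahlerQ.polyQ,
    recPoly_zero, oddPart_zero]
  norm_num

theorem a_one_zero : MahlerQ.a 1 0 = 2 := by
  rw [MahlerQ.a]
  simp [MahlerQ.d, rpEven_zero_one]

theorem b_one_zero : MahlerQ.b 1 0 = 2 / √3 := by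
  rw [MahlerQ.b]
  simp [MahlerQ.d, constEven_zero]

theorem mahlerMeasure_ratQ_one : (MahlerQ.mahlerMeasure (MahlerQ.ratQ 1) : ℂ) =
    5 / 3 * deriv MahlerQ.chi3.LFunction (-1) := by
  have h := mahlerMeasure_ratQ_odd 0
  rw [mul_zero, zero_add] at h
  rw [h]
  simp [MahlerQ.d]
  norm_num

theorem mahlerMeasure_ratQ_two : (MahlerQ.mahlerMeasure (MahlerQ.ratQ 2) : ℂ) =
    -182 / 9 * deriv riemannZeta (-2) + 5 / 9 * deriv MahlerQ.chi3.LFunction (-1) := by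
  have h := mahlerMeasure_ratQ_even (n := 1) le_rfl
  rw [mul_one] at h
  have h3 : (2 / ((√3 : ℝ) : ℂ)) / ((√3 : ℝ) : ℂ) = 2 / 3 := by
    rw [div_div, ← sq, sqrt_three_sq]
  rw [h, Finset.Icc_self, Finset.sum_singleton, Nat.sub_self, Finset.Icc_self,
    Finset.sum_singleton, a_one_zero, b_one_zero]
  push_cast
  rw [pow_zero, one_mul, h3]
  norm_num
  ring

end
end MahlerProof

theorem mainTheorem4 :
    (∀ n : ℕ, 1 ≤ n → MahlerQ.MahlerIntegrable (MahlerQ.ratQ n)) ∧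
    (∀ n : ℕ, 1 ≤ n →
      (MahlerQ.mahlerMeasure (MahlerQ.ratQ (2 * n)) : ℂ) =
        2 / 12 ^ n *
          (∑ h ∈ Finset.Icc 1 n,
              (-1) ^ h * (MahlerQ.a n (h - 1) : ℂ) / 3 *
                (3 ^ (2 * h + 1) - 1) * (2 ^ (2 * h + 1) - 1) *
                deriv riemannZeta (-2 * (h : ℂ))
            + ∑ h ∈ Finset.Icc 0 (n - 1),
              (-1) ^ h * (MahlerQ.b n h : ℂ) / ((√3 : ℝ) : ℂ) *
                (2 ^ (2 * h + 2) + 1) *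
                deriv MahlerQ.chi3.LFunction (-2 * (h : ℂ) - 1))) ∧
    (∀ n : ℕ,
      (MahlerQ.mahlerMeasure (MahlerQ.ratQ (2 * n + 1)) : ℂ) =
        1 / 12 ^ n *
          (∑ h ∈ Finset.Icc 1 n,
              (-1) ^ h * (MahlerQ.c n (h - 1) : ℂ) / (3 * ((√3 : ℝ) : ℂ)) *
                (3 ^ (2 * h + 1) - 1) * (2 ^ (2 * h + 1) - 1) *
                deriv riemannZeta (-2 * (h : ℂ))
            + ∑ h ∈ Finset.Icc 0 n,
              (-1) ^ h * (MahlerQ.d n h : ℂ) / 3 *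
                (2 ^ (2 * h + 2) + 1) *
                deriv MahlerQ.chi3.LFunction (-2 * (h : ℂ) - 1))) ∧
    (∀ n j : ℕ, j < n →
      (∃ t : ℚ, MahlerQ.a n j = t) ∧ (∃ t : ℚ, MahlerQ.b n j = √3 * t) ∧
        (∃ t : ℚ, MahlerQ.c n j = √3 * t)) ∧
    (∀ n k : ℕ, k ≤ n → ∃ t : ℚ, MahlerQ.d n k = t) ∧
    (MahlerQ.mahlerMeasure (MahlerQ.ratQ 1) : ℂ) =
      5 / 3 * deriv MahlerQ.chi3.LFunction (-1) ∧
    (MahlerQ.mahlerMeasure (MahlerQ.ratQ 2) : ℂ) =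
      -182 / 9 * deriv riemannZeta (-2) + 5 / 9 * deriv MahlerQ.chi3.LFunction (-1) := by
  refine ⟨fun n _ => MahlerProof.mahlerIntegrable_ratQ n,
    fun n hn => MahlerProof.mahlerMeasure_ratQ_even hn, MahlerProof.mahlerMeasure_ratQ_odd,
    fun n j _ => ?_, fun n k _ => ?_, MahlerProof.mahlerMeasure_ratQ_one,
    MahlerProof.mahlerMeasure_ratQ_two⟩
  · obtain ⟨⟨ha, hb⟩, hc, -⟩ := MahlerProof.isRatMul_coeffs n
    exact ⟨by simpa [MahlerProof.IsRatMul] using ha j, hb j, hc j⟩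
  · simpa [MahlerProof.IsRatMul] using (MahlerProof.isRatMul_coeffs n).2.2 k
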